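/- Chains of loops. Let $g\ge 1$. A chain of $g$ loops $\Gamma$ is the metric graph with vertices $w_0,\dots,w_g,v_1,\dots,v_{g+1}$, a bridge $\beta_k$ of length $n_k>0$ from $w_k$ to $v_{k+1}$ for $0\le k\le g$, and, for $1\le k\le g$, two edges (the $k$-th loop) of lengths $\ell_k>0$ and $m_k>0$ from $v_k$ to $w_k$. A divisor on $\Gamma$ is a finite formal integer combination of points. $\mathrm{PL}(\Gamma)$ is the set of continuous piecewise linear functions with integer slopes, and $\operatorname{div}\psi$ is the divisor whose coefficient at each point is the sum of the incoming slopes of $\psi$. Two divisors are equivalent if they differ by some $\operatorname{div}\psi$ with $\psi\in \mathrm{PL}(\Gamma)$. The rank of a divisor is its Baker–Norine rank. The class of a divisor $D$ of rank $r$ is vertex avoiding if for each $0\le i\le r$ there is a unique effective divisor $D_i\sim D$ with $D_i\ge i\,w_0+(r-i)\,v_{g+1}$, and this $D_i$ has degree exactly $i$ at $w_0$, degree exactly $r-i$ at $v_{g+1}$, and no chip at $v_1,w_1,\dots,v_g,w_g$. In this case choose $\psi_i\in\mathrm{PL}(\Gamma)$ with $D+\operatorname{div}\psi_i=D_i$ (unique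 up to an additive constant), and put $\psi_I=\sum_{i\in I}\psi_i$ for each multiset $I$ in $\{0,\dots,r\}$. A finite family of functions $\{f_j\}$ on $\Gamma$ is tropically independent if there are no real numbers $b_j$ such that the minimum of the values $f_j(x)+b_j$ occurs at least twice at every point $x\in\Gamma$. The conjecture. For integers $r,s,m\ge 1$ and $\rho\ge 0$ put $g=(r+1)s+\rho$ and $d=g+r-s$. The edge lengths of a chain of $g$ loops are called generic with constant $C$ if 1. $4g\,m_k<\ell_k$ for $1\le k\le g$, and there is no nontrivial relation $c_1m_1+\dots+c_gm_g=0$ with integers $|c_k|\le g+1$; 2. $C\,\ell_k<\min\{n_{k-1},n_k\}$ for $1\le k\le g$, and $$C\Big(\sum_{i=\alpha s+1}^{(\alpha+1)s}\ell_i+\sum_{i=\alpha s+1}^{(\alpha+1)s-1}n_i\Big)<\min\{n_{\alpha s},n_{(\alpha+1)s}\}\qquad\text{for } 0\le\alpha\le r.$$ The tropical maximal rank conjecture for $(r,s,\rho,m)$ is the assertion that for all positive loop lengths $(\ell_k,m_k)_{1\le k\le g}$ that satisfy (1), and for every real $C$, there are bridge lengths $(n_k)_{0\le k\le g}$ that satisfy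 (2), a divisor $D$ of degree $d$ and rank $r$ whose class is vertex avoiding on the corresponding chain of $g$ loops, and a set of exactly $\min\{\binom{r+m}{m},\,md-g+1\}$ multisets $I$ of size $m$ in $\{0,\dots,r\}$ for which the functions $\psi_I$ are tropically independent. We say that $(r,s,\rho,m)$ is in the surjective range if $\binom{r+m}{m}\ge md-g+1$. Theorem 1.2. Let $s\ge1$, $m\ge 1$, $\rho\ge 0$ and $r\ge s$ be integers such that $(r,s,\rho,m)$ is in the surjective range. If the tropical maximal rank conjecture holds for $(r,s,\rho,m)$, then it holds for $(r+1,s,\rho,m)$. -/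

import Mathlib

noncomputable section

open scoped Topology

/-- A metric graph: vertices `V`, (oriented) edges `E`, each edge an interval of positive length
glued to the vertices at its two ends. The orientation only serves to parametrize the edges. -/
structure MetricGraph (V E : Type) where
  src : E → V
  tgt : E → V
  len : E → ℝ
  len_pos : ∀ e, 0 < len e

namespace MetricGraph

variable {V E : Type}

/-- The points of a metric graph: the vertices, and the points in the interior of the edges
(the point of `e` at distance `t` from its source). -/
inductive Point (Γ : MetricGraph V E) : Type
  | vertex (v : V) : Point Γ
  | inner (e : E) (t : ℝ) (ht : 0 < t ∧ t < Γ.len e) : Point Γ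

open Classical in
/-- The parametrization of the closed edge `e` by `[0, len e]`
(continued by the end points outside this interval). -/
def pt (Γ : MetricGraph V E) (e : E) (t : ℝ) : Γ.Point :=
  if h : 0 < t ∧ t < Γ.len e then Point.inner e t h
  else if t ≤ 0 then Point.vertex (Γ.src e) else Point.vertex (Γ.tgt e)

/-- `PL(Γ)`: the continuous piecewise linear functions with integer slopes. On every closed edge,
the function is, near each point and on each side of it, affine of integer slope with the value of
the function at this point as its limit. -/
def IsPL (Γ : MetricGraph V E) (f : Γ.Point → ℝ) : Prop :=
  ∀ e : E,
    (∀ t : ℝ, 0 ≤ t → t < Γ.len e →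
      ∃ n : ℤ, ∀ᶠ u in 𝓝[>] t, f (Γ.pt e u) = f (Γ.pt e t) + n * (u - t)) ∧
    (∀ t : ℝ, 0 < t → t ≤ Γ.len e →
      ∃ n : ℤ, ∀ᶠ u in 𝓝[<] t, f (Γ.pt e u) = f (Γ.pt e t) + n * (u - t))

open Classical in
/-- The coefficient of `div f` at a point: the sum of the incoming slopes of `f`
(minus the sum of the outgoing slopes). -/
def ord [Fintype E] (Γ : MetricGraph V E) (f : Γ.Point → ℝ) : Γ.Point → ℝ
  | Point.vertex v =>
      (∑ e : E with Γ.tgt e = v,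
        derivWithin (fun t => f (Γ.pt e t)) (Set.Iio (Γ.len e)) (Γ.len e)) -
      ∑ e : E with Γ.src e = v, derivWithin (fun t => f (Γ.pt e t)) (Set.Ioi 0) 0
  | Point.inner e t _ =>
      derivWithin (fun u => f (Γ.pt e u)) (Set.Iio t) t -
      derivWithin (fun u => f (Γ.pt e u)) (Set.Ioi t) t

/-- Divisors are finite formal integer combinations of points; `D` is effective if `0 ≤ D`. -/
abbrev Divisor (Γ : MetricGraph V E) : Type := Γ.Point →₀ ℤ

/-- The degree of a divisor. -/
def deg {Γ : MetricGraph V E} (D : Γ.Divisor) : ℤ := D.sum fun _ a => a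

variable [Fintype E]

/-- `f ∈ PL(Γ)` and `D + div f = D'`. -/
def Carries (Γ : MetricGraph V E) (f : Γ.Point → ℝ) (D D' : Γ.Divisor) : Prop :=
  Γ.IsPL f ∧ ∀ p, (D' p : ℝ) = D p + Γ.ord f p

/-- Linear equivalence of divisors. -/
def LinEquiv (Γ : MetricGraph V E) (D D' : Γ.Divisor) : Prop :=
  ∃ f : Γ.Point → ℝ, Γ.Carries f D D'

/-- The (Baker–Norine) rank of `D` is at least `r`: for every effective divisor `F` of degree `r`,
the divisor `D - F` is equivalent to an effective divisor. -/
def RankGE (Γ : MetricGraph V E) (D : Γ.Divisor) (r : ℕ) : Prop :=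
  ∀ F : Γ.Divisor, 0 ≤ F → deg F = r → ∃ D' : Γ.Divisor, 0 ≤ D' ∧ Γ.LinEquiv (D - F) D'

/-- The divisor `D` has rank exactly `r`. -/
def HasRank (Γ : MetricGraph V E) (D : Γ.Divisor) (r : ℕ) : Prop :=
  Γ.RankGE D r ∧ ¬ Γ.RankGE D (r + 1)

end MetricGraph

/-- A finite family of functions `f i`, `i ∈ S`, is tropically dependent if there are real
constants `b i` such that at every point the minimum of the `f i + b i` occurs at least twice. -/
def TropicallyDependent {ι X : Type} (S : Finset ι) (f : ι → X → ℝ) : Prop :=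
  ∃ b : ι → ℝ, ∀ x : X, ∃ i ∈ S, ∃ j ∈ S, i ≠ j ∧
    f i x + b i = f j x + b j ∧ ∀ k ∈ S, f i x + b i ≤ f k x + b k

/-- Tropical independence. -/
def TropicallyIndependent {ι X : Type} (S : Finset ι) (f : ι → X → ℝ) : Prop :=
  ¬ TropicallyDependent S f

/-- The vertices of the chain of `g` loops: `w k` is `w_k` for `0 ≤ k ≤ g`, and
`v k` is `v_{k+1}` for `0 ≤ k ≤ g`. -/
inductive ChainVertex (g : ℕ) : Type
  | w (k : Fin (g + 1)) : ChainVertex g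
  | v (k : Fin (g + 1)) : ChainVertex g

/-- The edges of the chain of `g` loops: `bridge k` is the bridge `β_k` for `0 ≤ k ≤ g`;
`top k` and `bottom k` are the top and bottom edges of the loop number `k + 1`. -/
inductive ChainEdge (g : ℕ) : Type
  | bridge (k : Fin (g + 1)) : ChainEdge g
  | top (k : Fin g) : ChainEdge g
  | bottom (k : Fin g) : ChainEdge g
  deriving Fintype

/-- The chain of `g` loops with bridges. The bridge `β_k` joins `w_k` to `v_{k+1}` and has length
`n k` for `0 ≤ k ≤ g`; the top and bottom edges of the `k`-th loop join `v_k` to `w_k` and have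
lengths `ℓ k` and `m k` for `1 ≤ k ≤ g`. The other values of the sequences are not used. -/
def chainOfLoops (g : ℕ) (ℓ m n : ℕ → ℝ) (hℓ : ∀ k, 0 < ℓ k) (hm : ∀ k, 0 < m k)
    (hn : ∀ k, 0 < n k) : MetricGraph (ChainVertex g) (ChainEdge g) where
  src
    | .bridge k => .w k
    | .top k => .v k.castSucc
    | .bottom k => .v k.castSucc
  tgt
    | .bridge k => .v k
    | .top k => .w k.succ
    | .bottom k => .w k.succ
  len
    | .bridge k => n k
    | .top k => ℓ (k + 1)
    | .bottom k => m (k + 1)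
  len_pos
    | .bridge _ => hn _
    | .top _ => hℓ _
    | .bottom _ => hm _

/-- The conditions of admissibility on the lengths of the edges of the loops:
`4 g m_k < ℓ_k` for all `k`, and no nontrivial integer linear relation with coefficients of
absolute value at most `g + 1` between the `m_k`. -/
def AdmissibleLoops (g : ℕ) (ℓ m : ℕ → ℝ) : Prop :=
  (∀ k ∈ Finset.Icc 1 g, 4 * (g : ℝ) * m k < ℓ k) ∧
  ∀ c : ℕ → ℤ, (∀ k ∈ Finset.Icc 1 g, |c k| ≤ (g : ℤ) + 1) →
    ∑ k ∈ Finset.Icc 1 g, (c k : ℝ) * m k = 0 → ∀ k ∈ Finset.Icc 1 g, c k = 0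

/-- The conditions of admissibility on the lengths of the bridges, where `a ≪ b` is read as
`C * a < b`: each loop is much shorter than the two bridges next to it, and each of the `r + 1`
blocks of `s` consecutive loops is much shorter than the two bridges next to it. -/
def AdmissibleBridges (g r s : ℕ) (ℓ n : ℕ → ℝ) (C : ℝ) : Prop :=
  (∀ k ∈ Finset.Icc 1 g, C * ℓ k < min (n (k - 1)) (n k)) ∧
  ∀ α ≤ r, C * ((∑ i ∈ Finset.Icc (α * s + 1) ((α + 1) * s), ℓ i) +
      ∑ i ∈ Finset.Ico (α * s + 1) ((α + 1) * s), n i) < min (n (α * s)) (n ((α + 1) * s))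

section Chain

variable {g : ℕ} (Γ : MetricGraph (ChainVertex g) (ChainEdge g))

/-- The left end point `w_0` of the chain. -/
def leftEnd : Γ.Point := .vertex (.w 0)

/-- The right end point `v_{g+1}` of the chain. -/
def rightEnd : Γ.Point := .vertex (.v (Fin.last g))

/-- The class of `D` (of rank `r`) is vertex avoiding: for each `0 ≤ i ≤ r` there is a unique
effective divisor `D_i` equivalent to `D` with `D_i ≥ i w_0 + (r - i) v_{g+1}`; it has degree
exactly `i` at `w_0` and exactly `r - i` at `v_{g+1}`, and it has no chip at any of the other
vertices `v_1, w_1, …, v_g, w_g`. -/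
def VertexAvoiding (D : Γ.Divisor) (r : ℕ) : Prop :=
  ∀ i ≤ r, ∃ D' : Γ.Divisor,
    (Γ.LinEquiv D D' ∧ 0 ≤ D' ∧
      D' (leftEnd Γ) = (i : ℤ) ∧ D' (rightEnd Γ) = (r : ℤ) - i ∧
      ∀ k : Fin g, D' (.vertex (.v k.castSucc)) = 0 ∧ D' (.vertex (.w k.succ)) = 0) ∧
    ∀ F : Γ.Divisor, Γ.LinEquiv D F → 0 ≤ F →
      (i : ℤ) ≤ F (leftEnd Γ) → (r : ℤ) - i ≤ F (rightEnd Γ) → F = D'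

/-- `ψ_0, …, ψ_r` are distinguished functions of `D`: each `D + div ψ_i` is an effective divisor
`D_i` of degree `i` at `w_0` and of degree `r - i` at `v_{g+1}`. -/
def IsDistinguished (D : Γ.Divisor) (r : ℕ) (ψ : Fin (r + 1) → Γ.Point → ℝ) : Prop :=
  ∀ i : Fin (r + 1), ∃ D' : Γ.Divisor, 0 ≤ D' ∧
    D' (leftEnd Γ) = (i : ℤ) ∧ D' (rightEnd Γ) = (r : ℤ) - i ∧ Γ.Carries (ψ i) D D'

end Chain

/-- The function `ψ_I = ∑_{i ∈ I} ψ_i` of a multiset `I` of size `m`. -/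
def multisetSum {r m : ℕ} {X : Type} (ψ : Fin (r + 1) → X → ℝ) (I : Sym (Fin (r + 1)) m) (x : X) :
    ℝ :=
  ((I : Multiset (Fin (r + 1))).map fun i => ψ i x).sum

/-- The genus `g = (r + 1) s + ρ`. -/
def mrcGenus (r s ρ : ℕ) : ℕ := (r + 1) * s + ρ

/-- The degree `d = g + r - s`. -/
def mrcDegree (r s ρ : ℕ) : ℤ := (mrcGenus r s ρ : ℤ) + r - s

/-- `(r, s, ρ, m)` is in the surjective range: `m d - g + 1 ≤ (r + m choose m)`. -/
def SurjectiveRange (r s ρ m : ℕ) : Prop :=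
  (m : ℤ) * mrcDegree r s ρ - mrcGenus r s ρ + 1 ≤ ((r + m).choose m : ℤ)

/-- The conclusion of the tropical maximal rank conjecture on a given chain of `g` loops: there are
a divisor `D` of degree `d` and rank `r` whose class is vertex avoiding, and a tropically
independent set of `min {(r + m choose m), m d - g + 1}` functions `ψ_I`, `|I| = m`. -/
def MaximalRankOn {g : ℕ} (Γ : MetricGraph (ChainVertex g) (ChainEdge g)) (d : ℤ) (r m : ℕ) :
    Prop :=
  ∃ D : Γ.Divisor, MetricGraph.deg D = d ∧ Γ.HasRank D r ∧ VertexAvoiding Γ D r ∧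
    ∃ ψ : Fin (r + 1) → Γ.Point → ℝ, IsDistinguished Γ D r ψ ∧
      ∃ A : Finset (Sym (Fin (r + 1)) m),
        (A.card : ℤ) = min ((r + m).choose m : ℤ) ((m : ℤ) * d - g + 1) ∧
        TropicallyIndependent A (multisetSum ψ)

/-- The tropical maximal rank conjecture for `(r, s, ρ, m)`: for every chain of `g` loops with
generic edge lengths, in the sense that the loops are arbitrary admissible ones and the bridges are
suitably long (for every constant `C`, they can be taken admissible for `a ≪ b` read as
`C * a < b`), there are a divisor and a tropically independent set as predicted. -/
def TropicalMRC (r s ρ m : ℕ) : Prop :=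
  ∀ (ℓ μ : ℕ → ℝ) (hℓ : ∀ k, 0 < ℓ k) (hμ : ∀ k, 0 < μ k),
    AdmissibleLoops (mrcGenus r s ρ) ℓ μ →
    ∀ C : ℝ, ∃ (n : ℕ → ℝ) (hn : ∀ k, 0 < n k),
      AdmissibleBridges (mrcGenus r s ρ) r s ℓ n C ∧
      MaximalRankOn (chainOfLoops (mrcGenus r s ρ) ℓ μ n hℓ hμ hn) (mrcDegree r s ρ) r m

end

/-!
Idea. Put `s` new loops in front of a chain that carries `D` and its functions `ψ_i`, joined to it
by a very long bridge. Every divisor that matters has at most one chip on each loop, and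
equivalence is detected loop by loop: the position of the chip on a loop and the number of chips to
the left of it determine a class in `ℝ / (ℓ_k + m_k)ℤ`, and equivalence means that these agree.

The new loops are filled so that the rank goes up by one. On the long bridge the new `ψ_0` has slope
`s + 1` and the new `ψ_(i+1)` has slope `-i`, and behind the bridge the new `ψ_(i+1)` is the old
`ψ_i`. This requires that `D + (s + 1) w_0` has an effective representative with `r + 1` chips at
`v_(g+1)` and none at the other vertices. A small perturbation of the old chips provides it, and by
compactness a small perturbation destroys no tropical independence.

A sum `ψ_I` with `0 ∉ I` has slope at most `0` on the long bridge, so these sums are independent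
for the same reason as on the old chain. The sums with `0 ∈ I` realize the slopes
`1, …, (m - 1) (s + 1)` and `m (s + 1)` there. Functions with distinct positive slopes on the bridge
are independent of one another and, the bridge being long, of the old sums. Their number is exactly
the growth of `m d - g + 1`.
-/

noncomputable section

open scoped Topology

open MetricGraph

/-- `F` is affine of slope `a` on a punctured neighbourhood of `t` in `s`, with the value `F t` as
its limit: for `s = Ioi t` or `s = Iio t` this is the one-sided slope of a continuous piecewise
linear function, as in `MetricGraph.IsPL`. -/
def HasSlopeWithin (F : ℝ → ℝ) (s : Set ℝ) (t a : ℝ) : Prop :=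
  ∀ᶠ u in 𝓝[s] t, F u = F t + a * (u - t)

namespace HasSlopeWithin

variable {F G : ℝ → ℝ} {s : Set ℝ} {t a b : ℝ}

lemma hasDerivWithinAt (h : HasSlopeWithin F s t a) : HasDerivWithinAt F a s t := by
  have haff : HasDerivWithinAt (fun u => F t + a * (u - t)) a s t := by
    simpa using (((hasDerivWithinAt_id t s).sub_const t).const_mul a).const_add (F t)
  exact haff.congr_of_eventuallyEq h (by simp)

lemma derivWithin (h : HasSlopeWithin F s t a) (hs : UniqueDiffWithinAt ℝ s t) :
    derivWithin F s t = a :=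
  h.hasDerivWithinAt.derivWithin hs

lemma unique (h : HasSlopeWithin F s t a) (h' : HasSlopeWithin F s t b)
    (hs : UniqueDiffWithinAt ℝ s t) : a = b :=
  (h.derivWithin hs).symm.trans (h'.derivWithin hs)

lemma add (h : HasSlopeWithin F s t a) (h' : HasSlopeWithin G s t b) :
    HasSlopeWithin (fun u => F u + G u) s t (a + b) := by
  filter_upwards [h, h'] with u hu hu'
  rw [hu, hu']
  ring

lemma const_mul (c : ℝ) (h : HasSlopeWithin F s t a) :
    HasSlopeWithin (fun u => c * F u) s t (c * a) := by
  filter_upwards [h] with u hu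
  rw [hu]
  ring

lemma congr (h : HasSlopeWithin F s t a) (hs : ∀ᶠ u in 𝓝[s] t, G u = F u) (ht : G t = F t) :
    HasSlopeWithin G s t a := by
  filter_upwards [h, hs] with u hu hu'
  rw [hu', hu, ht]

lemma eventually_nearby (h : HasSlopeWithin F s t a) (hs : IsOpen s) :
    ∀ᶠ u in 𝓝[s] t, ∀ s', HasSlopeWithin F s' u a := by
  filter_upwards [eventually_eventually_nhdsWithin.2 h, h, self_mem_nhdsWithin] with u hnear hu hus
  rw [hs.nhdsWithin_eq hus] at hnear
  intro s'
  filter_upwards [nhdsWithin_le_nhds hnear] with w hw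
  rw [hw, hu]
  ring

end HasSlopeWithin

lemma hasSlopeWithin_affine (c a t : ℝ) (s : Set ℝ) : HasSlopeWithin (fun u => c + a * u) s t a :=
  Filter.Eventually.of_forall fun u => by ring

lemma hasSlopeWithin_Ioi_hinge (c t : ℝ) :
    HasSlopeWithin (fun u => max (u - c) 0) (Set.Ioi t) t (if c ≤ t then 1 else 0) := by
  split_ifs with h
  · filter_upwards [self_mem_nhdsWithin] with u (hu : t < u)
    rw [max_eq_left (by linarith), max_eq_left (by linarith)]
    ring
  · filter_upwards [nhdsWithin_le_nhds (Iio_mem_nhds (not_le.1 h))] with u (hu : u < c)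
    rw [max_eq_right (by linarith), max_eq_right (by linarith)]
    ring

lemma hasSlopeWithin_Iio_hinge (c t : ℝ) :
    HasSlopeWithin (fun u => max (u - c) 0) (Set.Iio t) t (if c < t then 1 else 0) := by
  split_ifs with h
  · filter_upwards [nhdsWithin_le_nhds (Ioi_mem_nhds h)] with u (hu : c < u)
    rw [max_eq_left (by linarith), max_eq_left (by linarith)]
    ring
  · filter_upwards [self_mem_nhdsWithin] with u (hu : u < t)
    rw [max_eq_right (by linarith), max_eq_right (by linarith)]
    ring

section NoKinks

variable {F : ℝ → ℝ} {ρ : ℝ → ℤ} {L : ℝ}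

lemma continuousOn_Icc_of_slopes
    (hr : ∀ t, 0 ≤ t → t < L → ∃ a, HasSlopeWithin F (Set.Ioi t) t a)
    (hl : ∀ t, 0 < t → t ≤ L → ∃ a, HasSlopeWithin F (Set.Iio t) t a) :
    ContinuousOn F (Set.Icc 0 L) := by
  intro t ht
  have hleft : ContinuousWithinAt F (Set.Icc 0 t) t := by
    rcases ht.1.eq_or_lt with rfl | h0
    · rw [Set.Icc_self]
      exact continuousWithinAt_singleton
    · obtain ⟨a, ha⟩ := hl t h0 ht.2
      exact (continuousWithinAt_Iio_iff_Iic.1 ha.hasDerivWithinAt.continuousWithinAt).mono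
        fun _ hu => hu.2
  have hright : ContinuousWithinAt F (Set.Icc t L) t := by
    rcases ht.2.eq_or_lt with rfl | h1
    · rw [Set.Icc_self]
      exact continuousWithinAt_singleton
    · obtain ⟨a, ha⟩ := hr t ht.1 h1
      exact (continuousWithinAt_Ioi_iff_Ici.1 ha.hasDerivWithinAt.continuousWithinAt).mono
        fun _ hu => hu.1
  rw [← Set.Icc_union_Icc_eq_Icc ht.1 ht.2]
  exact hleft.union hright

lemma slope_eq_of_no_kinks
    (hr : ∀ t, 0 ≤ t → t < L → HasSlopeWithin F (Set.Ioi t) t (ρ t))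
    (hl : ∀ t, 0 < t → t < L → HasSlopeWithin F (Set.Iio t) t (ρ t)) :
    ∀ t, 0 ≤ t → t < L → ρ t = ρ 0 := by
  have slope_eq : ∀ {t u : ℝ}, 0 ≤ u → u < L → (∀ s', HasSlopeWithin F s' u (ρ t)) → ρ u = ρ t :=
    fun h0 h1 h => Int.cast_injective ((hr _ h0 h1).unique (h _) (uniqueDiffWithinAt_Ioi _))
  have hright : ∀ t, 0 ≤ t → t < L → ContinuousWithinAt ρ (Set.Ici t) t := by
    intro t h0 h1
    refine continuousWithinAt_Ioi_iff_Ici.1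
      (continuousWithinAt_const.congr_of_eventuallyEq (f := fun _ => ρ t) ?_ rfl)
    filter_upwards [(hr t h0 h1).eventually_nearby isOpen_Ioi, Ioo_mem_nhdsGT h1] with u hu hut
    exact slope_eq (h0.trans hut.1.le) hut.2 hu
  have hleft : ∀ t, 0 < t → t < L → ContinuousWithinAt ρ (Set.Iic t) t := by
    intro t h0 h1
    refine continuousWithinAt_Iio_iff_Iic.1
      (continuousWithinAt_const.congr_of_eventuallyEq (f := fun _ => ρ t) ?_ rfl)
    filter_upwards [(hl t h0 h1).eventually_nearby isOpen_Iio, Ioo_mem_nhdsLT h0] with u hu hut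
    exact slope_eq hut.1.le (hut.2.trans h1) hu
  have hcont : ContinuousOn ρ (Set.Ico 0 L) := by
    intro t ht
    rcases ht.1.eq_or_lt with rfl | h0
    · exact (hright 0 le_rfl ht.2).mono fun _ hu => hu.1
    · exact ((hleft t h0 ht.2).union (hright t ht.1 ht.2)).mono fun u _ => le_total u t
  exact fun t h0 h1 =>
    isPreconnected_Ico.constant hcont ⟨h0, h1⟩ ⟨le_rfl, h0.trans_lt h1⟩

lemma affine_of_no_kinks
    (hr : ∀ t, 0 ≤ t → t < L → HasSlopeWithin F (Set.Ioi t) t (ρ t))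
    (hl : ∀ t, 0 < t → t < L → HasSlopeWithin F (Set.Iio t) t (ρ t))
    (hL : ∃ a, HasSlopeWithin F (Set.Iio L) L a) {t : ℝ} (h0 : 0 ≤ t) (h1 : t ≤ L) :
    F t = F 0 + ρ 0 * t := by
  have hcont : ContinuousOn F (Set.Icc 0 L) :=
    continuousOn_Icc_of_slopes (fun t h0 h1 => ⟨_, hr t h0 h1⟩) fun t h0 h1 => by
      rcases h1.eq_or_lt with rfl | h1
      exacts [hL, ⟨_, hl t h0 h1⟩]
  have hderiv : ∀ u ∈ Set.Ico 0 L,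
      HasDerivWithinAt (fun t => F t - ρ 0 * t) 0 (Set.Ici u) u := by
    intro u hu
    have hFu := (hr u hu.1 hu.2).hasDerivWithinAt.Ici_of_Ioi
    rw [slope_eq_of_no_kinks hr hl u hu.1 hu.2] at hFu
    have hsub : HasDerivWithinAt (fun t => F t - ρ 0 * t) (ρ 0 - ρ 0 * 1 : ℝ) (Set.Ici u) u :=
      hFu.sub ((hasDerivWithinAt_id u (Set.Ici u)).const_mul (ρ 0 : ℝ))
    simpa using hsub
  have hconst : F t - ρ 0 * t = F 0 - ρ 0 * 0 :=
    constant_of_has_deriv_right_zero (hcont.sub (by fun_prop)) hderiv t ⟨h0, h1⟩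
  linarith

end NoKinks

namespace MetricGraph

variable {V E : Type} {Γ : MetricGraph V E}

lemma pt_inner {e : E} {t : ℝ} (h : 0 < t ∧ t < Γ.len e) : Γ.pt e t = .inner e t h := by
  simp [pt, h]

lemma pt_zero (e : E) : Γ.pt e 0 = .vertex (Γ.src e) := by
  simp [pt]

lemma pt_len (e : E) : Γ.pt e (Γ.len e) = .vertex (Γ.tgt e) := by
  simp [pt, Γ.len_pos e]

section Pair

variable {R : Type*} [Ring R]

/-- The pairing `∑ p, Z p * φ p` of a divisor `Z` with a function `φ` on the points. -/
def pair (φ : Γ.Point → R) : Γ.Divisor →+ R :=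
  (Finsupp.linearCombination ℤ φ).toAddMonoidHom

@[simp] lemma pair_single (φ : Γ.Point → R) (p : Γ.Point) (c : ℤ) :
    pair φ (Finsupp.single p c) = c * φ p := by
  simp [pair]

lemma pair_apply (φ : Γ.Point → R) (Z : Γ.Divisor) :
    pair φ Z = ∑ p ∈ Z.support, (Z p : R) * φ p := by
  simp [pair, Finsupp.linearCombination_apply, Finsupp.sum]

lemma pair_add_fun (φ χ : Γ.Point → R) (Z : Γ.Divisor) :
    pair (fun p => φ p + χ p) Z = pair φ Z + pair χ Z := by
  simp only [pair_apply, mul_add, Finset.sum_add_distrib]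

lemma pair_mul_fun {R : Type*} [CommRing R] (a : R) (φ : Γ.Point → R) (Z : Γ.Divisor) :
    pair (fun p => a * φ p) Z = a * pair φ Z := by
  simp only [pair_apply, Finset.mul_sum, mul_left_comm]

lemma pair_congr {φ χ : Γ.Point → R} {Z : Γ.Divisor} (h : ∀ p, Z p ≠ 0 → φ p = χ p) :
    pair φ Z = pair χ Z := by
  rw [pair_apply, pair_apply]
  exact Finset.sum_congr rfl fun p hp => by rw [h p (Finsupp.mem_support_iff.1 hp)]

lemma pair_eq_zero {φ : Γ.Point → R} {Z : Γ.Divisor} (h : ∀ p, Z p ≠ 0 → φ p = 0) :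
    pair φ Z = 0 := by
  rw [pair_congr h]
  simp [pair_apply]

lemma cast_pair (φ : Γ.Point → ℤ) (Z : Γ.Divisor) :
    ((pair φ Z : ℤ) : R) = pair (fun p => (φ p : R)) Z := by
  simp [pair_apply]

open Classical in
lemma pair_indicator (q : Γ.Point) (Z : Γ.Divisor) :
    pair (fun p => if p = q then (1 : R) else 0) Z = Z q := by
  by_cases h : Z q = 0 <;> simp [pair_apply, h]

lemma deg_eq_pair (Z : Γ.Divisor) : deg Z = pair (fun _ => (1 : ℤ)) Z := by
  simp [deg, pair_apply, Finsupp.sum]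

lemma pair_nonneg {φ : Γ.Point → ℤ} {Z : Γ.Divisor} (hφ : ∀ p, 0 ≤ φ p) (hZ : 0 ≤ Z) :
    0 ≤ pair φ Z := by
  rw [pair_apply]
  exact Finset.sum_nonneg fun p _ => mul_nonneg (by simpa using hZ p) (hφ p)

end Pair

section Hinge

open Classical in
/-- The integral over the initial piece of length `t` of the edge `e` of the change of slope caused
by one chip at a point: a function with initial slope `σ` on `e` whose divisor is `Z` has the value
`σ * t - pair (hinge e t) Z` at distance `t`, relative to its value at the source of `e`. -/
def hinge (e : E) (t : ℝ) : Γ.Point → ℝ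
  | .vertex _ => 0
  | .inner e' t' _ => if e' = e then max (t - t') 0 else 0

open Classical in
/-- The indicator of the interior points of the edge `e` with coordinate in `s`. -/
def edgeIndicator (e : E) (s : Set ℝ) : Γ.Point → ℤ
  | .vertex _ => 0
  | .inner e' t' _ => if e' = e ∧ t' ∈ s then 1 else 0

/-- The degree of a divisor on the interior points of the edge `e` with coordinate in `s`. -/
def degOn (e : E) (s : Set ℝ) : Γ.Divisor →+ ℤ := pair (edgeIndicator e s)

lemma pair_hinge_zero (e : E) (Z : Γ.Divisor) : pair (hinge e 0) Z = 0 :=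
  pair_eq_zero fun p _ => by
    rcases p with v | ⟨e', t', h⟩
    · rfl
    · simp [hinge, h.1.le]

lemma degOn_Iic_zero (e : E) (Z : Γ.Divisor) : degOn e (Set.Iic 0) Z = 0 :=
  pair_eq_zero fun p _ => by
    rcases p with v | ⟨e', t', h⟩
    · rfl
    · simp [edgeIndicator, h.1]

lemma degOn_Iio_len (e : E) (Z : Γ.Divisor) :
    degOn e (Set.Iio (Γ.len e)) Z = degOn e Set.univ Z :=
  pair_congr fun p _ => by
    rcases p with v | ⟨e', t', h⟩
    · rfl
    · by_cases he : e' = e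
      · subst he
        simp [edgeIndicator, h.2]
      · simp [edgeIndicator, he]

lemma degOn_Iic_eq {e : E} {t : ℝ} (h : 0 < t ∧ t < Γ.len e) (Z : Γ.Divisor) :
    degOn e (Set.Iic t) Z = degOn e (Set.Iio t) Z + Z (.inner e t h) := by
  classical
  rw [← Int.cast_id (n := Z (.inner e t h)), ← pair_indicator, degOn, degOn, ← pair_add_fun]
  refine pair_congr fun p _ => ?_
  rcases p with v | ⟨e', t', h'⟩
  · simp [edgeIndicator]
  · by_cases he : e' = e
    · rcases lt_trichotomy t' t with h1 | h1 | h1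
      · simp [edgeIndicator, he, h1, h1.le, h1.ne]
      · simp [edgeIndicator, he, h1]
      · simp [edgeIndicator, h1.not_ge, h1.not_gt, h1.ne']
    · simp [edgeIndicator, he]

lemma hasSlopeWithin_pair_hinge {e : E} {s s' : Set ℝ} {t : ℝ}
    (h : ∀ p : Γ.Point, HasSlopeWithin (fun u => hinge e u p) s t (edgeIndicator e s' p))
    (Z : Γ.Divisor) :
    HasSlopeWithin (fun u => pair (hinge e u) Z) s t (degOn e s' Z) := by
  induction Z using Finsupp.induction_linear with
  | zero => exact Filter.Eventually.of_forall fun u => by simp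
  | add Z Z' hZ hZ' =>
    simp only [map_add, Int.cast_add]
    exact hZ.add hZ'
  | single p c =>
    simp only [degOn, pair_single, Int.cast_mul, Int.cast_id]
    exact (h p).const_mul c

lemma hasSlopeWithin_Ioi_pair_hinge (e : E) (t : ℝ) (Z : Γ.Divisor) :
    HasSlopeWithin (fun u => pair (hinge e u) Z) (Set.Ioi t) t (degOn e (Set.Iic t) Z) := by
  refine hasSlopeWithin_pair_hinge (fun p => ?_) Z
  rcases p with v | ⟨e', t', h'⟩
  · exact Filter.Eventually.of_forall fun u => by simp [hinge, edgeIndicator]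
  · by_cases he : e' = e
    · simpa [hinge, edgeIndicator, he] using hasSlopeWithin_Ioi_hinge t' t
    · exact Filter.Eventually.of_forall fun u => by simp [hinge, edgeIndicator, he]

lemma hasSlopeWithin_Iio_pair_hinge (e : E) (t : ℝ) (Z : Γ.Divisor) :
    HasSlopeWithin (fun u => pair (hinge e u) Z) (Set.Iio t) t (degOn e (Set.Iio t) Z) := by
  refine hasSlopeWithin_pair_hinge (fun p => ?_) Z
  rcases p with v | ⟨e', t', h'⟩
  · exact Filter.Eventually.of_forall fun u => by simp [hinge, edgeIndicator]
  · by_cases he : e' = e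
    · simpa [hinge, edgeIndicator, he] using hasSlopeWithin_Iio_hinge t' t
    · exact Filter.Eventually.of_forall fun u => by simp [hinge, edgeIndicator, he]

lemma continuous_pair_hinge (e : E) (Z : Γ.Divisor) : Continuous fun u => pair (hinge e u) Z := by
  induction Z using Finsupp.induction_linear with
  | zero => simp [continuous_const]
  | add Z Z' hZ hZ' =>
    simp only [map_add]
    exact hZ.add hZ'
  | single p c =>
    simp only [pair_single]
    refine continuous_const.mul ?_
    rcases p with _ | ⟨e', t', h'⟩
    · exact continuous_const
    · simp only [hinge]
      split_ifs <;> fun_prop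

end Hinge

section InitialSlope

/-- On the edge `e` the function `f` starts with slope `σ` at the source, and its slope drops by
`Z p` at each interior point `p`. -/
def HasInitialSlope (f : Γ.Point → ℝ) (Z : Γ.Divisor) (e : E) (σ : ℤ) : Prop :=
  ∀ t, 0 ≤ t → t ≤ Γ.len e →
    f (Γ.pt e t) = f (.vertex (Γ.src e)) + σ * t - pair (hinge e t) Z

variable {f : Γ.Point → ℝ} {Z : Γ.Divisor} {e : E} {σ : ℤ}

namespace HasInitialSlope

lemma hasSlopeWithin_Ioi (h : HasInitialSlope f Z e σ) {t : ℝ} (h0 : 0 ≤ t) (h1 : t < Γ.len e) :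
    HasSlopeWithin (fun u => f (Γ.pt e u)) (Set.Ioi t) t
      ((σ - degOn e (Set.Iic t) Z : ℤ) : ℝ) := by
  have hslope := (hasSlopeWithin_affine (f (.vertex (Γ.src e))) σ t (Set.Ioi t)).add
    ((hasSlopeWithin_Ioi_pair_hinge e t Z).const_mul (-1))
  push_cast
  rw [sub_eq_add_neg, ← neg_one_mul]
  refine hslope.congr ?_ (by rw [h t h0 h1.le]; ring)
  filter_upwards [Ioo_mem_nhdsGT h1] with u hu
  rw [h u (h0.trans hu.1.le) hu.2.le]
  ring

lemma hasSlopeWithin_Iio (h : HasInitialSlope f Z e σ) {t : ℝ} (h0 : 0 < t) (h1 : t ≤ Γ.len e) :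
    HasSlopeWithin (fun u => f (Γ.pt e u)) (Set.Iio t) t
      ((σ - degOn e (Set.Iio t) Z : ℤ) : ℝ) := by
  have hslope := (hasSlopeWithin_affine (f (.vertex (Γ.src e))) σ t (Set.Iio t)).add
    ((hasSlopeWithin_Iio_pair_hinge e t Z).const_mul (-1))
  push_cast
  rw [sub_eq_add_neg, ← neg_one_mul]
  refine hslope.congr ?_ (by rw [h t h0.le h1]; ring)
  filter_upwards [Ioo_mem_nhdsLT h0] with u hu
  rw [h u hu.1.le (hu.2.le.trans h1)]
  ring

lemma add {f' : Γ.Point → ℝ} {Z' : Γ.Divisor} {σ' : ℤ} (h : HasInitialSlope f Z e σ)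
    (h' : HasInitialSlope f' Z' e σ') :
    HasInitialSlope (fun p => f p + f' p) (Z + Z') e (σ + σ') := fun t h0 h1 => by
  beta_reduce
  rw [h t h0 h1, h' t h0 h1, map_add]
  push_cast
  ring

lemma neg (h : HasInitialSlope f Z e σ) :
    HasInitialSlope (fun p => -f p) (-Z) e (-σ) := fun t h0 h1 => by
  beta_reduce
  rw [h t h0 h1, map_neg]
  push_cast
  ring

lemma ord_inner [Fintype E] (h : HasInitialSlope f Z e σ) {t : ℝ} (ht : 0 < t ∧ t < Γ.len e) :
    Γ.ord f (.inner e t ht) = Z (.inner e t ht) := by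
  rw [ord, (h.hasSlopeWithin_Iio ht.1 ht.2.le).derivWithin (uniqueDiffWithinAt_Iio t),
    (h.hasSlopeWithin_Ioi ht.1.le ht.2).derivWithin (uniqueDiffWithinAt_Ioi t), degOn_Iic_eq ht]
  push_cast
  ring

end HasInitialSlope

lemma isPL_of_hasInitialSlope {σ : E → ℤ} (h : ∀ e, HasInitialSlope f Z e (σ e)) : Γ.IsPL f :=
  fun e => ⟨fun _ h0 h1 => ⟨_, (h e).hasSlopeWithin_Ioi h0 h1⟩,
    fun _ h0 h1 => ⟨_, (h e).hasSlopeWithin_Iio h0 h1⟩⟩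

open Classical in
lemma ord_vertex_of_hasInitialSlope [Fintype E] {σ : E → ℤ}
    (h : ∀ e, HasInitialSlope f Z e (σ e)) (v : V) :
    Γ.ord f (.vertex v) = ((∑ e with Γ.tgt e = v, (σ e - degOn e Set.univ Z) -
      ∑ e with Γ.src e = v, σ e : ℤ) : ℝ) := by
  rw [ord]
  push_cast
  congr 1 <;> refine Finset.sum_congr rfl fun e _ => ?_
  · rw [((h e).hasSlopeWithin_Iio (Γ.len_pos e) le_rfl).derivWithin (uniqueDiffWithinAt_Iio _),
      degOn_Iio_len]
    push_cast
    rfl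
  · rw [((h e).hasSlopeWithin_Ioi le_rfl (Γ.len_pos e)).derivWithin (uniqueDiffWithinAt_Ioi _),
      degOn_Iic_zero, sub_zero]

lemma IsPL.exists_hasInitialSlope [Fintype E] (hf : Γ.IsPL f)
    (hZ : ∀ p, (Z p : ℝ) = Γ.ord f p) (e : E) : ∃ σ : ℤ, HasInitialSlope f Z e σ := by
  have hR : ∀ t, 0 ≤ t → t < Γ.len e →
      ∃ n : ℤ, HasSlopeWithin (fun u => f (Γ.pt e u)) (Set.Ioi t) t n := (hf e).1
  have hL : ∀ t, 0 < t → t ≤ Γ.len e →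
      ∃ n : ℤ, HasSlopeWithin (fun u => f (Γ.pt e u)) (Set.Iio t) t n := (hf e).2
  choose! ρ hρ using hR
  -- Adding the hinges of `Z` to `f` removes all the kinks in the interior of `e`.
  refine ⟨ρ 0, fun t h0 h1 => ?_⟩
  have haffine := affine_of_no_kinks (F := fun u => f (Γ.pt e u) + pair (hinge e u) Z)
    (ρ := fun t => ρ t + degOn e (Set.Iic t) Z)
    (fun t h0 h1 => by
      push_cast
      exact (hρ t h0 h1).add (hasSlopeWithin_Ioi_pair_hinge e t Z))
    (fun t h0 h1 => by
      obtain ⟨n, hn⟩ := hL t h0 h1.le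
      have hord := hZ (.inner e t ⟨h0, h1⟩)
      rw [ord, hn.derivWithin (uniqueDiffWithinAt_Iio t),
        (hρ t h0.le h1).derivWithin (uniqueDiffWithinAt_Ioi t)] at hord
      convert hn.add (hasSlopeWithin_Iio_pair_hinge e t Z) using 1
      rw [degOn_Iic_eq ⟨h0, h1⟩]
      push_cast
      linarith)
    (by
      obtain ⟨n, hn⟩ := hL _ (Γ.len_pos e) le_rfl
      exact ⟨_, hn.add (hasSlopeWithin_Iio_pair_hinge e _ Z)⟩) h0 h1
  simp only [pair_hinge_zero, degOn_Iic_zero, pt_zero, add_zero] at haffine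
  linarith

open Classical in
lemma carries_iff_hasInitialSlope [Fintype E] {D D' : Γ.Divisor} :
    Γ.Carries f D D' ↔ ∃ σ : E → ℤ, (∀ e, HasInitialSlope f (D' - D) e (σ e)) ∧
      ∀ v, (D' - D) (.vertex v) =
        ∑ e with Γ.tgt e = v, (σ e - degOn e Set.univ (D' - D)) - ∑ e with Γ.src e = v, σ e := by
  have hdiv : (∀ p, (D' p : ℝ) = D p + Γ.ord f p) ↔ ∀ p, ((D' - D) p : ℝ) = Γ.ord f p := by
    refine forall_congr' fun p => ?_
    rw [Finsupp.sub_apply, Int.cast_sub, sub_eq_iff_eq_add']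
  rw [Carries, hdiv]
  constructor
  · rintro ⟨hf, hD⟩
    choose σ hσ using hf.exists_hasInitialSlope hD
    refine ⟨σ, hσ, fun v => ?_⟩
    have hv := hD (.vertex v)
    rw [ord_vertex_of_hasInitialSlope hσ] at hv
    exact_mod_cast hv
  · rintro ⟨σ, hσ, hv⟩
    refine ⟨isPL_of_hasInitialSlope hσ, ?_⟩
    rintro (v | ⟨e, t, ht⟩)
    · rw [ord_vertex_of_hasInitialSlope hσ, hv v]
    · rw [(hσ e).ord_inner]

lemma exists_hasInitialSlope (Z : Γ.Divisor) (val : V → ℝ) (σ : E → ℤ)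
    (h : ∀ e, val (Γ.tgt e) = val (Γ.src e) + σ e * Γ.len e - pair (hinge e (Γ.len e)) Z) :
    ∃ f : Γ.Point → ℝ, (∀ v, f (.vertex v) = val v) ∧ ∀ e, HasInitialSlope f Z e (σ e) := by
  refine ⟨fun p => match p with
    | .vertex v => val v
    | .inner e t _ => val (Γ.src e) + σ e * t - pair (hinge e t) Z, fun _ => rfl, ?_⟩
  intro e t h0 h1
  rcases h0.eq_or_lt with rfl | h0
  · simp only [pt_zero, pair_hinge_zero, mul_zero, add_zero, sub_zero]
  rcases h1.eq_or_lt with rfl | h1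
  · rw [pt_len]
    exact h e
  · rw [pt_inner ⟨h0, h1⟩]

end InitialSlope

section LinEquiv

variable [Fintype E] {D D' D'' : Γ.Divisor}

lemma Carries.add {f f' : Γ.Point → ℝ} {D₁ D₁' D₂ D₂' : Γ.Divisor} (h : Γ.Carries f D₁ D₁')
    (h' : Γ.Carries f' D₂ D₂') (hD : D' - D = (D₁' - D₁) + (D₂' - D₂)) :
    Γ.Carries (fun p => f p + f' p) D D' := by
  rw [carries_iff_hasInitialSlope] at *
  obtain ⟨σ, hσ, hv⟩ := h
  obtain ⟨σ', hσ', hv'⟩ := h'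
  rw [hD]
  refine ⟨fun e => σ e + σ' e, fun e => (hσ e).add (hσ' e), fun v => ?_⟩
  rw [Finsupp.add_apply, hv v, hv' v]
  simp only [map_add, Finset.sum_sub_distrib, Finset.sum_add_distrib]
  ring

lemma Carries.neg {f : Γ.Point → ℝ} (h : Γ.Carries f D D') :
    Γ.Carries (fun p => -f p) D' D := by
  rw [carries_iff_hasInitialSlope] at *
  obtain ⟨σ, hσ, hv⟩ := h
  rw [← neg_sub D' D]
  refine ⟨fun e => -σ e, fun e => (hσ e).neg, fun v => ?_⟩
  rw [Finsupp.neg_apply, hv v]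
  simp only [map_neg, Finset.sum_sub_distrib, Finset.sum_neg_distrib]
  ring

lemma LinEquiv.symm (h : Γ.LinEquiv D D') : Γ.LinEquiv D' D :=
  let ⟨_, hf⟩ := h
  ⟨_, hf.neg⟩

lemma LinEquiv.trans (h : Γ.LinEquiv D D') (h' : Γ.LinEquiv D' D'') : Γ.LinEquiv D D'' :=
  let ⟨_, hf⟩ := h
  let ⟨_, hf'⟩ := h'
  ⟨_, hf.add hf' (by abel)⟩

lemma LinEquiv.congr_sub {D₁ D₁' : Γ.Divisor} (h : Γ.LinEquiv D D')
    (hD : D₁' - D₁ = D' - D) : Γ.LinEquiv D₁ D₁' := by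
  obtain ⟨f, hf⟩ := h
  refine ⟨f, ?_⟩
  rw [carries_iff_hasInitialSlope] at *
  rwa [hD]

end LinEquiv

end MetricGraph

section ChainDegrees

variable {g : ℕ} {Γ : MetricGraph (ChainVertex g) (ChainEdge g)}

/-- The place of a point in the chain: `4k` for `w k`, `4k + 1` for the interior of the bridge `k`,
`4k + 2` for `v k` and `4k + 3` for the interior of the two edges of the loop `k`. -/
def place : Γ.Point → ℕ
  | .vertex (.w k) => 4 * k
  | .vertex (.v k) => 4 * k + 2
  | .inner (.bridge k) _ _ => 4 * k + 1
  | .inner (.top k) _ _ => 4 * k + 3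
  | .inner (.bottom k) _ _ => 4 * k + 3

lemma place_lt (p : Γ.Point) : place p < 4 * g + 3 := by
  rcases p with (k | k) | ⟨k | k | k, t, h⟩ <;> have := k.2 <;> simp only [place] <;> omega

/-- The degree of a divisor to the left of the place `j`. -/
def degLT (j : ℕ) : Γ.Divisor →+ ℤ := pair fun p => if place p < j then 1 else 0

/-- The degree of a divisor at the place `j`. -/
def degAt (j : ℕ) : Γ.Divisor →+ ℤ := pair fun p => if place p = j then 1 else 0

lemma degLT_zero (Z : Γ.Divisor) : degLT 0 Z = 0 := by
  simp [degLT, pair_apply]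

lemma degLT_succ (j : ℕ) (Z : Γ.Divisor) : degLT (j + 1) Z = degLT j Z + degAt j Z := by
  rw [degLT, degLT, degAt, ← pair_add_fun]
  refine pair_congr fun p _ => ?_
  rcases lt_trichotomy (place p) j with h | h | h
  · simp [h, h.ne, h.trans]
  · simp [h]
  · simp [h.not_gt, h.ne', h.not_ge]

lemma degLT_last (Z : Γ.Divisor) : degLT (4 * g + 3) Z = deg Z := by
  rw [deg_eq_pair, degLT]
  exact pair_congr fun p _ => by simp [place_lt p]

lemma degAt_nonneg {Z : Γ.Divisor} (hZ : 0 ≤ Z) (j : ℕ) : 0 ≤ degAt j Z :=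
  pair_nonneg (fun p => by positivity) hZ

lemma degLT_mono {Z : Γ.Divisor} (hZ : 0 ≤ Z) {i j : ℕ} (h : i ≤ j) : degLT i Z ≤ degLT j Z := by
  induction j, h using Nat.le_induction with
  | base => rfl
  | succ j _ ih =>
    rw [degLT_succ]
    exact ih.trans (le_add_of_nonneg_right (degAt_nonneg hZ j))

lemma degAt_eq_of_place_eq_iff {j : ℕ} {q : Γ.Point} (h : ∀ p : Γ.Point, place p = j ↔ p = q)
    (Z : Γ.Divisor) : degAt j Z = Z q := by
  classical
  rw [← Int.cast_id (n := Z q), ← pair_indicator, degAt]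
  simp only [h]

lemma degAt_w (k : Fin (g + 1)) (Z : Γ.Divisor) : degAt (4 * k) Z = Z (.vertex (.w k)) := by
  refine degAt_eq_of_place_eq_iff (fun p => ?_) Z
  rcases p with (j | j) | ⟨j | j | j, t, h⟩ <;> simp [place, Fin.ext_iff] <;> omega

lemma degAt_v (k : Fin (g + 1)) (Z : Γ.Divisor) : degAt (4 * k + 2) Z = Z (.vertex (.v k)) := by
  refine degAt_eq_of_place_eq_iff (fun p => ?_) Z
  rcases p with (j | j) | ⟨j | j | j, t, h⟩ <;> simp [place, Fin.ext_iff] <;> omega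

lemma degAt_bridge (k : Fin (g + 1)) (Z : Γ.Divisor) :
    degAt (4 * k + 1) Z = degOn (.bridge k) Set.univ Z := by
  refine pair_congr fun p _ => ?_
  rcases p with (j | j) | ⟨j | j | j, t, h⟩ <;> simp [place, edgeIndicator, Fin.ext_iff] <;> omega

lemma degAt_loop (k : Fin g) (Z : Γ.Divisor) :
    degAt (4 * k + 3) Z = degOn (.top k) Set.univ Z + degOn (.bottom k) Set.univ Z := by
  rw [degAt, degOn, degOn, ← pair_add_fun]
  refine pair_congr fun p _ => ?_
  rcases p with (j | j) | ⟨j | j | j, t, h⟩ <;> simp [place, edgeIndicator, Fin.ext_iff] <;> omega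

end ChainDegrees

section Moments

variable {g : ℕ} {Γ : MetricGraph (ChainVertex g) (ChainEdge g)}

open Classical in
/-- The coordinate on the edge `e`. -/
def edgeCoord (e : ChainEdge g) : Γ.Point → ℝ
  | .vertex _ => 0
  | .inner e' t _ => if e' = e then t else 0

lemma pair_hinge_len (e : ChainEdge g) (Z : Γ.Divisor) :
    pair (hinge e (Γ.len e)) Z = Γ.len e * (degOn e Set.univ Z : ℤ) - pair (edgeCoord e) Z := by
  rw [eq_sub_iff_add_eq, ← pair_add_fun, degOn, cast_pair, ← pair_mul_fun]
  refine pair_congr fun p _ => ?_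
  rcases p with v | ⟨e', t, h⟩
  · simp [hinge, edgeCoord, edgeIndicator]
  · by_cases he : e' = e
    · subst he
      simp [hinge, edgeCoord, edgeIndicator, h.2.le]
    · simp [hinge, edgeCoord, edgeIndicator, he]

/-- The coordinate of the points on the loop `k`: `t` on the bottom edge, `-t` on the top edge. -/
def loopCoord (k : Fin g) (p : Γ.Point) : ℝ := edgeCoord (.bottom k) p + -1 * edgeCoord (.top k) p

/-- The component of the Abel–Jacobi map at the loop `k`, as a real number; it matters only modulo
the length of the loop. All chips are retracted to the loop and their coordinates are measured from
its right vertex, so that chips to the right contribute `0`. -/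
def moment (k : Fin g) : Γ.Divisor →+ ℝ :=
  pair fun p => loopCoord k p - if place p < 4 * k + 4 then Γ.len (.bottom k) else 0

lemma moment_eq (k : Fin g) (Z : Γ.Divisor) :
    moment k Z = pair (loopCoord k) Z - Γ.len (.bottom k) * (degLT (4 * k + 4) Z : ℤ) := by
  rw [moment, eq_sub_iff_add_eq, degLT, cast_pair, ← pair_mul_fun, ← pair_add_fun]
  refine pair_congr fun p _ => ?_
  split_ifs <;> simp

/-- The total length of the loop `k`. -/
def loopLen (Γ : MetricGraph (ChainVertex g) (ChainEdge g)) (k : Fin g) : ℝ :=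
  Γ.len (.top k) + Γ.len (.bottom k)

lemma pair_loopCoord (k : Fin g) (Z : Γ.Divisor) :
    pair (loopCoord k) Z = pair (edgeCoord (.bottom k)) Z - pair (edgeCoord (.top k)) Z := by
  rw [sub_eq_add_neg, ← neg_one_mul, ← pair_mul_fun, ← pair_add_fun]
  rfl

lemma loop_closes_iff (k : Fin g) (Z : Γ.Divisor) (a b : ℤ) (hab : a + b = -degLT (4 * k + 3) Z) :
    a * Γ.len (.top k) - pair (hinge (.top k) (Γ.len (.top k))) Z =
      b * Γ.len (.bottom k) - pair (hinge (.bottom k) (Γ.len (.bottom k))) Z ↔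
    moment k Z =
      ((-(b + degLT (4 * k + 3) Z + degOn (.top k) Set.univ Z) : ℤ) : ℝ) * loopLen Γ k := by
  have ha : (a : ℝ) = -b - (degLT (4 * k + 3) Z : ℤ) := by
    rw [eq_sub_of_add_eq hab]
    push_cast
    ring
  rw [moment_eq, pair_loopCoord, pair_hinge_len, pair_hinge_len, ha, degLT_succ (4 * k + 3),
    degAt_loop, loopLen]
  push_cast
  constructor <;> intro h <;> linarith

end Moments

section ChainCarries

variable {g : ℕ} {ℓ m n : ℕ → ℝ} {hℓ : ∀ k, 0 < ℓ k} {hm : ∀ k, 0 < m k} {hn : ∀ k, 0 < n k}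

local notation "𝒞" => chainOfLoops g ℓ m n hℓ hm hn

open Classical in
lemma sum_tgt_eq_w_zero (φ : ChainEdge g → ℤ) : ∑ e with tgt 𝒞 e = .w 0, φ e = 0 := by
  refine Finset.sum_eq_zero fun e he => absurd (Finset.mem_filter.1 he).2 ?_
  rcases e with j | j | j <;> simp [chainOfLoops, Fin.ext_iff]

open Classical in
lemma sum_tgt_eq_w_succ (φ : ChainEdge g → ℤ) (k : Fin g) :
    ∑ e with tgt 𝒞 e = .w k.succ, φ e = φ (.top k) + φ (.bottom k) := by
  rw [← Finset.sum_pair (by simp : (ChainEdge.top k) ≠ .bottom k)]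
  congr 1
  ext e
  rw [Finset.mem_filter]
  rcases e with j | j | j <;> simp [chainOfLoops]

open Classical in
lemma sum_tgt_eq_v (φ : ChainEdge g → ℤ) (k : Fin (g + 1)) :
    ∑ e with tgt 𝒞 e = .v k, φ e = φ (.bridge k) := by
  rw [← Finset.sum_singleton φ (.bridge k)]
  congr 1
  ext e
  rw [Finset.mem_filter]
  rcases e with j | j | j <;> simp [chainOfLoops]

open Classical in
lemma sum_src_eq_v_last (φ : ChainEdge g → ℤ) :
    ∑ e with src 𝒞 e = .v (Fin.last g), φ e = 0 := by
  refine Finset.sum_eq_zero fun e he => absurd (Finset.mem_filter.1 he).2 ?_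
  rcases e with j | j | j <;> simp [chainOfLoops, Fin.ext_iff, j.2.ne]

open Classical in
lemma sum_src_eq_v_castSucc (φ : ChainEdge g → ℤ) (k : Fin g) :
    ∑ e with src 𝒞 e = .v k.castSucc, φ e = φ (.top k) + φ (.bottom k) := by
  rw [← Finset.sum_pair (by simp : (ChainEdge.top k) ≠ .bottom k)]
  congr 1
  ext e
  rw [Finset.mem_filter]
  rcases e with j | j | j <;> simp [chainOfLoops]

open Classical in
lemma sum_src_eq_w (φ : ChainEdge g → ℤ) (k : Fin (g + 1)) :
    ∑ e with src 𝒞 e = .w k, φ e = φ (.bridge k) := by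
  rw [← Finset.sum_singleton φ (.bridge k)]
  congr 1
  ext e
  rw [Finset.mem_filter]
  rcases e with j | j | j <;> simp [chainOfLoops]

lemma degLT_w (k : Fin (g + 1)) (Z : Divisor 𝒞) :
    degLT (4 * k + 1) Z = degLT (4 * k) Z + Z (.vertex (.w k)) := by
  rw [degLT_succ, degAt_w]

lemma degLT_v (k : Fin (g + 1)) (Z : Divisor 𝒞) :
    degLT (4 * k + 3) Z =
      degLT (4 * k + 1) Z + degOn (.bridge k) Set.univ Z + Z (.vertex (.v k)) := by
  rw [degLT_succ, degAt_v, degLT_succ, degAt_bridge]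

lemma degLT_loop (k : Fin g) (Z : Divisor 𝒞) :
    degLT (4 * k.succ) Z =
      degLT (4 * k.castSucc + 3) Z + degOn (.top k) Set.univ Z + degOn (.bottom k) Set.univ Z := by
  rw [Fin.val_succ, Fin.val_castSucc, Nat.mul_succ, degLT_succ, degAt_loop, add_assoc]

/-- The slopes `σ e` at the sources of the edges are those of a function with divisor `Z`, as far as
the degrees are concerned: across every cut the total slope is minus the degree to the left. -/
def BalancedSlopes (Z : Divisor 𝒞) (σ : ChainEdge g → ℤ) : Prop :=
  (∀ k : Fin (g + 1), σ (.bridge k) = -degLT (4 * k + 1) Z) ∧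
  (∀ k : Fin g, σ (.top k) + σ (.bottom k) = -degLT (4 * k + 3) Z) ∧ deg Z = 0

open Classical in
lemma balancedSlopes_of_vertex_eq {Z : Divisor 𝒞} {σ : ChainEdge g → ℤ}
    (h : ∀ v, Z (.vertex v) = ∑ e with tgt 𝒞 e = v, (σ e - degOn e Set.univ Z) -
      ∑ e with src 𝒞 e = v, σ e) : BalancedSlopes Z σ := by
  have hw0 := h (.w 0)
  have hw (k : Fin g) := h (.w k.succ)
  have hv (k : Fin g) := h (.v k.castSucc)
  have hlast := h (.v (Fin.last g))
  simp only [sum_tgt_eq_w_zero, sum_tgt_eq_w_succ, sum_tgt_eq_v, sum_src_eq_w,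
    sum_src_eq_v_castSucc, sum_src_eq_v_last] at hw0 hw hv hlast
  have hbridge (k : Fin (g + 1)) : σ (.bridge k) = -degLT (4 * k + 1) Z := by
    induction k using Fin.induction with
    | zero =>
      rw [degLT_w, Fin.val_zero, mul_zero, degLT_zero]
      linarith
    | succ k ih =>
      rw [degLT_w, degLT_loop, degLT_v]
      linarith [hw k, hv k]
  refine ⟨hbridge, fun k => ?_, ?_⟩
  · have hdeg := degLT_v k.castSucc Z
    have hk := hv k
    rw [hbridge] at hk
    simp only [Fin.val_castSucc] at hdeg hk
    linarith
  · have hdeg := degLT_v (Fin.last g) Z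
    rw [Fin.val_last, degLT_last] at hdeg
    have hk := hbridge (Fin.last g)
    rw [Fin.val_last] at hk
    linarith

open Classical in
lemma BalancedSlopes.vertex_eq {Z : Divisor 𝒞} {σ : ChainEdge g → ℤ} (h : BalancedSlopes Z σ)
    (v : ChainVertex g) :
    Z (.vertex v) = ∑ e with tgt 𝒞 e = v, (σ e - degOn e Set.univ Z) -
      ∑ e with src 𝒞 e = v, σ e := by
  obtain ⟨hbridge, hloop, hdeg⟩ := h
  rcases v with k | k
  · rw [sum_src_eq_w, hbridge, degLT_w]
    induction k using Fin.cases with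
    | zero =>
      rw [sum_tgt_eq_w_zero, Fin.val_zero, mul_zero, degLT_zero]
      ring
    | succ k =>
      rw [sum_tgt_eq_w_succ, degLT_loop, Fin.val_castSucc]
      linarith [hloop k]
  · rw [sum_tgt_eq_v, hbridge]
    have hv := degLT_v k Z
    induction k using Fin.lastCases with
    | last =>
      rw [sum_src_eq_v_last]
      rw [Fin.val_last, degLT_last, hdeg] at hv
      rw [Fin.val_last]
      linarith
    | cast k =>
      rw [sum_src_eq_v_castSucc, hloop]
      rw [Fin.val_castSucc] at *
      linarith

lemma chain_carries_iff {f : Point 𝒞 → ℝ} {D D' : Divisor 𝒞} :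
    Carries 𝒞 f D D' ↔ ∃ σ : ChainEdge g → ℤ,
      (∀ e, HasInitialSlope f (D' - D) e (σ e)) ∧ BalancedSlopes (D' - D) σ := by
  rw [carries_iff_hasInitialSlope]
  exact exists_congr fun σ => and_congr_right'
    ⟨balancedSlopes_of_vertex_eq, fun h v => h.vertex_eq v⟩

lemma exists_partial_sums (c : Fin g → ℝ) :
    ∃ W : Fin (g + 1) → ℝ, W 0 = 0 ∧ ∀ k : Fin g, W k.succ = W k.castSucc + c k :=
  ⟨fun k => Fin.induction (motive := fun _ => ℝ) 0 (fun k a => a + c k) k, rfl, fun _ => rfl⟩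

lemma exists_carries {D D' : Divisor 𝒞} {σ : ChainEdge g → ℤ} (hσ : BalancedSlopes (D' - D) σ)
    (hclose : ∀ k : Fin g,
      σ (.top k) * ℓ (k + 1) - pair (hinge (.top k) (ℓ (k + 1))) (D' - D) =
        σ (.bottom k) * m (k + 1) - pair (hinge (.bottom k) (m (k + 1))) (D' - D)) :
    ∃ f : Point 𝒞 → ℝ, Carries 𝒞 f D D' ∧ f (.vertex (.w 0)) = 0 ∧
      ∀ e, HasInitialSlope f (D' - D) e (σ e) := by
  let inc (e : ChainEdge g) : ℝ := σ e * len 𝒞 e - pair (hinge e (len 𝒞 e)) (D' - D)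
  obtain ⟨W, hW0, hW⟩ := exists_partial_sums fun k : Fin g =>
    inc (.bridge k.castSucc) + inc (.bottom k)
  obtain ⟨f, hv, hf⟩ := exists_hasInitialSlope (Γ := 𝒞) (D' - D)
    (fun | .w k => W k | .v k => W k + inc (.bridge k)) σ (by
      rintro (k | k | k)
      · simp only [chainOfLoops, inc]
        ring
      · have hk := hclose k
        have hWk := hW k
        simp only [chainOfLoops, inc] at hk hWk ⊢
        linarith
      · have hWk := hW k
        simp only [chainOfLoops, inc] at hWk ⊢
        linarith)
  exact ⟨f, chain_carries_iff.2 ⟨σ, hf, hσ⟩, (hv _).trans hW0, hf⟩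

theorem chain_linEquiv_iff {D D' : Divisor 𝒞} :
    LinEquiv 𝒞 D D' ↔ deg D' = deg D ∧
      ∀ k : Fin g, ∃ z : ℤ, moment k D' - moment k D = z * loopLen 𝒞 k := by
  have hdeg : deg (D' - D) = deg D' - deg D := by simp only [deg_eq_pair, map_sub]
  simp only [← map_sub (moment _)]
  constructor
  · rintro ⟨f, hf⟩
    obtain ⟨σ, hσ, -, hloop, hZ⟩ := chain_carries_iff.1 hf
    refine ⟨by linarith, fun k => ⟨_, (loop_closes_iff k (D' - D) _ _ (hloop k)).1 ?_⟩⟩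
    have htop := hσ (.top k) _ (len_pos 𝒞 _).le le_rfl
    have hbottom := hσ (.bottom k) _ (len_pos 𝒞 _).le le_rfl
    rw [pt_len] at htop hbottom
    simp only [chainOfLoops] at htop hbottom ⊢
    linarith
  · rintro ⟨hd, hmoment⟩
    choose z hz using hmoment
    let b (k : Fin g) : ℤ := -z k - degLT (4 * k + 3) (D' - D) - degOn (.top k) Set.univ (D' - D)
    let σ : ChainEdge g → ℤ
      | .bridge k => -degLT (4 * k + 1) (D' - D)
      | .top k => -degLT (4 * k + 3) (D' - D) - b k
      | .bottom k => b k
    have hσ : BalancedSlopes (D' - D) σ :=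
      ⟨fun k => rfl, fun k => by simp [σ], by rw [hdeg, hd, sub_self]⟩
    obtain ⟨f, hf, -⟩ := exists_carries hσ fun k =>
      (loop_closes_iff k (D' - D) _ _ (hσ.2.1 k)).2 (by
        rw [hz]
        congr 2
        simp only [σ, b]
        ring)
    exact ⟨f, hf⟩

end ChainCarries

section ChipData

variable {g : ℕ}

/-- The point of coordinate `u` on the loop `k`: on the bottom edge at distance `u` from the left
vertex if `u` is positive, on the top edge at distance `-u` otherwise. -/
def loopPt (Γ : MetricGraph (ChainVertex g) (ChainEdge g)) (k : Fin g) (u : ℝ) : Γ.Point :=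
  if 0 < u then Γ.pt (.bottom k) u else Γ.pt (.top k) (-u)

/-- The divisor with `a` chips at the left end, `b` chips at the right end, and one chip at
the position `x k` on the loop `k` whenever `x k` is not `none`. -/
def stdDiv (Γ : MetricGraph (ChainVertex g) (ChainEdge g)) (a : ℤ) (x : ℕ → Option ℝ) (b : ℤ) :
    Γ.Divisor :=
  Finsupp.single (leftEnd Γ) a +
    ∑ k : Fin g, (x k).elim 0 (fun u => Finsupp.single (loopPt Γ k u) 1) +
    Finsupp.single (rightEnd Γ) b

/-- The positions are interior points of the edges of the loops. -/
def ValidChips (g : ℕ) (ℓ m : ℕ → ℝ) (x : ℕ → Option ℝ) : Prop :=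
  ∀ k < g, ∀ u ∈ x k, -ℓ (k + 1) < u ∧ u < m (k + 1) ∧ u ≠ 0

/-- The number of chips to the left of the loop `k`, when there are `a` chips at the left end. -/
def chipsLT (a : ℤ) (x : ℕ → Option ℝ) (k : ℕ) : ℤ :=
  a + ∑ j ∈ Finset.range k, if (x j).isSome then 1 else 0

lemma chipsLT_zero (a : ℤ) (x : ℕ → Option ℝ) : chipsLT a x 0 = a := by
  simp [chipsLT]

lemma chipsLT_succ (a : ℤ) (x : ℕ → Option ℝ) (k : ℕ) :
    chipsLT a x (k + 1) = chipsLT a x k + if (x k).isSome then 1 else 0 := by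
  rw [chipsLT, chipsLT, Finset.sum_range_succ, add_assoc]

lemma pair_stdDiv {R : Type*} [Ring R] {Γ : MetricGraph (ChainVertex g) (ChainEdge g)}
    (φ : Γ.Point → R) (a : ℤ) (x : ℕ → Option ℝ) (b : ℤ) :
    pair φ (stdDiv Γ a x b) = a * φ (leftEnd Γ) +
      ∑ k : Fin g, (x k).elim 0 (fun u => φ (loopPt Γ k u)) + b * φ (rightEnd Γ) := by
  rw [stdDiv, map_add, map_add, pair_single, pair_single, map_sum]
  congr 2
  refine Finset.sum_congr rfl fun k _ => ?_
  cases x k <;> simp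

lemma deg_stdDiv {Γ : MetricGraph (ChainVertex g) (ChainEdge g)} (a : ℤ) (x : ℕ → Option ℝ)
    (b : ℤ) : deg (stdDiv Γ a x b) = chipsLT a x g + b := by
  rw [deg_eq_pair, pair_stdDiv, chipsLT, Finset.sum_range]
  simp only [Int.cast_id, mul_one]
  congr 2
  refine Finset.sum_congr rfl fun i _ => ?_
  cases x i <;> simp

open Classical in
lemma stdDiv_apply {Γ : MetricGraph (ChainVertex g) (ChainEdge g)} (a : ℤ) (x : ℕ → Option ℝ)
    (b : ℤ) (p : Γ.Point) :
    stdDiv Γ a x b p = a * (if leftEnd Γ = p then 1 else 0) +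
      ∑ k : Fin g, (x k).elim 0 (fun u => if loopPt Γ k u = p then 1 else 0) +
      b * (if rightEnd Γ = p then 1 else 0) := by
  rw [← Int.cast_id (n := stdDiv Γ a x b p), ← pair_indicator, pair_stdDiv]
  rfl

lemma stdDiv_nonneg {Γ : MetricGraph (ChainVertex g) (ChainEdge g)} {a b : ℤ} (ha : 0 ≤ a)
    (x : ℕ → Option ℝ) (hb : 0 ≤ b) : 0 ≤ stdDiv Γ a x b := by
  refine add_nonneg (add_nonneg (by simpa using ha) (Finset.sum_nonneg fun i _ => ?_))
    (by simpa using hb)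
  cases x i <;> simp

end ChipData

section ChipDataOnChain

variable {g : ℕ} {ℓ m n : ℕ → ℝ} {hℓ : ∀ k, 0 < ℓ k} {hm : ∀ k, 0 < m k} {hn : ∀ k, 0 < n k}

local notation "𝒞" => chainOfLoops g ℓ m n hℓ hm hn

lemma loopPt_eq_inner (k : Fin g) {u : ℝ} (h : -ℓ (k + 1) < u ∧ u < m (k + 1) ∧ u ≠ 0) :
    (0 < u ∧ ∃ h', loopPt 𝒞 k u = .inner (.bottom k) u h') ∨
    (u < 0 ∧ ∃ h', loopPt 𝒞 k u = .inner (.top k) (-u) h') := by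
  obtain ⟨hℓu, hum, hu⟩ := h
  rcases hu.lt_or_gt with hneg | hpos
  · have hu' : 0 < -u ∧ -u < len 𝒞 (.top k) := ⟨neg_pos.2 hneg, neg_lt.1 hℓu⟩
    exact .inr ⟨hneg, hu', by rw [loopPt, if_neg hneg.not_gt, pt_inner hu']⟩
  · have hu' : 0 < u ∧ u < len 𝒞 (.bottom k) := ⟨hpos, hum⟩
    exact .inl ⟨hpos, hu', by rw [loopPt, if_pos hpos, pt_inner hu']⟩

lemma loopPt_zero (k : Fin g) : loopPt 𝒞 k 0 = .vertex (.v k.castSucc) := by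
  rw [loopPt, if_neg (lt_irrefl _), neg_zero, pt_zero]
  rfl

lemma loopPt_right (k : Fin g) : loopPt 𝒞 k (m (k + 1)) = .vertex (.w k.succ) := by
  rw [loopPt, if_pos (hm _)]
  exact pt_len (Γ := 𝒞) (.bottom k)

lemma place_loopPt (k : Fin g) {u : ℝ} (h : -ℓ (k + 1) < u ∧ u < m (k + 1) ∧ u ≠ 0) :
    place (loopPt 𝒞 k u) = 4 * k + 3 := by
  rcases loopPt_eq_inner (hℓ := hℓ) (hm := hm) (hn := hn) k h with ⟨-, _, e⟩ | ⟨-, _, e⟩ <;>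
    rw [e] <;> rfl

lemma loopCoord_loopPt (j k : Fin g) {u : ℝ} (h : -ℓ (k + 1) < u ∧ u < m (k + 1) ∧ u ≠ 0) :
    loopCoord j (loopPt 𝒞 k u) = if k = j then u else 0 := by
  rcases loopPt_eq_inner (hℓ := hℓ) (hm := hm) (hn := hn) k h with ⟨-, _, e⟩ | ⟨-, _, e⟩ <;>
    rw [e] <;> simp [loopCoord, edgeCoord]

variable {x : ℕ → Option ℝ} {a b : ℤ}

lemma degLT_stdDiv (hx : ValidChips g ℓ m x) {j k : ℕ} (hkj : 4 * k ≤ j) (hjk : j ≤ 4 * k + 3)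
    (hj : 1 ≤ j) (hjg : j ≤ 4 * g + 2) : degLT j (stdDiv 𝒞 a x b) = chipsLT a x k := by
  have hleft : place (leftEnd 𝒞) < j := by
    simp only [leftEnd, place, Fin.val_zero]
    omega
  have hright : ¬place (rightEnd 𝒞) < j := by
    simp only [rightEnd, place, Fin.val_last]
    omega
  have hrange : Finset.range k = (Finset.range g).filter (· < k) := by
    ext i
    simp only [Finset.mem_range, Finset.mem_filter]
    omega
  rw [degLT, pair_stdDiv, if_pos hleft, if_neg hright, chipsLT, hrange, Finset.sum_filter,
    Finset.sum_range]
  simp only [Int.cast_id, mul_one, mul_zero, add_zero]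
  congr 1
  refine Finset.sum_congr rfl fun i _ => ?_
  rcases hxi : x i with _ | u
  · simp
  · simp only [Option.elim_some, Option.isSome_some, if_true]
    rw [place_loopPt i (hx i i.2 u hxi)]
    exact if_congr (by omega) rfl rfl

lemma pair_stdDiv_of_loop {R : Type*} [Ring R] (hx : ValidChips g ℓ m x) (k : Fin g)
    {φ : Point 𝒞 → R} (hleft : φ (leftEnd 𝒞) = 0) (hright : φ (rightEnd 𝒞) = 0)
    (hφ : ∀ i ≠ k, ∀ u, -ℓ (i + 1) < u ∧ u < m (i + 1) ∧ u ≠ 0 → φ (loopPt 𝒞 i u) = 0) :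
    pair φ (stdDiv 𝒞 a x b) = (x k).elim 0 fun u => φ (loopPt 𝒞 k u) := by
  rw [pair_stdDiv, Finset.sum_eq_single_of_mem k (Finset.mem_univ k), hleft, hright]
  · simp
  · intro i _ hi
    rcases hxi : x i with _ | u
    · rfl
    · exact hφ i hi u (hx i i.2 u hxi)

lemma pair_loopCoord_stdDiv (hx : ValidChips g ℓ m x) (k : Fin g) :
    pair (loopCoord k) (stdDiv 𝒞 a x b) = (x k).getD 0 := by
  rw [pair_stdDiv_of_loop hx k]
  · rcases hxk : x k with _ | u
    · rfl
    · simp [loopCoord_loopPt k k (hx k k.2 u hxk)]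
  · simp [loopCoord, edgeCoord, leftEnd]
  · simp [loopCoord, edgeCoord, rightEnd]
  · intro i hi u hu
    rw [loopCoord_loopPt k i hu, if_neg hi]

lemma moment_stdDiv (hx : ValidChips g ℓ m x) (k : Fin g) :
    moment k (stdDiv 𝒞 a x b) = (x k).getD 0 - m (k + 1) * (chipsLT a x (k + 1) : ℤ) := by
  rw [moment_eq, pair_loopCoord_stdDiv hx,
    degLT_stdDiv (k := (k : ℕ) + 1) hx (by omega) (by omega) (by omega) (by omega)]
  rfl

/-- The contribution of a chip to a function on the bottom edge of its loop. -/
def bottomHinge (o : Option ℝ) (t : ℝ) : ℝ := o.elim 0 fun u => if 0 < u then max (t - u) 0 else 0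

/-- The contribution of a chip to a function on the top edge of its loop. -/
def topHinge (o : Option ℝ) (t : ℝ) : ℝ := o.elim 0 fun u => if 0 < u then 0 else max (t + u) 0

lemma pair_hinge_bridge (hx : ValidChips g ℓ m x) (k : Fin (g + 1)) (t : ℝ) :
    pair (hinge (.bridge k) t) (stdDiv 𝒞 a x b) = 0 := by
  rw [pair_stdDiv, Finset.sum_eq_zero]
  · simp [hinge, leftEnd, rightEnd]
  · intro i _
    rcases hxi : x i with _ | u
    · rfl
    · rcases loopPt_eq_inner (hℓ := hℓ) (hm := hm) (hn := hn) i (hx i i.2 u hxi) with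
        ⟨-, _, e⟩ | ⟨-, _, e⟩ <;> simp [e, hinge]

lemma pair_hinge_bottom (hx : ValidChips g ℓ m x) (k : Fin g) (t : ℝ) :
    pair (hinge (.bottom k) t) (stdDiv 𝒞 a x b) = bottomHinge (x k) t := by
  rw [pair_stdDiv_of_loop hx k rfl rfl]
  · rcases hxk : x k with _ | u
    · rfl
    · rcases loopPt_eq_inner (hℓ := hℓ) (hm := hm) (hn := hn) k (hx k k.2 u hxk) with
        ⟨h, _, e⟩ | ⟨h, _, e⟩ <;> simp [e, hinge, bottomHinge, h, h.not_gt]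
  · intro i hi u hu
    rcases loopPt_eq_inner (hℓ := hℓ) (hm := hm) (hn := hn) i hu with
      ⟨-, _, e⟩ | ⟨-, _, e⟩ <;> simp [e, hinge, hi]

lemma pair_hinge_top (hx : ValidChips g ℓ m x) (k : Fin g) (t : ℝ) :
    pair (hinge (.top k) t) (stdDiv 𝒞 a x b) = topHinge (x k) t := by
  rw [pair_stdDiv_of_loop hx k rfl rfl]
  · rcases hxk : x k with _ | u
    · rfl
    · rcases loopPt_eq_inner (hℓ := hℓ) (hm := hm) (hn := hn) k (hx k k.2 u hxk) with
        ⟨h, _, e⟩ | ⟨h, _, e⟩ <;> simp [e, hinge, topHinge, h, h.not_gt]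
  · intro i hi u hu
    rcases loopPt_eq_inner (hℓ := hℓ) (hm := hm) (hn := hn) i hu with
      ⟨-, _, e⟩ | ⟨-, _, e⟩ <;> simp [e, hinge, hi]

open Classical in
lemma stdDiv_vertex (hx : ValidChips g ℓ m x) (w : ChainVertex g) :
    stdDiv 𝒞 a x b (.vertex w) = a * (if .w 0 = w then 1 else 0) +
      b * (if .v (Fin.last g) = w then 1 else 0) := by
  rw [stdDiv_apply, Finset.sum_eq_zero]
  · simp only [leftEnd, rightEnd, add_zero, Point.vertex.injEq]
  · intro i _
    rcases hxi : x i with _ | u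
    · rfl
    · rcases loopPt_eq_inner (hℓ := hℓ) (hm := hm) (hn := hn) i (hx i i.2 u hxi) with
        ⟨-, _, e⟩ | ⟨-, _, e⟩ <;> simp [e]

lemma stdDiv_leftEnd (hx : ValidChips g ℓ m x) : stdDiv 𝒞 a x b (leftEnd 𝒞) = a := by
  simp [leftEnd, stdDiv_vertex hx]

lemma stdDiv_rightEnd (hx : ValidChips g ℓ m x) : stdDiv 𝒞 a x b (rightEnd 𝒞) = b := by
  simp [rightEnd, stdDiv_vertex hx]

lemma stdDiv_v (hx : ValidChips g ℓ m x) (k : Fin g) :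
    stdDiv 𝒞 a x b (.vertex (.v k.castSucc)) = 0 := by
  simp [stdDiv_vertex hx, Fin.ext_iff, k.2.ne']

lemma stdDiv_w (hx : ValidChips g ℓ m x) (k : Fin g) :
    stdDiv 𝒞 a x b (.vertex (.w k.succ)) = 0 := by
  simp [stdDiv_vertex hx, Fin.ext_iff]

end ChipDataOnChain

section Effective

variable {g : ℕ} {Γ : MetricGraph (ChainVertex g) (ChainEdge g)}

lemma apply_le_degAt {F : Γ.Divisor} (hF : 0 ≤ F) (p : Γ.Point) : F p ≤ degAt (place p) F := by
  classical
  have hind : ∀ q : Γ.Point,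
      0 ≤ (if place q = place p then (1 : ℤ) else 0) + -1 * (if q = p then 1 else 0) := by
    intro q
    by_cases h : q = p
    · simp [h]
    · simp only [h, if_false, mul_zero, add_zero]
      positivity
  have hpair := pair_nonneg hind hF
  rw [pair_add_fun, pair_mul_fun, pair_indicator, Int.cast_id] at hpair
  rw [degAt]
  linarith

lemma apply_eq_zero_of_degAt {F : Γ.Divisor} (hF : 0 ≤ F) {p : Γ.Point}
    (h : degAt (place p) F = 0) : F p = 0 :=
  le_antisymm ((apply_le_degAt hF p).trans_eq h) (hF p)

lemma exists_pos_of_degAt_pos {F : Γ.Divisor} {j : ℕ} (h : 0 < degAt j F) :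
    ∃ p, place p = j ∧ 0 < F p := by
  by_contra! hc
  refine h.not_ge ?_
  rw [degAt, pair_apply]
  refine Finset.sum_nonpos fun p _ => ?_
  by_cases hp : place p = j
  · simpa [hp] using hc p hp
  · simp [hp]

lemma degAt_single (p : Γ.Point) (c : ℤ) :
    degAt (place p) (Finsupp.single p c) = c := by
  simp [degAt]

lemma loopCoord_eq_zero {k : Fin g} {p : Γ.Point} (h : place p ≠ 4 * k + 3) :
    loopCoord k p = 0 := by
  rcases p with v | ⟨i | i | i, t, ht⟩
  · simp [loopCoord, edgeCoord]
  · simp [loopCoord, edgeCoord]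
  all_goals
    have hik : i ≠ k := by
      rintro rfl
      exact h rfl
    simp [loopCoord, edgeCoord, hik]

lemma pair_loopCoord_eq_zero {F : Γ.Divisor} (hF : 0 ≤ F) {k : Fin g}
    (h : degAt (4 * k + 3) F = 0) : pair (loopCoord k) F = 0 :=
  pair_eq_zero fun _ hp => loopCoord_eq_zero fun hplace =>
    hp (apply_eq_zero_of_degAt hF (hplace ▸ h))

lemma moment_single (k : Fin g) (p : Γ.Point) (c : ℤ) :
    moment k (Finsupp.single p c) =
      c * (loopCoord k p - if place p < 4 * k + 4 then Γ.len (.bottom k) else 0) :=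
  pair_single _ _ _

lemma moment_single_of_place_ne {k : Fin g} {p : Γ.Point} (h : place p ≠ 4 * k + 3) (c : ℤ) :
    moment k (Finsupp.single p c) =
      if place p < 4 * k + 4 then -Γ.len (.bottom k) * c else 0 := by
  rw [moment_single, loopCoord_eq_zero h]
  split_ifs
  · ring
  · ring

lemma single_nonneg (p : Γ.Point) : (0 : Γ.Divisor) ≤ Finsupp.single p 1 :=
  Finsupp.single_nonneg.2 zero_le_one

lemma sub_single_nonneg {F : Γ.Divisor} (hF : 0 ≤ F) {p : Γ.Point} (hp : 0 < F p) :
    0 ≤ F - Finsupp.single p 1 := by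
  classical
  intro q
  rw [Finsupp.coe_sub, Pi.sub_apply, Finsupp.single_apply]
  split_ifs with h
  · subst h
    exact sub_nonneg.2 hp
  · simpa using hF q

lemma stdDiv_congr {a b : ℤ} {x x' : ℕ → Option ℝ} (h : ∀ k < g, x k = x' k) :
    stdDiv Γ a x b = stdDiv Γ a x' b := by
  rw [stdDiv, stdDiv]
  congr 2
  exact Finset.sum_congr rfl fun k _ => by rw [h k k.2]

end Effective

section LoopPoints

variable {g : ℕ} {ℓ m n : ℕ → ℝ} {hℓ : ∀ k, 0 < ℓ k} {hm : ∀ k, 0 < m k} {hn : ∀ k, 0 < n k}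

local notation "𝒞" => chainOfLoops g ℓ m n hℓ hm hn

lemma exists_eq_loopPt {k : Fin g} {p : Point 𝒞} (hp : place p = 4 * k + 3) :
    ∃ u, (-ℓ (k + 1) < u ∧ u < m (k + 1) ∧ u ≠ 0) ∧ p = loopPt 𝒞 k u := by
  rcases p with (i | i) | ⟨i | i | i, t, ht⟩ <;> simp only [place] at hp
  · omega
  · omega
  · omega
  · obtain rfl : i = k := Fin.ext (by omega)
    have htℓ : t < ℓ (i + 1) := ht.2
    refine ⟨-t, ⟨neg_lt_neg htℓ, by linarith [ht.1, hm (i + 1)], by linarith [ht.1]⟩, ?_⟩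
    rw [loopPt, if_neg (by linarith [ht.1]), neg_neg, pt_inner ht]
  · obtain rfl : i = k := Fin.ext (by omega)
    refine ⟨t, ⟨by linarith [ht.1, hℓ (i + 1)], ht.2, ht.1.ne'⟩, ?_⟩
    rw [loopPt, if_pos ht.1, pt_inner ht]

lemma place_loopPt_of_le (k : Fin g) {u : ℝ} (h1 : -ℓ (k + 1) < u) (h2 : u ≤ m (k + 1)) :
    place (loopPt 𝒞 k u) = if u = 0 then 4 * (k : ℕ) + 2 else
      if u = m (k + 1) then 4 * (k : ℕ) + 4 else 4 * k + 3 := by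
  split_ifs with h3 h4
  · rw [h3, loopPt_zero]
    rfl
  · rw [h4, loopPt_right]
    simp only [place, Fin.val_succ]
    ring
  · exact place_loopPt k ⟨h1, lt_of_le_of_ne h2 h4, h3⟩

lemma moment_loopPt_self (k : Fin g) {u : ℝ} (h1 : -ℓ (k + 1) < u) (h2 : u ≤ m (k + 1)) :
    moment k (Finsupp.single (loopPt 𝒞 k u) 1) = u - m (k + 1) := by
  have hlen : len 𝒞 (.bottom k) = m (k + 1) := rfl
  rw [moment_single, Int.cast_one, one_mul, hlen]
  by_cases h0 : u = 0
  · rw [h0, loopPt_zero, loopCoord_eq_zero (by simp only [place, Fin.val_castSucc]; omega),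
      if_pos (by simp only [place, Fin.val_castSucc]; omega)]
  rcases h2.eq_or_lt with rfl | hlt
  · rw [loopPt_right, loopCoord_eq_zero (by simp only [place, Fin.val_succ]; omega),
      if_neg (by simp only [place, Fin.val_succ]; omega)]
    ring
  · have hu := And.intro h1 (And.intro hlt h0)
    rw [loopCoord_loopPt k k hu, place_loopPt k hu, if_pos rfl, if_pos (by omega)]

lemma moment_loopPt_of_ne {j k : Fin g} (hkj : k ≠ j) {u : ℝ} (h1 : -ℓ (k + 1) < u)
    (h2 : u ≤ m (k + 1)) :
    moment j (Finsupp.single (loopPt 𝒞 k u) 1) = if k < j then -m (j + 1) else 0 := by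
  have hkj' : (k : ℕ) ≠ j := Fin.val_ne_of_ne hkj
  have hplace := place_loopPt_of_le (hℓ := hℓ) (hm := hm) (hn := hn) k h1 h2
  have hne : place (loopPt 𝒞 k u) ≠ 4 * j + 3 := by
    rw [hplace]
    split_ifs <;> omega
  have hlt : place (loopPt 𝒞 k u) < 4 * j + 4 ↔ k < j := by
    rw [hplace, Fin.lt_def]
    split_ifs <;> omega
  rw [moment_single_of_place_ne hne, if_congr hlt rfl rfl, Int.cast_one, mul_one]
  rfl

lemma exists_chip_of_degAt_le_one {F : Divisor 𝒞} (hF : 0 ≤ F) {k : Fin g}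
    (hk : degAt (4 * k + 3) F ≤ 1) :
    ∃ o : Option ℝ, (∀ u ∈ o, -ℓ (k + 1) < u ∧ u < m (k + 1) ∧ u ≠ 0) ∧
      ∀ p, place p = 4 * k + 3 → F p = o.elim 0 (fun u => Finsupp.single (loopPt 𝒞 k u) 1 p) := by
  rcases (degAt_nonneg hF (4 * k + 3)).eq_or_lt with h0 | h0
  · exact ⟨none, by simp, fun p hp => apply_eq_zero_of_degAt hF (by rw [hp, h0])⟩
  · obtain ⟨p, hp, hFp⟩ := exists_pos_of_degAt_pos h0
    obtain ⟨u, hu, rfl⟩ := exists_eq_loopPt hp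
    have hdeg : degAt (4 * k + 3) (F - Finsupp.single (loopPt 𝒞 k u) 1) = 0 := by
      have hnonneg := degAt_nonneg (sub_single_nonneg hF hFp) (4 * k + 3)
      have hsingle := degAt_single (loopPt 𝒞 k u) 1
      rw [hp] at hsingle
      rw [map_sub, hsingle] at hnonneg ⊢
      omega
    refine ⟨some u, fun _ h => Option.some_injective _ h ▸ hu, fun q hq => sub_eq_zero.1 ?_⟩
    exact apply_eq_zero_of_degAt (sub_single_nonneg hF hFp) (hq ▸ hdeg)

lemma stdDiv_apply_of_place_eq {x : ℕ → Option ℝ} (hx : ValidChips g ℓ m x) (a b : ℤ) {k : Fin g}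
    {p : Point 𝒞} (hp : place p = 4 * k + 3) :
    stdDiv 𝒞 a x b p = (x k).elim 0 (fun u => Finsupp.single (loopPt 𝒞 k u) 1 p) := by
  classical
  rw [← Int.cast_id (n := stdDiv 𝒞 a x b p), ← pair_indicator, pair_stdDiv_of_loop hx k]
  · cases x k <;> simp [Finsupp.single_apply]
  · refine if_neg ?_
    rintro rfl
    simp [place, leftEnd] at hp
  · refine if_neg ?_
    rintro rfl
    simp only [place, rightEnd] at hp
    omega
  · intro i hi u hu
    refine if_neg ?_
    rintro rfl
    rw [place_loopPt i hu] at hp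
    exact hi (Fin.ext (by omega))

lemma stdDiv_apply_bridge {x : ℕ → Option ℝ} (hx : ValidChips g ℓ m x) (a b : ℤ)
    (k : Fin (g + 1)) {t : ℝ} (ht : 0 < t ∧ t < len 𝒞 (.bridge k)) :
    stdDiv 𝒞 a x b (.inner (.bridge k) t ht) = 0 := by
  classical
  rw [stdDiv_apply, Finset.sum_eq_zero]
  · simp [leftEnd, rightEnd]
  · intro i _
    rcases hxi : x i with _ | u
    · rfl
    · refine if_neg fun h => ?_
      have hplace := place_loopPt (hℓ := hℓ) (hm := hm) (hn := hn) i (hx i i.2 u hxi)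
      rw [h] at hplace
      simp only [place] at hplace
      omega

lemma exists_eq_stdDiv {F : Divisor 𝒞} (hF : 0 ≤ F)
    (hv : ∀ k : Fin g, F (.vertex (.v k.castSucc)) = 0)
    (hw : ∀ k : Fin g, F (.vertex (.w k.succ)) = 0)
    (hb : ∀ k : Fin (g + 1), degAt (4 * k + 1) F = 0)
    (hl : ∀ k : Fin g, degAt (4 * k + 3) F ≤ 1) :
    ∃ x, ValidChips g ℓ m x ∧ F = stdDiv 𝒞 (F (leftEnd 𝒞)) x (F (rightEnd 𝒞)) := by
  choose o ho hoF using fun k => exists_chip_of_degAt_le_one hF (hl k)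
  let x (k : ℕ) : Option ℝ := if h : k < g then o ⟨k, h⟩ else none
  have hxo (k : Fin g) : x k = o k := by simp [x]
  have hx : ValidChips g ℓ m x := fun k hk u hu => ho ⟨k, hk⟩ u (hxo ⟨k, hk⟩ ▸ hu)
  have hloop (k : Fin g) (p : Point 𝒞) (hp : place p = 4 * k + 3) :
      F p = stdDiv 𝒞 (F (leftEnd 𝒞)) x (F (rightEnd 𝒞)) p := by
    rw [stdDiv_apply_of_place_eq hx _ _ hp, hxo, hoF k p hp]
  refine ⟨x, hx, Finsupp.ext fun p => ?_⟩
  rcases p with (k | k) | ⟨k | k | k, t, ht⟩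
  · rcases Fin.eq_zero_or_eq_succ k with rfl | ⟨k, rfl⟩
    · exact (stdDiv_leftEnd hx).symm
    · rw [hw, stdDiv_w hx]
  · rcases Fin.eq_castSucc_or_eq_last k with ⟨k, rfl⟩ | rfl
    · rw [hv, stdDiv_v hx]
    · exact (stdDiv_rightEnd hx).symm
  · rw [stdDiv_apply_bridge hx]
    exact apply_eq_zero_of_degAt hF (hb k)
  · exact hloop k _ rfl
  · exact hloop k _ rfl

end LoopPoints

section Uniqueness

variable {g : ℕ} {ℓ m n : ℕ → ℝ} {hℓ : ∀ k, 0 < ℓ k} {hm : ∀ k, 0 < m k} {hn : ∀ k, 0 < n k}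

local notation "𝒞" => chainOfLoops g ℓ m n hℓ hm hn

lemma eq_zero_of_eq_mul_of_abs_lt {L c : ℝ} {z : ℤ} (h : c = z * L) (hc : |c| < L) : c = 0 := by
  have hL : 0 < L := (abs_nonneg c).trans_lt hc
  rw [h, abs_mul, abs_of_pos hL] at hc
  have hz : |(z : ℝ)| < 1 := lt_of_mul_lt_mul_right (by linarith) hL.le
  rw [h, Int.abs_lt_one_iff.1 (by exact_mod_cast hz : |z| < 1), Int.cast_zero, zero_mul]

lemma degAt_loop_stdDiv {x : ℕ → Option ℝ} {a b : ℤ} (hx : ValidChips g ℓ m x) {k : ℕ}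
    (hk : k < g) :
    degAt (4 * k + 3) (stdDiv 𝒞 a x b) = if (x k).isSome then 1 else 0 := by
  have hsucc := degLT_succ (4 * k + 3) (stdDiv 𝒞 a x b)
  rw [degLT_stdDiv (k := k + 1) hx (by omega) (by omega) (by omega) (by omega),
    degLT_stdDiv (k := k) hx (by omega) (by omega) (by omega) (by omega), chipsLT_succ] at hsucc
  exact (add_left_cancel hsucc).symm

lemma exists_loopCoord_eq {x : ℕ → Option ℝ} {a b : ℤ} {F : Divisor 𝒞}
    (hx : ValidChips g ℓ m x) (h : LinEquiv 𝒞 (stdDiv 𝒞 a x b) F) (k : Fin g) :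
    ∃ z : ℤ, pair (loopCoord k) F =
      (x k).getD 0 + m (k + 1) * (degLT (4 * k + 4) F - chipsLT a x (k + 1) : ℤ) +
        z * (ℓ (k + 1) + m (k + 1)) := by
  obtain ⟨z, hz⟩ := (chain_linEquiv_iff.1 h).2 k
  rw [moment_stdDiv hx, moment_eq] at hz
  refine ⟨z, ?_⟩
  have hlen : len 𝒞 (.bottom k) = m (k + 1) := rfl
  have hloop : loopLen 𝒞 k = ℓ (k + 1) + m (k + 1) := rfl
  rw [hlen, hloop] at hz
  push_cast
  linear_combination hz

lemma degAt_loop_pos {x : ℕ → Option ℝ} {a b : ℤ} {F : Divisor 𝒞}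
    (hx : ValidChips g ℓ m x) (h : LinEquiv 𝒞 (stdDiv 𝒞 a x b) F) (hF : 0 ≤ F)
    {k : ℕ} (hk : k < g) (hxk : (x k).isSome)
    (hdeg : degLT (4 * k + 4) F = chipsLT a x k ∨ degLT (4 * k + 4) F = chipsLT a x k + 1) :
    0 < degAt (4 * k + 3) F := by
  refine lt_of_le_of_ne (degAt_nonneg hF _) fun h0 => ?_
  obtain ⟨u, hu⟩ := Option.isSome_iff_exists.1 hxk
  obtain ⟨hℓu, hum, hu0⟩ := hx k hk u hu
  obtain ⟨z, hz⟩ := exists_loopCoord_eq hx h ⟨k, hk⟩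
  rw [pair_loopCoord_eq_zero (k := ⟨k, hk⟩) hF h0.symm] at hz
  simp only [hu, Option.getD_some, chipsLT_succ, Option.isSome_some, if_true] at hz
  have hℓk := hℓ (k + 1)
  have hmk := hm (k + 1)
  rcases hdeg with hdeg | hdeg <;> rw [hdeg] at hz <;> push_cast at hz
  · have hzero : m (k + 1) - u = 0 :=
      eq_zero_of_eq_mul_of_abs_lt (z := z) (L := ℓ (k + 1) + m (k + 1)) (by linarith)
        (abs_lt.2 ⟨by linarith, by linarith⟩)
    linarith
  · have hzero : -u = 0 :=
      eq_zero_of_eq_mul_of_abs_lt (z := z) (L := ℓ (k + 1) + m (k + 1)) (by linarith)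
        (abs_lt.2 ⟨by linarith, by linarith⟩)
    exact hu0 (neg_eq_zero.1 hzero)

lemma chipsLT_succ_le_degLT {x : ℕ → Option ℝ} {a b : ℤ} {F : Divisor 𝒞}
    (hx : ValidChips g ℓ m x) (h : LinEquiv 𝒞 (stdDiv 𝒞 a x b) F) (hF : 0 ≤ F)
    {k : ℕ} (hk : k < g) (hdeg : chipsLT a x k ≤ degLT (4 * k + 3) F) :
    chipsLT a x (k + 1) ≤ degLT (4 * k + 4) F := by
  have hsucc : degLT (4 * k + 4) F = degLT (4 * k + 3) F + degAt (4 * k + 3) F :=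
    degLT_succ _ _
  have hnonneg := degAt_nonneg hF (4 * k + 3)
  rw [chipsLT_succ]
  split_ifs with hxk
  · by_contra! hlt
    have := degAt_loop_pos hx h hF hk hxk (.inl (by omega))
    omega
  · omega

lemma chipsLT_le_degLT {x : ℕ → Option ℝ} {a b : ℤ} {F : Divisor 𝒞}
    (hx : ValidChips g ℓ m x) (h : LinEquiv 𝒞 (stdDiv 𝒞 a x b) F) (hF : 0 ≤ F)
    (ha : a ≤ F (leftEnd 𝒞)) {k : ℕ} (hk : k ≤ g) : chipsLT a x k ≤ degLT (4 * k + 1) F := by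
  induction k with
  | zero =>
    have hw := degLT_w (hℓ := hℓ) (hm := hm) (hn := hn) 0 F
    rw [Fin.val_zero, mul_zero, degLT_zero, zero_add, zero_add] at hw
    rwa [chipsLT_zero, mul_zero, hw]
  | succ k ih =>
    exact (chipsLT_succ_le_degLT hx h hF hk
      ((ih (by omega)).trans (degLT_mono hF (by omega)))).trans (degLT_mono hF (by omega))

lemma degLT_le_chipsLT_of_succ {x : ℕ → Option ℝ} {a b : ℤ} {F : Divisor 𝒞}
    (hx : ValidChips g ℓ m x) (h : LinEquiv 𝒞 (stdDiv 𝒞 a x b) F)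
    (hF : 0 ≤ F) {k : ℕ} (hk : k < g) (hdeg : degLT (4 * k + 4) F ≤ chipsLT a x (k + 1)) :
    degLT (4 * k + 3) F ≤ chipsLT a x k := by
  by_contra! hlt
  have hsucc : degLT (4 * k + 4) F = degLT (4 * k + 3) F + degAt (4 * k + 3) F :=
    degLT_succ _ _
  have hnonneg := degAt_nonneg hF (4 * k + 3)
  rw [chipsLT_succ] at hdeg
  split_ifs at hdeg with hxk
  · have := degAt_loop_pos hx h hF hk hxk (.inr (by omega))
    omega
  · omega

lemma degLT_le_chipsLT {x : ℕ → Option ℝ} {a b : ℤ} {F : Divisor 𝒞}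
    (hx : ValidChips g ℓ m x) (h : LinEquiv 𝒞 (stdDiv 𝒞 a x b) F) (hF : 0 ≤ F)
    (hb : b ≤ F (rightEnd 𝒞)) {k : ℕ} (hk : k ≤ g) : degLT (4 * k + 2) F ≤ chipsLT a x k := by
  induction hk using Nat.decreasingInduction with
  | self =>
    have hdeg := (chain_linEquiv_iff.1 h).1
    have hlast := degAt_v (Γ := 𝒞) (Fin.last g) F
    have hsucc := degLT_succ (4 * g + 2) F
    rw [Fin.val_last] at hlast
    rw [degLT_last, hdeg, deg_stdDiv, hlast] at hsucc
    rw [rightEnd] at hb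
    omega
  | of_succ k hk ih =>
    exact (degLT_mono hF (by omega)).trans (degLT_le_chipsLT_of_succ hx h hF hk
      ((degLT_mono hF (by omega)).trans ih))

lemma degLT_eq_of_linEquiv {x : ℕ → Option ℝ} {a b : ℤ} {F : Divisor 𝒞}
    (hx : ValidChips g ℓ m x) (h : LinEquiv 𝒞 (stdDiv 𝒞 a x b) F)
    (hF : 0 ≤ F) (ha : a ≤ F (leftEnd 𝒞)) (hb : b ≤ F (rightEnd 𝒞)) {j : ℕ} (hj : j ≤ 4 * g + 3) :
    degLT j F = degLT j (stdDiv 𝒞 a x b) := by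
  have hlower (k : ℕ) (hk : k ≤ g) := chipsLT_le_degLT hx h hF ha hk
  have hupper (k : ℕ) (hk : k ≤ g) := degLT_le_chipsLT hx h hF hb hk
  rcases Nat.eq_zero_or_pos j with rfl | hj0
  · rw [degLT_zero, degLT_zero]
  rcases hj.eq_or_lt with rfl | hlt
  · rw [degLT_last, degLT_last, (chain_linEquiv_iff.1 h).1]
  have hkj : 4 * (j / 4) ≤ j := by omega
  have hjk : j ≤ 4 * (j / 4) + 3 := by omega
  rw [degLT_stdDiv hx hkj hjk hj0 (by omega)]
  generalize j / 4 = k at hkj hjk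
  have hk : k ≤ g := by omega
  refine le_antisymm ?_ ?_
  · rcases hk.eq_or_lt with rfl | hkg
    · exact (degLT_mono hF (by omega)).trans (hupper k hk)
    · exact (degLT_mono hF hjk).trans (degLT_le_chipsLT_of_succ hx h hF hkg
        ((degLT_mono hF (by omega)).trans (hupper (k + 1) hkg)))
  · rcases hkj.eq_or_lt with rfl | hlt
    · obtain ⟨k, rfl⟩ : ∃ i, k = i + 1 := ⟨k - 1, by omega⟩
      exact chipsLT_succ_le_degLT hx h hF (by omega)
        ((hlower k (by omega)).trans (degLT_mono hF (by omega)))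
    · exact (hlower k hk).trans (degLT_mono hF hlt)

lemma degAt_eq_of_linEquiv {x : ℕ → Option ℝ} {a b : ℤ} {F : Divisor 𝒞}
    (hx : ValidChips g ℓ m x) (h : LinEquiv 𝒞 (stdDiv 𝒞 a x b) F) (hF : 0 ≤ F)
    (ha : a ≤ F (leftEnd 𝒞)) (hb : b ≤ F (rightEnd 𝒞)) {j : ℕ} (hj : j ≤ 4 * g + 2) :
    degAt j F = degAt j (stdDiv 𝒞 a x b) := by
  have hdeg := degLT_eq_of_linEquiv hx h hF ha hb (j := j + 1) (by omega)
  rw [degLT_succ, degLT_succ, degLT_eq_of_linEquiv hx h hF ha hb (by omega)] at hdeg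
  exact add_left_cancel hdeg

lemma exists_eq_stdDiv_of_linEquiv {x : ℕ → Option ℝ} {a b : ℤ} {F : Divisor 𝒞}
    (hx : ValidChips g ℓ m x) (h : LinEquiv 𝒞 (stdDiv 𝒞 a x b) F) (hF : 0 ≤ F)
    (ha : a ≤ F (leftEnd 𝒞)) (hb : b ≤ F (rightEnd 𝒞)) :
    ∃ x', ValidChips g ℓ m x' ∧ F = stdDiv 𝒞 a x' b := by
  have hdegAt {j : ℕ} (hj : j ≤ 4 * g + 2) := degAt_eq_of_linEquiv hx h hF ha hb hj
  have hw (k : Fin (g + 1)) : F (.vertex (.w k)) = stdDiv 𝒞 a x b (.vertex (.w k)) := by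
    rw [← degAt_w, ← degAt_w, hdegAt (by omega)]
  have hv (k : Fin (g + 1)) : F (.vertex (.v k)) = stdDiv 𝒞 a x b (.vertex (.v k)) := by
    rw [← degAt_v, ← degAt_v, hdegAt (by omega)]
  have hleft : F (leftEnd 𝒞) = a := (hw 0).trans (stdDiv_leftEnd hx)
  have hright : F (rightEnd 𝒞) = b := (hv (Fin.last g)).trans (stdDiv_rightEnd hx)
  rw [← hleft, ← hright]
  refine exists_eq_stdDiv hF (fun k => (hv _).trans (stdDiv_v hx k))
    (fun k => (hw _).trans (stdDiv_w hx k)) (fun k => ?_) (fun k => ?_)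
  · have hsucc := degLT_succ (4 * k + 1) (stdDiv 𝒞 a x b)
    rw [degLT_stdDiv (k := k) hx (by omega) (by omega) (by omega) (by omega),
      degLT_stdDiv (k := k) hx (by omega) (by omega) (by omega) (by omega)] at hsucc
    rw [hdegAt (by omega)]
    exact left_eq_add.1 hsucc
  · rw [hdegAt (by omega), degAt_loop_stdDiv hx k.2]
    split_ifs <;> norm_num

theorem stdDiv_unique {x : ℕ → Option ℝ} {a b : ℤ} {F : Divisor 𝒞}
    (hx : ValidChips g ℓ m x) (h : LinEquiv 𝒞 (stdDiv 𝒞 a x b) F) (hF : 0 ≤ F)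
    (ha : a ≤ F (leftEnd 𝒞)) (hb : b ≤ F (rightEnd 𝒞)) : F = stdDiv 𝒞 a x b := by
  obtain ⟨x', hx', hFx'⟩ := exists_eq_stdDiv_of_linEquiv hx h hF ha hb
  rw [hFx']
  refine stdDiv_congr fun k hk => ?_
  have hsome := degAt_eq_of_linEquiv hx h hF ha hb (j := 4 * k + 3) (by omega)
  rw [hFx', degAt_loop_stdDiv hx' hk, degAt_loop_stdDiv hx hk] at hsome
  obtain ⟨z, hz⟩ := exists_loopCoord_eq hx h ⟨k, hk⟩
  rw [degLT_eq_of_linEquiv hx h hF ha hb (by simp only; omega),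
    degLT_stdDiv (k := k + 1) hx (by simp only; omega) (by simp only; omega) (by omega)
      (by simp only; omega),
    hFx', pair_loopCoord_stdDiv hx' ⟨k, hk⟩] at hz
  rcases hxk : x k with _ | u <;> rcases hxk' : x' k with _ | u'
  · rfl
  · simp [hxk, hxk'] at hsome
  · simp [hxk, hxk'] at hsome
  · obtain ⟨hℓu, hum, -⟩ := hx k hk u hxk
    obtain ⟨hℓu', hum', -⟩ := hx' k hk u' hxk'
    simp only [hxk, hxk', Option.getD_some, sub_self, Int.cast_zero, mul_zero, add_zero] at hz
    rw [sub_eq_zero.1 (eq_zero_of_eq_mul_of_abs_lt (sub_eq_of_eq_add' hz)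
      (abs_lt.2 ⟨by linarith, by linarith⟩))]

end Uniqueness

section DeterminedByEnds

variable {g : ℕ} {ℓ m n : ℕ → ℝ} {hℓ : ∀ k, 0 < ℓ k} {hm : ∀ k, 0 < m k} {hn : ∀ k, 0 < n k}

local notation "𝒞" => chainOfLoops g ℓ m n hℓ hm hn

/-- Among the effective divisors of its class, `F` is the only one with at least as many chips at
both ends. -/
def DeterminedByEnds (F : Divisor 𝒞) : Prop :=
  ∀ G : Divisor 𝒞, LinEquiv 𝒞 F G → 0 ≤ G →
    F (leftEnd 𝒞) ≤ G (leftEnd 𝒞) → F (rightEnd 𝒞) ≤ G (rightEnd 𝒞) → G = F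

lemma DeterminedByEnds.eq_of_linEquiv {F Z E : Divisor 𝒞} (h : DeterminedByEnds F)
    (hZE : LinEquiv 𝒞 Z E) (hZF : 0 ≤ F - Z) (hE : 0 ≤ E) (hleft : Z (leftEnd 𝒞) = 0)
    (hright : Z (rightEnd 𝒞) = 0) : E = Z := by
  have hG := h (F - Z + E) (hZE.congr_sub (by abel)) (add_nonneg hZF hE)
    (by simpa [hleft] using hE (leftEnd 𝒞)) (by simpa [hright] using hE (rightEnd 𝒞))
  rw [sub_add_eq_add_sub, sub_eq_iff_eq_add] at hG
  exact add_left_cancel hG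

lemma single_apply_of_place_ne {p q : Point 𝒞} (h : place p ≠ place q) (c : ℤ) :
    Finsupp.single p c q = 0 :=
  Finsupp.single_eq_of_ne fun e => h (congrArg place e.symm)

lemma place_leftEnd : place (leftEnd 𝒞) = 0 := rfl

lemma place_rightEnd : place (rightEnd 𝒞) = 4 * g + 2 := rfl

lemma linEquiv_single_bridge {k : Fin (g + 1)} {p : Point 𝒞} (hp : place p = 4 * k + 1) :
    LinEquiv 𝒞 (Finsupp.single p 1) (Finsupp.single (.vertex (.w k)) 1) := by
  refine chain_linEquiv_iff.2 ⟨by simp [deg_eq_pair], fun j => ⟨0, ?_⟩⟩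
  have hw : place (Γ := 𝒞) (.vertex (.w k)) = 4 * k := rfl
  have hlt : (4 * (k : ℕ) < 4 * j + 4) ↔ (4 * (k : ℕ) + 1 < 4 * j + 4) := by omega
  rw [moment_single_of_place_ne (by omega), moment_single_of_place_ne (by omega), hp, hw,
    if_congr hlt rfl rfl]
  simp

lemma DeterminedByEnds.degAt_bridge {F : Divisor 𝒞} (h : DeterminedByEnds F) (hF : 0 ≤ F)
    (k : Fin (g + 1)) : degAt (4 * k + 1) F = 0 := by
  by_contra h0
  obtain ⟨p, hp, hFp⟩ := exists_pos_of_degAt_pos (lt_of_le_of_ne (degAt_nonneg hF _) (Ne.symm h0))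
  have heq := h.eq_of_linEquiv (linEquiv_single_bridge hp) (sub_single_nonneg hF hFp)
    (single_nonneg _) (single_apply_of_place_ne (by rw [hp, place_leftEnd]; omega) 1)
    (single_apply_of_place_ne (by rw [hp, place_rightEnd]; omega) 1)
  have hpw : Point.vertex (.w k) = p := Finsupp.single_left_injective one_ne_zero heq
  rw [← hpw] at hp
  simp [place] at hp

lemma exists_linEquiv_v_add_loopPt (k : Fin g) {u₁ u₂ : ℝ}
    (h₁ : -ℓ (k + 1) < u₁ ∧ u₁ < m (k + 1)) (h₂ : -ℓ (k + 1) < u₂ ∧ u₂ < m (k + 1)) :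
    ∃ u₃, LinEquiv 𝒞 (Finsupp.single (loopPt 𝒞 k u₁) 1 + Finsupp.single (loopPt 𝒞 k u₂) 1)
      (Finsupp.single (.vertex (.v k.castSucc)) 1 + Finsupp.single (loopPt 𝒞 k u₃) 1) := by
  have hL : 0 < ℓ (k + 1) + m (k + 1) := add_pos (hℓ _) (hm _)
  have hmem := toIocMod_mem_Ioc hL (-ℓ (k + 1)) (u₁ + u₂)
  have hz := self_sub_toIocMod hL (-ℓ (k + 1)) (u₁ + u₂)
  rw [zsmul_eq_mul] at hz
  have hu₃ : toIocMod hL (-ℓ (k + 1)) (u₁ + u₂) ≤ m (k + 1) := by linarith [hmem.2]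
  have hℓ0 : -ℓ (k + 1) < 0 := neg_lt_zero.2 (hℓ _)
  refine ⟨toIocMod hL (-ℓ (k + 1)) (u₁ + u₂), chain_linEquiv_iff.2 ⟨by simp [deg_eq_pair], ?_⟩⟩
  intro j
  rw [← loopPt_zero, map_add, map_add]
  by_cases hkj : k = j
  · subst hkj
    refine ⟨-toIocDiv hL (-ℓ (k + 1)) (u₁ + u₂), ?_⟩
    rw [moment_loopPt_self k h₁.1 h₁.2.le, moment_loopPt_self k h₂.1 h₂.2.le,
      moment_loopPt_self k hmem.1 hu₃, moment_loopPt_self k hℓ0 (hm _).le]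
    simp only [loopLen, chainOfLoops]
    push_cast
    linear_combination -hz
  · refine ⟨0, ?_⟩
    rw [moment_loopPt_of_ne hkj h₁.1 h₁.2.le, moment_loopPt_of_ne hkj h₂.1 h₂.2.le,
      moment_loopPt_of_ne hkj hmem.1 hu₃, moment_loopPt_of_ne hkj hℓ0 (hm _).le]
    simp

lemma DeterminedByEnds.degAt_loop_le_one {F : Divisor 𝒞} (h : DeterminedByEnds F) (hF : 0 ≤ F)
    (k : Fin g) : degAt (4 * k + 3) F ≤ 1 := by
  by_contra! h1
  obtain ⟨p, hp, hFp⟩ := exists_pos_of_degAt_pos (by omega : 0 < degAt (4 * k + 3) F)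
  have hF₁ := sub_single_nonneg hF hFp
  have hdeg : 0 < degAt (4 * k + 3) (F - Finsupp.single p 1) := by
    rw [map_sub, ← hp, degAt_single, hp]
    omega
  obtain ⟨q, hq, hFq⟩ := exists_pos_of_degAt_pos hdeg
  have hF₂ := sub_single_nonneg hF₁ hFq
  rw [sub_sub] at hF₂
  have hvertex (w : ChainVertex g) (hw : place (Γ := 𝒞) (.vertex w) ≠ 4 * k + 3) :
      (Finsupp.single p 1 + Finsupp.single q 1 : Divisor 𝒞) (.vertex w) = 0 := by
    rw [Finsupp.add_apply, single_apply_of_place_ne (hp.trans_ne hw.symm),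
      single_apply_of_place_ne (hq.trans_ne hw.symm), add_zero]
  obtain ⟨u₁, hu₁, rfl⟩ := exists_eq_loopPt hp
  obtain ⟨u₂, hu₂, rfl⟩ := exists_eq_loopPt hq
  obtain ⟨u₃, hequiv⟩ := exists_linEquiv_v_add_loopPt (hℓ := hℓ) (hm := hm) (hn := hn) k
    ⟨hu₁.1, hu₁.2.1⟩ ⟨hu₂.1, hu₂.2.1⟩
  have heq := h.eq_of_linEquiv hequiv hF₂ (add_nonneg (single_nonneg _) (single_nonneg _))
    (hvertex _ (by simp [place])) (hvertex _ (by simp only [place, Fin.val_last]; omega))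
  have hv := hvertex (.v k.castSucc) (by simp only [place, Fin.val_castSucc]; omega)
  rw [← heq, Finsupp.add_apply, Finsupp.single_eq_same] at hv
  have hnonneg := single_nonneg (loopPt 𝒞 k u₃) (.vertex (.v k.castSucc))
  rw [Finsupp.zero_apply] at hnonneg
  omega

theorem DeterminedByEnds.exists_eq_stdDiv {F : Divisor 𝒞} (h : DeterminedByEnds F) (hF : 0 ≤ F)
    (hv : ∀ k : Fin g, F (.vertex (.v k.castSucc)) = 0)
    (hw : ∀ k : Fin g, F (.vertex (.w k.succ)) = 0) :
    ∃ x, ValidChips g ℓ m x ∧ F = stdDiv 𝒞 (F (leftEnd 𝒞)) x (F (rightEnd 𝒞)) :=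
  _root_.exists_eq_stdDiv hF hv hw (h.degAt_bridge hF) (h.degAt_loop_le_one hF)

end DeterminedByEnds

section Rank

variable {g : ℕ} {ℓ m n : ℕ → ℝ} {hℓ : ∀ k, 0 < ℓ k} {hm : ∀ k, 0 < m k} {hn : ∀ k, 0 < n k}

local notation "𝒞" => chainOfLoops g ℓ m n hℓ hm hn

lemma moment_single_v (j k : Fin g) (c : ℤ) :
    moment j (Finsupp.single (.vertex (.v k.castSucc)) c : Divisor 𝒞) =
      if k ≤ j then -m (j + 1) * c else 0 := by
  rw [moment_single_of_place_ne (by simp only [place, Fin.val_castSucc]; omega)]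
  refine if_congr ?_ rfl rfl
  simp only [place, Fin.val_castSucc, Fin.le_def]
  omega

lemma moment_single_w (j k : Fin g) (c : ℤ) :
    moment j (Finsupp.single (.vertex (.w k.succ)) c : Divisor 𝒞) =
      if k < j then -m (j + 1) * c else 0 := by
  rw [moment_single_of_place_ne (by simp only [place, Fin.val_succ]; omega)]
  refine if_congr ?_ rfl rfl
  simp only [place, Fin.val_succ, Fin.lt_def]
  omega

lemma exists_divisor_on_loop (k : Fin g) {N : ℤ} (hN : 0 ≤ N) {ξ : ℝ}
    (hξ : N = 0 → ∃ z : ℤ, ξ = z * (ℓ (k + 1) + m (k + 1))) :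
    ∃ B : Divisor 𝒞, 0 ≤ B ∧ deg B = N ∧
      (∀ j, k < j → moment j B = -m (j + 1) * N) ∧ (∀ j, j < k → moment j B = 0) ∧
      ∃ z : ℤ, moment k B = ξ - m (k + 1) * N + z * (ℓ (k + 1) + m (k + 1)) := by
  rcases hN.eq_or_lt with rfl | hpos
  · obtain ⟨z, hz⟩ := hξ rfl
    exact ⟨0, le_rfl, by simp [deg_eq_pair], fun j _ => by simp, fun j _ => map_zero _, -z,
      by rw [map_zero, hz]; push_cast; ring⟩
  have hL : 0 < ℓ (k + 1) + m (k + 1) := add_pos (hℓ _) (hm _)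
  obtain ⟨hu, hu'⟩ := toIocMod_mem_Ioc hL (-ℓ (k + 1)) ξ
  have hz := self_sub_toIocMod hL (-ℓ (k + 1)) ξ
  rw [zsmul_eq_mul] at hz
  set u := toIocMod hL (-ℓ (k + 1)) ξ
  have hum : u ≤ m (k + 1) := by linarith
  refine ⟨Finsupp.single (.vertex (.v k.castSucc)) (N - 1) + Finsupp.single (loopPt 𝒞 k u) 1,
    add_nonneg (Finsupp.single_nonneg.2 (by omega)) (single_nonneg _), by simp [deg_eq_pair],
    fun j hj => ?_, fun j hj => ?_, -toIocDiv hL (-ℓ (k + 1)) ξ, ?_⟩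
  · rw [map_add, moment_single_v, if_pos hj.le, moment_loopPt_of_ne hj.ne hu hum, if_pos hj]
    push_cast
    ring
  · rw [map_add, moment_single_v, if_neg hj.not_ge, moment_loopPt_of_ne hj.ne' hu hum,
      if_neg hj.not_gt, add_zero]
  · rw [map_add, moment_single_v, if_pos le_rfl, moment_loopPt_self k hu hum]
    push_cast
    linear_combination -hz

lemma sum_ite_lt_sub (S : ℕ → ℝ) (j : Fin g) :
    ∑ k : Fin g, (if k < j then S (k + 1) - S k else 0) = S j - S 0 := by
  simp only [Fin.lt_def]
  rw [Fin.sum_univ_eq_sum_range (fun k => if k < (j : ℕ) then S (k + 1) - S k else 0),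
    ← Finset.sum_filter, ← Finset.sum_range_sub]
  congr 1
  ext i
  simp only [Finset.mem_range, Finset.mem_filter]
  omega

lemma exists_effective_of_moments {S S' : ℕ → ℤ} (hS0 : S 0 = 0) (hS : ∀ k < g, S k ≤ S' k)
    (hS' : ∀ k < g, S' k ≤ S (k + 1)) {ξ : Fin g → ℝ}
    (hξ : ∀ k : Fin g, S' k = S k → ∃ z : ℤ, ξ k = z * (ℓ (k + 1) + m (k + 1))) :
    ∃ B : Divisor 𝒞, 0 ≤ B ∧ deg B = S g ∧
      ∀ j : Fin g, ∃ z : ℤ, moment j B = ξ j - m (j + 1) * S' j + z * (ℓ (j + 1) + m (j + 1)) := by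
  choose B hB hdeg hright hleft z hself using fun k : Fin g => exists_divisor_on_loop (hℓ := hℓ)
    (hm := hm) (hn := hn) k (sub_nonneg.2 (hS k k.2)) fun h => hξ k (sub_eq_zero.1 h)
  let W (k : Fin g) : Divisor 𝒞 := Finsupp.single (.vertex (.w k.succ)) (S (k + 1) - S' k)
  refine ⟨∑ k, (B k + W k), Finset.sum_nonneg fun k _ => add_nonneg (hB k)
    (Finsupp.single_nonneg.2 (sub_nonneg.2 (hS' k k.2))), ?_, fun j => ⟨z j, ?_⟩⟩
  · have hsum (k : Fin g) : pair (fun _ => (1 : ℤ)) (B k + W k) = S (k + 1) - S k := by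
      rw [map_add, ← deg_eq_pair, hdeg, pair_single, Int.cast_id]
      ring
    rw [deg_eq_pair, map_sum, Finset.sum_congr rfl fun k _ => hsum k,
      Fin.sum_univ_eq_sum_range (fun k => S (k + 1) - S k), Finset.sum_range_sub, hS0, sub_zero]
  · have hterm (k : Fin g) : moment j (B k + W k) =
        -m (j + 1) * (if k < j then (S (k + 1) : ℝ) - S k else 0) +
          if k = j then moment j (B j) else 0 := by
      rw [map_add, moment_single_w]
      rcases lt_trichotomy k j with h | rfl | h
      · rw [hright k j h, if_pos h, if_pos h, if_neg h.ne]
        push_cast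
        ring
      · simp
      · simp [hleft k j h, h.not_gt, h.ne']
    rw [map_sum, Finset.sum_congr rfl fun k _ => hterm k, Finset.sum_add_distrib,
      Finset.sum_ite_eq', if_pos (Finset.mem_univ _), ← Finset.mul_sum,
      sum_ite_lt_sub fun k => (S k : ℝ), hS0, hself]
    push_cast
    ring

lemma ne_none_of_chipsLT_eq {a a' b b' : ℤ} {x x' : ℕ → Option ℝ} (hx : ValidChips g ℓ m x)
    (hx' : ValidChips g ℓ m x') (h : LinEquiv 𝒞 (stdDiv 𝒞 a x b) (stdDiv 𝒞 a' x' b')) {k : ℕ}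
    (hk : k < g) (hchips : chipsLT a' x' k = chipsLT a x k + 1) : x' k ≠ none := by
  intro hnone
  obtain ⟨z, hz⟩ := exists_loopCoord_eq hx h ⟨k, hk⟩
  rw [pair_loopCoord_stdDiv hx' ⟨k, hk⟩, degLT_stdDiv (k := k + 1) hx' (by simp only; omega)
    (by simp only; omega) (by omega) (by simp only; omega)] at hz
  have hℓk := hℓ (k + 1)
  have hmk := hm (k + 1)
  rcases hxk : x k with _ | u
  · simp only [hnone, hxk, chipsLT_succ, hchips, Option.getD_none, Option.isSome_none,
      Bool.false_eq_true, if_false] at hz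
    push_cast at hz
    have := eq_zero_of_eq_mul_of_abs_lt (c := -m (k + 1)) (z := z) (L := ℓ (k + 1) + m (k + 1))
      (by linarith) (abs_lt.2 ⟨by linarith, by linarith⟩)
    linarith
  · obtain ⟨hℓu, hum, hu0⟩ := hx k hk u hxk
    simp only [hnone, hxk, chipsLT_succ, hchips, Option.getD_none, Option.getD_some,
      Option.isSome_none, Option.isSome_some, Bool.false_eq_true, if_false, if_true] at hz
    push_cast at hz
    have := eq_zero_of_eq_mul_of_abs_lt (c := -u) (z := z) (L := ℓ (k + 1) + m (k + 1))
      (by linarith) (abs_lt.2 ⟨by linarith, by linarith⟩)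
    exact hu0 (neg_eq_zero.1 this)

lemma chipsLT_lt_chipsLT {a a' b b' : ℤ} {x x' : ℕ → Option ℝ} (hx : ValidChips g ℓ m x)
    (hx' : ValidChips g ℓ m x') (h : LinEquiv 𝒞 (stdDiv 𝒞 a x b) (stdDiv 𝒞 a' x' b'))
    (ha : a < a') {k : ℕ} (hk : k ≤ g) : chipsLT a x k < chipsLT a' x' k := by
  induction k with
  | zero => rwa [chipsLT_zero, chipsLT_zero]
  | succ k ih =>
    have hlt := ih (by omega)
    have hne (hnone : x' k = none) : chipsLT a' x' k ≠ chipsLT a x k + 1 := fun heq =>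
      ne_none_of_chipsLT_eq hx hx' h hk heq hnone
    rw [chipsLT_succ, chipsLT_succ]
    rcases hxk : x' k with _ | u
    · have := hne hxk
      simp only [Option.isSome_none, Bool.false_eq_true, if_false]
      split_ifs <;> omega
    · rw [Option.isSome_some, if_pos rfl]
      split_ifs <;> omega

lemma chipsLT_sub_le {r : ℕ} {x : ℕ → ℕ → Option ℝ} {D : Divisor 𝒞}
    (hx : ∀ i ≤ r, ValidChips g ℓ m (x i))
    (hD : ∀ i ≤ r, LinEquiv 𝒞 D (stdDiv 𝒞 i (x i) (r - i))) {i j : ℕ} (hij : i ≤ j) (hj : j ≤ r)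
    {k : ℕ} (hk : k ≤ g) : chipsLT i (x i) k - i ≤ chipsLT j (x j) k - j := by
  induction j, hij using Nat.le_induction with
  | base => rfl
  | succ j _ ih =>
    have hle := ih (by omega)
    have hlt := chipsLT_lt_chipsLT (hx j (by omega)) (hx (j + 1) hj)
      ((hD j (by omega)).symm.trans (hD (j + 1) hj)) (by omega) hk
    push_cast at hlt ⊢
    omega

lemma eq_and_eq_none_of_chipsLT_succ_sub_eq {r : ℕ} {x : ℕ → ℕ → Option ℝ} {D : Divisor 𝒞}
    (hx : ∀ i ≤ r, ValidChips g ℓ m (x i))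
    (hD : ∀ i ≤ r, LinEquiv 𝒞 D (stdDiv 𝒞 i (x i) (r - i))) {i j : ℕ} (hij : i ≤ j) (hj : j ≤ r)
    {k : ℕ} (hk : k < g) (heq : chipsLT j (x j) (k + 1) - j = chipsLT i (x i) k - i) :
    i = j ∧ x j k = none := by
  have hle := chipsLT_sub_le hx hD hij hj hk.le
  have hnone : x j k = none := by
    by_contra hne
    rw [chipsLT_succ, if_pos (Option.isSome_iff_ne_none.2 hne)] at heq
    omega
  refine ⟨hij.eq_or_lt.resolve_right fun hlt => ?_, hnone⟩
  obtain ⟨j, rfl⟩ : ∃ j', j = j' + 1 := ⟨j - 1, by omega⟩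
  have hlt' := chipsLT_lt_chipsLT (hx j (by omega)) (hx (j + 1) hj)
    ((hD j (by omega)).symm.trans (hD (j + 1) hj)) (by omega) hk.le
  have hne := ne_none_of_chipsLT_eq (hx j (by omega)) (hx (j + 1) hj)
    ((hD j (by omega)).symm.trans (hD (j + 1) hj)) hk |>.mt (not_not.2 hnone)
  have hle' := chipsLT_sub_le hx hD (Nat.lt_succ_iff.1 hlt) (by omega) hk.le
  rw [chipsLT_succ, hnone, Option.isSome_none, if_neg Bool.false_ne_true] at heq
  push_cast at heq hlt' hne
  omega

lemma exists_moment_add_eq_of_eq_none {a b : ℤ} {x : ℕ → Option ℝ} {D : Divisor 𝒞}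
    (hx : ValidChips g ℓ m x) (hD : LinEquiv 𝒞 D (stdDiv 𝒞 a x b)) (k : Fin g)
    (hk : x k = none) : ∃ z : ℤ, moment k D + m (k + 1) * chipsLT a x (k + 1) =
      z * (ℓ (k + 1) + m (k + 1)) := by
  obtain ⟨z, hz⟩ := (chain_linEquiv_iff.1 hD).2 k
  have hloop : loopLen 𝒞 k = ℓ (k + 1) + m (k + 1) := rfl
  rw [moment_stdDiv hx, hk, Option.getD_none, hloop] at hz
  refine ⟨-z, ?_⟩
  push_cast
  linear_combination -hz

lemma exists_effective_of_monotone {r : ℕ} {x : ℕ → ℕ → Option ℝ} {D : Divisor 𝒞}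
    (hx : ∀ i ≤ r, ValidChips g ℓ m (x i))
    (hD : ∀ i ≤ r, LinEquiv 𝒞 D (stdDiv 𝒞 i (x i) (r - i))) {e : ℕ → ℕ} (he : Monotone e)
    (hlast : e (4 * g + 3) = r) {η : Fin g → ℝ}
    (hη : ∀ k : Fin g, e (4 * k + 3) = e (4 * k + 4) → η k = 0) :
    ∃ B : Divisor 𝒞, 0 ≤ B ∧ deg B = deg D - r ∧
      ∀ j : Fin g, ∃ z : ℤ, moment j B =
        moment j D - η j + m (j + 1) * e (4 * j + 4) + z * (ℓ (j + 1) + m (j + 1)) := by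
  have her {j : ℕ} (h : j ≤ 4 * g + 3) : e j ≤ r := hlast ▸ he h
  let c (i k : ℕ) : ℤ := chipsLT i (x i) k
  let S (k : ℕ) : ℤ := c (e (4 * k + 3)) k - e (4 * k + 3)
  let S' (k : ℕ) : ℤ := c (e (4 * k + 4)) (k + 1) - e (4 * k + 4)
  have hS (k : ℕ) (hk : k < g) : S k ≤ S' k := by
    refine (chipsLT_sub_le hx hD (he (show 4 * k + 3 ≤ 4 * k + 4 by omega))
      (her (by omega)) hk.le).trans (sub_le_sub_right ?_ _)
    simp only [c, chipsLT_succ]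
    split_ifs <;> omega
  have hS' (k : ℕ) (hk : k < g) : S' k ≤ S (k + 1) :=
    chipsLT_sub_le hx hD (he (by omega)) (her (by omega)) hk
  have hSg : S g = deg D - r := by
    have hdeg := (chain_linEquiv_iff.1 (hD r le_rfl)).1
    rw [deg_stdDiv] at hdeg
    simp only [S, c, hlast]
    linarith
  have hξ (k : Fin g) (h : S' k = S k) : ∃ z : ℤ, moment k D - η k +
      m (k + 1) * c (e (4 * k + 4)) (k + 1) = z * (ℓ (k + 1) + m (k + 1)) := by
    have hek : e (4 * (k : ℕ) + 4) ≤ r := her (by omega)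
    obtain ⟨heq, hnone⟩ := eq_and_eq_none_of_chipsLT_succ_sub_eq hx hD
      (he (show 4 * (k : ℕ) + 3 ≤ 4 * k + 4 by omega)) hek k.2 h
    rw [hη k heq, sub_zero]
    exact exists_moment_add_eq_of_eq_none (hx _ hek) (hD _ hek) k hnone
  obtain ⟨B, hB, hBdeg, hBmoment⟩ := exists_effective_of_moments (hℓ := hℓ) (hm := hm) (hn := hn)
    (S := S) (S' := S') (by simp [S, c, chipsLT_zero]) hS hS' hξ
  refine ⟨B, hB, hBdeg.trans hSg, fun j => ?_⟩
  obtain ⟨z, hz⟩ := hBmoment j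
  refine ⟨z, hz.trans ?_⟩
  simp only [S']
  push_cast
  ring

theorem rankGE_of_stdDiv {r : ℕ} {x : ℕ → ℕ → Option ℝ} {D : Divisor 𝒞}
    (hx : ∀ i ≤ r, ValidChips g ℓ m (x i))
    (hD : ∀ i ≤ r, LinEquiv 𝒞 D (stdDiv 𝒞 i (x i) (r - i))) : RankGE 𝒞 D r := by
  intro E hE hEdeg
  let e (j : ℕ) : ℕ := (degLT j E).toNat
  have he (j : ℕ) : (e j : ℤ) = degLT j E :=
    Int.toNat_of_nonneg ((degLT_zero E).ge.trans (degLT_mono hE j.zero_le))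
  have hlast : e (4 * g + 3) = r := by
    rw [← Nat.cast_inj (R := ℤ), he, degLT_last, hEdeg]
  have hη (k : Fin g) (heq : e (4 * k + 3) = e (4 * k + 4)) : pair (loopCoord k) E = 0 := by
    have hsucc := degLT_succ (4 * (k : ℕ) + 3) E
    rw [← he, ← he, heq] at hsucc
    exact pair_loopCoord_eq_zero hE (left_eq_add.1 hsucc)
  obtain ⟨B, hB, hBdeg, hBmoment⟩ := exists_effective_of_monotone (e := e) hx hD
    (fun i j h => Int.toNat_le_toNat (degLT_mono hE h)) hlast hη
  refine ⟨B, hB, chain_linEquiv_iff.2 ⟨?_, fun j => ?_⟩⟩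
  · rw [hBdeg, deg_eq_pair (D - E), map_sub, ← deg_eq_pair, ← deg_eq_pair, hEdeg]
  · obtain ⟨z, hz⟩ := hBmoment j
    have hlen : len 𝒞 (.bottom j) = m (j + 1) := rfl
    refine ⟨z, ?_⟩
    rw [hz, map_sub, moment_eq j E, hlen, ← he]
    simp only [loopLen, chainOfLoops]
    push_cast
    ring

end Rank

section Chips

lemma chipsLT_add (a b : ℤ) (x : ℕ → Option ℝ) (k : ℕ) :
    chipsLT (a + b) x k = a + chipsLT b x k := by
  rw [chipsLT, chipsLT, add_assoc]

lemma chipsLT_congr {a : ℤ} {x x' : ℕ → Option ℝ} {k : ℕ}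
    (h : ∀ j < k, (x j).isSome = (x' j).isSome) : chipsLT a x k = chipsLT a x' k := by
  rw [chipsLT, chipsLT]
  congr 1
  exact Finset.sum_congr rfl fun j hj => by rw [h j (Finset.mem_range.1 hj)]

lemma chipsLT_none (a : ℤ) (k : ℕ) : chipsLT a (fun _ => none) k = a := by
  simp [chipsLT]

lemma chipsLT_some (a : ℤ) (f : ℕ → ℝ) (k : ℕ) : chipsLT a (fun k => some (f k)) k = a + k := by
  simp [chipsLT]

lemma chipsLT_mono (a : ℤ) (x : ℕ → Option ℝ) : Monotone (chipsLT a x) :=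
  monotone_nat_of_le_succ fun k => by
    rw [chipsLT_succ]
    split_ifs <;> omega

lemma chipsLT_le_add (a : ℤ) (x : ℕ → Option ℝ) {j k : ℕ} (h : j ≤ k) :
    chipsLT a x k ≤ chipsLT a x j + (k - j) := by
  induction k, h using Nat.le_induction with
  | base => simp
  | succ k _ ih =>
    rw [chipsLT_succ]
    push_cast
    split_ifs <;> omega

/-- The moment of `stdDiv Γ a x b` on the loop `k`. -/
def chipMoment (m : ℕ → ℝ) (a : ℤ) (x : ℕ → Option ℝ) (k : ℕ) : ℝ :=
  (x k).getD 0 - m (k + 1) * (chipsLT a x (k + 1) : ℤ)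

lemma stdDiv_linEquiv_iff {g : ℕ} {ℓ m n : ℕ → ℝ} {hℓ : ∀ k, 0 < ℓ k} {hm : ∀ k, 0 < m k}
    {hn : ∀ k, 0 < n k} {a a' b b' : ℤ} {x x' : ℕ → Option ℝ} (hx : ValidChips g ℓ m x)
    (hx' : ValidChips g ℓ m x') :
    LinEquiv (chainOfLoops g ℓ m n hℓ hm hn) (stdDiv _ a x b) (stdDiv _ a' x' b') ↔
      chipsLT a' x' g + b' = chipsLT a x g + b ∧ ∀ k < g, ∃ z : ℤ,
        chipMoment m a' x' k - chipMoment m a x k = z * (ℓ (k + 1) + m (k + 1)) := by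
  rw [chain_linEquiv_iff, deg_stdDiv, deg_stdDiv]
  simp only [moment_stdDiv hx, moment_stdDiv hx']
  exact and_congr_right' ⟨fun h k hk => h ⟨k, hk⟩, fun h k => h k k.2⟩

/-- The chips `h` on the first `s` loops, followed by the chips `x`. -/
def prependChips (s : ℕ) (h x : ℕ → Option ℝ) (k : ℕ) : Option ℝ :=
  if k < s then h k else x (k - s)

lemma prependChips_lt {s k : ℕ} (hk : k < s) (h x : ℕ → Option ℝ) :
    prependChips s h x k = h k := if_pos hk

lemma prependChips_add (s k : ℕ) (h x : ℕ → Option ℝ) : prependChips s h x (k + s) = x k := by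
  rw [prependChips, if_neg (by omega), Nat.add_sub_cancel]

lemma chipsLT_prependChips_le {s k : ℕ} (hk : k ≤ s) (a : ℤ) (h x : ℕ → Option ℝ) :
    chipsLT a (prependChips s h x) k = chipsLT a h k :=
  chipsLT_congr fun j hj => by rw [prependChips_lt (hj.trans_le hk)]

lemma chipsLT_prependChips_add (s k : ℕ) (a : ℤ) (h x : ℕ → Option ℝ) :
    chipsLT a (prependChips s h x) (k + s) = chipsLT (chipsLT a h s) x k := by
  induction k with
  | zero => rw [zero_add, chipsLT_prependChips_le le_rfl, chipsLT_zero]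
  | succ k ih =>
    rw [Nat.add_right_comm, chipsLT_succ, ih, prependChips_add, chipsLT_succ]

lemma ValidChips.prependChips {g s : ℕ} {ℓ m : ℕ → ℝ} {h x : ℕ → Option ℝ}
    (hh : ValidChips s ℓ m h) (hx : ValidChips g (fun k => ℓ (k + s)) (fun k => m (k + s)) x) :
    ValidChips (g + s) ℓ m (prependChips s h x) := by
  intro k hk u hu
  rcases lt_or_ge k s with hks | hks
  · rw [prependChips_lt hks] at hu
    exact hh k hks u hu
  · obtain ⟨j, rfl⟩ := Nat.exists_eq_add_of_le' hks
    rw [prependChips_add] at hu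
    simpa only [Nat.add_right_comm j 1 s] using hx j (by omega) u hu

open Classical in
/-- The chips `x`, those on the loops in `S` being moved by `ε`. -/
def shiftChips (S : ℕ → Prop) (ε : ℝ) (x : ℕ → Option ℝ) (k : ℕ) : Option ℝ :=
  if S k then (x k).map (· + ε) else x k

lemma isSome_shiftChips (S : ℕ → Prop) (ε : ℝ) (x : ℕ → Option ℝ) (k : ℕ) :
    (shiftChips S ε x k).isSome = (x k).isSome := by
  rw [shiftChips]
  split_ifs <;> simp

lemma chipsLT_shiftChips (a : ℤ) (S : ℕ → Prop) (ε : ℝ) (x : ℕ → Option ℝ) (k : ℕ) :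
    chipsLT a (shiftChips S ε x) k = chipsLT a x k :=
  chipsLT_congr fun j _ => isSome_shiftChips S ε x j

open Classical in
lemma chipMoment_shiftChips (m : ℕ → ℝ) (a : ℤ) {S : ℕ → Prop} (ε : ℝ) {x : ℕ → Option ℝ} {k : ℕ}
    (h : S k → (x k).isSome) :
    chipMoment m a (shiftChips S ε x) k = chipMoment m a x k + if S k then ε else 0 := by
  rw [chipMoment, chipMoment, chipsLT_shiftChips, shiftChips]
  split_ifs with hS
  · obtain ⟨u, hu⟩ := Option.isSome_iff_exists.1 (h hS)
    simp only [hu, Option.map_some, Option.getD_some]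
    ring
  · ring

lemma eventually_lt_of_pos {c : ℝ} (hc : 0 < c) : ∀ᶠ ε in 𝓝[>] (0 : ℝ), ε < c :=
  nhdsWithin_le_nhds (Iio_mem_nhds hc)

lemma ValidChips.eventually_shiftChips {g : ℕ} {ℓ m : ℕ → ℝ} {x : ℕ → Option ℝ}
    (hx : ValidChips g ℓ m x) (S : ℕ → Prop) :
    ∀ᶠ ε in 𝓝[>] (0 : ℝ), ValidChips g ℓ m (shiftChips S ε x) := by
  suffices h : ∀ k ∈ Finset.range g, ∀ᶠ ε in 𝓝[>] (0 : ℝ), ∀ u ∈ shiftChips S ε x k,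
      -ℓ (k + 1) < u ∧ u < m (k + 1) ∧ u ≠ 0 by
    filter_upwards [(Filter.eventually_all_finset _).2 h] with ε hε k hk
    exact hε k (Finset.mem_range.2 hk)
  intro k hk
  have hxk := hx k (Finset.mem_range.1 hk)
  by_cases hS : S k
  swap
  · exact .of_forall fun ε => by simpa only [shiftChips, hS, if_false] using hxk
  rcases hu : x k with _ | u
  · exact .of_forall fun ε => by simp [shiftChips, hS, hu]
  obtain ⟨hℓu, hum, hu0⟩ := hxk u hu
  filter_upwards [eventually_lt_of_pos (sub_pos.2 hum), eventually_lt_of_pos (abs_pos.2 hu0),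
    self_mem_nhdsWithin] with ε hεm hεu (hε : 0 < ε)
  simp only [shiftChips, hS, hu, if_true, Option.map_some, Option.mem_def, Option.some.injEq,
    forall_eq']
  refine ⟨by linarith, by linarith, fun h0 => ?_⟩
  rw [eq_neg_of_add_eq_zero_left h0, abs_neg, abs_of_pos hε] at hεu
  exact lt_irrefl _ hεu

/-- The distance from the point `v_{k+1}` to the chip left on the loop `k` by `transferChips`,
measured from left to right along the bottom edge, and modulo the length of the loop. -/
def transferCoord (m : ℕ → ℝ) (a : ℤ) (x : ℕ → Option ℝ) (k : ℕ) : ℝ :=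
  (x k).getD (m (k + 1)) - m (k + 1) * (chipsLT a x k - k : ℤ)

/-- The chips that are left on the loops by `a` chips that go through the chain from the left to
the right, one of them being left on each loop that carries no chip. -/
def transferChips {ℓ m : ℕ → ℝ} (hℓ : ∀ k, 0 < ℓ k) (hm : ∀ k, 0 < m k) (a : ℤ)
    (x : ℕ → Option ℝ) (k : ℕ) : Option ℝ :=
  some (toIocMod (add_pos (hℓ (k + 1)) (hm (k + 1))) (-ℓ (k + 1)) (transferCoord m a x k))

lemma chipsLT_transferChips {ℓ m : ℕ → ℝ} (hℓ : ∀ k, 0 < ℓ k) (hm : ∀ k, 0 < m k) (a c : ℤ)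
    (x : ℕ → Option ℝ) (k : ℕ) : chipsLT c (transferChips hℓ hm a x) k = c + k :=
  chipsLT_some _ _ _

lemma exists_chipMoment_transferChips {ℓ m : ℕ → ℝ} (hℓ : ∀ k, 0 < ℓ k) (hm : ∀ k, 0 < m k)
    (a : ℤ) (x : ℕ → Option ℝ) (k : ℕ) :
    ∃ z : ℤ, chipMoment m 0 (transferChips hℓ hm a x) k - chipMoment m a x k =
      z * (ℓ (k + 1) + m (k + 1)) := by
  have hz := self_sub_toIocMod (add_pos (hℓ (k + 1)) (hm (k + 1))) (-ℓ (k + 1))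
    (transferCoord m a x k)
  rw [zsmul_eq_mul] at hz
  refine ⟨-toIocDiv (add_pos (hℓ (k + 1)) (hm (k + 1))) (-ℓ (k + 1)) (transferCoord m a x k), ?_⟩
  have hcoord : transferCoord m a x k =
      (x k).getD 0 - m (k + 1) * (chipsLT a x (k + 1) - (k + 1 : ℕ) : ℤ) := by
    rw [transferCoord, chipsLT_succ]
    rcases x k with _ | u <;>
      simp only [Option.getD_none, Option.getD_some, Option.isSome_none, Option.isSome_some,
        Bool.false_eq_true, if_false, if_true] <;>
      push_cast <;> ring
  rw [chipMoment, chipMoment, chipsLT_transferChips, transferChips, Option.getD_some]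
  push_cast at hz hcoord ⊢
  linear_combination hcoord - hz

/-- The point at distance `c` from `v_k`, along a loop of length `L` whose bottom edge has length
`μ`, is neither `v_k` nor `w_k`. -/
def AvoidsLoopEnds (L μ c : ℝ) : Prop :=
  ∀ z : ℤ, c ≠ z * L ∧ c - μ ≠ z * L

lemma validChips_transferChips {g : ℕ} {ℓ m : ℕ → ℝ} (hℓ : ∀ k, 0 < ℓ k) (hm : ∀ k, 0 < m k)
    {a : ℤ} {x : ℕ → Option ℝ}
    (h : ∀ k < g, AvoidsLoopEnds (ℓ (k + 1) + m (k + 1)) (m (k + 1)) (transferCoord m a x k)) :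
    ValidChips g ℓ m (transferChips hℓ hm a x) := by
  rintro k hk u ⟨⟩
  have hz := self_sub_toIocMod (add_pos (hℓ (k + 1)) (hm (k + 1))) (-ℓ (k + 1))
    (transferCoord m a x k)
  obtain ⟨hleft, hright⟩ := toIocMod_mem_Ioc (add_pos (hℓ (k + 1)) (hm (k + 1))) (-ℓ (k + 1))
    (transferCoord m a x k)
  obtain ⟨hv, hw⟩ := h k hk
    (toIocDiv (add_pos (hℓ (k + 1)) (hm (k + 1))) (-ℓ (k + 1)) (transferCoord m a x k))
  rw [zsmul_eq_mul] at hz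
  refine ⟨hleft, lt_of_le_of_ne (by linarith) fun hu => hw ?_, fun hu => hv ?_⟩
  · rwa [hu] at hz
  · rwa [hu, sub_zero] at hz

lemma AvoidsLoopEnds.add_mul {L μ c : ℝ} (h : AvoidsLoopEnds L μ c) (z₀ : ℤ) :
    AvoidsLoopEnds L μ (c + z₀ * L) := fun z => by
  refine ⟨fun hz => (h (z - z₀)).1 ?_, fun hz => (h (z - z₀)).2 ?_⟩ <;> push_cast <;>
    linear_combination hz

lemma avoidsLoopEnds_neg_mul {L μ : ℝ} {N c : ℕ} (hμ : 0 < μ) (hL : N * μ < L) (hc : 0 < c)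
    (hcN : c + 1 ≤ N) : AvoidsLoopEnds L μ (-(μ * c)) := by
  have hne {c : ℕ} (hc : 0 < c) (hcN : c ≤ N) (z : ℤ) : -(μ * c) ≠ z * L := fun h => by
    have hpos : 0 < μ * c := mul_pos hμ (Nat.cast_pos.2 hc)
    have hle : μ * c ≤ N * μ := by
      rw [mul_comm]
      exact mul_le_mul_of_nonneg_right (Nat.cast_le.2 hcN) hμ.le
    have := eq_zero_of_eq_mul_of_abs_lt h (by rw [abs_neg, abs_of_pos hpos]; linarith)
    linarith
  refine fun z => ⟨hne hc (by omega) z, fun hz => hne c.succ_pos hcN z ?_⟩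
  push_cast
  linear_combination hz

lemma eventually_add_ne_mul {L : ℝ} (hL : 0 < L) (c : ℝ) :
    ∀ᶠ ε in 𝓝[>] (0 : ℝ), ∀ z : ℤ, c + ε ≠ z * L := by
  have hfloor := Int.floor_le (c / L)
  have hlt := Int.lt_floor_add_one (c / L)
  rw [le_div_iff₀ hL] at hfloor
  rw [div_lt_iff₀ hL] at hlt
  filter_upwards [eventually_lt_of_pos (sub_pos.2 hlt), self_mem_nhdsWithin] with ε hεL hε z hz
  have hε : 0 < ε := hε
  have := eq_zero_of_eq_mul_of_abs_lt (c := c + ε - ⌊c / L⌋ * L) (z := z - ⌊c / L⌋) (L := L)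
    (by push_cast; linear_combination hz) (abs_lt.2 ⟨by linarith, by linarith⟩)
  linarith

lemma eventually_avoidsLoopEnds_add {L : ℝ} (hL : 0 < L) (μ c : ℝ) :
    ∀ᶠ ε in 𝓝[>] (0 : ℝ), AvoidsLoopEnds L μ (c + ε) := by
  filter_upwards [eventually_add_ne_mul hL c, eventually_add_ne_mul hL (c - μ)] with ε h₁ h₂ z
  exact ⟨h₁ z, add_sub_right_comm c ε μ ▸ h₂ z⟩

lemma exists_chipsLT_eq_add {g : ℕ} {a : ℕ} {x : ℕ → Option ℝ} (htot : chipsLT a x g = g + 1)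
    {k : ℕ} (hk : k < g) :
    ∃ c : ℕ, chipsLT a x k = k + c ∧ c ≤ a ∧ 0 < c ∧ (x k = none → 1 < c) := by
  have hlower := chipsLT_le_add a x (Nat.succ_le_of_lt hk)
  have hupper := chipsLT_le_add a x k.zero_le
  rw [htot, chipsLT_succ] at hlower
  rw [chipsLT_zero] at hupper
  push_cast at hlower hupper
  have hnone (h : x k = none) : (if (x k).isSome then 1 else 0 : ℤ) = 0 := by simp [h]
  refine ⟨(chipsLT a x k - k).toNat, ?_, ?_, ?_, fun h => ?_⟩
  · split_ifs at hlower <;> omega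
  · omega
  · split_ifs at hlower <;> omega
  · rw [hnone h] at hlower
    omega

section

variable {g : ℕ} {ℓ m n : ℕ → ℝ} {hℓ : ∀ k, 0 < ℓ k} {hm : ∀ k, 0 < m k} {hn : ∀ k, 0 < n k}

local notation "𝒞" => chainOfLoops g ℓ m n hℓ hm hn

lemma exists_eq_neg_mul_of_none {r : ℕ} {x : ℕ → ℕ → Option ℝ} {D : Divisor 𝒞}
    (hx : ∀ i ≤ r, ValidChips g ℓ m (x i))
    (hD : ∀ i ≤ r, LinEquiv 𝒞 D (stdDiv 𝒞 i (x i) (r - i))) {i : ℕ} (hi : i ≤ r) {k : ℕ}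
    (hk : k < g) {u : ℝ} (hu : x 0 k = some u) (hxi : x i k = none) :
    ∃ (b : ℕ) (z : ℤ), b + 1 ≤ r + g ∧ u = -(m (k + 1) * b) + z * (ℓ (k + 1) + m (k + 1)) := by
  have hequiv := (hD 0 r.zero_le).symm.trans (hD i hi)
  have hi0 : i ≠ 0 := by
    rintro rfl
    simp [hu] at hxi
  have hlt := chipsLT_lt_chipsLT (hx 0 r.zero_le) (hx i hi) hequiv
    (by simpa using Nat.pos_of_ne_zero hi0) hk.le
  have hupper := chipsLT_le_add i (x i) k.zero_le
  have hlower := chipsLT_mono (0 : ℕ) (x 0) k.zero_le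
  rw [chipsLT_zero] at hupper hlower
  obtain ⟨b, hb⟩ := Int.eq_ofNat_of_zero_le (sub_nonneg.2 (Int.add_one_le_iff.2 hlt))
  obtain ⟨z, hz⟩ := ((stdDiv_linEquiv_iff (hx 0 r.zero_le) (hx i hi)).1 hequiv).2 k hk
  refine ⟨b, -z, by push_cast at hupper hlower hb; omega, ?_⟩
  have hchips : chipsLT i (x i) k = chipsLT (0 : ℕ) (x 0) k + 1 + b := by omega
  simp only [chipMoment, chipsLT_succ, hu, hxi, hchips, Option.getD_some, Option.getD_none,
    Option.isSome_some, Option.isSome_none, Bool.false_eq_true, if_true, if_false] at hz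
  push_cast at hz ⊢
  linear_combination -hz

lemma eventually_avoidsLoopEnds_transferCoord {r a N : ℕ} (hN : a + r + g ≤ N)
    {x : ℕ → ℕ → Option ℝ} {D : Divisor 𝒞} (hx : ∀ i ≤ r, ValidChips g ℓ m (x i))
    (hD : ∀ i ≤ r, LinEquiv 𝒞 D (stdDiv 𝒞 i (x i) (r - i))) (htot : chipsLT a (x 0) g = g + 1)
    {k : ℕ} (hk : k < g) (hlen : N * m (k + 1) < ℓ (k + 1) + m (k + 1)) :
    ∀ᶠ ε in 𝓝[>] (0 : ℝ), AvoidsLoopEnds (ℓ (k + 1) + m (k + 1)) (m (k + 1))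
      (transferCoord m a (shiftChips (fun k => ∀ i ≤ r, (x i k).isSome) ε (x 0)) k) := by
  obtain ⟨c, hc, hca, hc0, hcnone⟩ := exists_chipsLT_eq_add htot hk
  simp only [transferCoord, chipsLT_shiftChips, hc, shiftChips, add_sub_cancel_left]
  rcases hx0 : x 0 k with _ | u
  · refine .of_forall fun ε => ?_
    have h1c := hcnone hx0
    obtain ⟨c, rfl⟩ : ∃ c', c = c' + 1 := ⟨c - 1, by omega⟩
    convert avoidsLoopEnds_neg_mul (c := c) (hm (k + 1)) hlen (by omega) (by omega) using 1
    simp only [Option.map_none, ite_self, Option.getD_none]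
    push_cast
    ring
  · by_cases hS : ∀ i ≤ r, (x i k).isSome
    · filter_upwards [eventually_avoidsLoopEnds_add (add_pos (hℓ (k + 1)) (hm (k + 1)))
        (m (k + 1)) (u - m (k + 1) * c)] with ε hε
      convert hε using 1
      simp only [if_pos hS, Option.map_some, Option.getD_some]
      push_cast
      ring
    · refine .of_forall fun ε => ?_
      obtain ⟨i, hi, hxi⟩ : ∃ i ≤ r, x i k = none := by simpa using hS
      obtain ⟨b, z, hb, rfl⟩ := exists_eq_neg_mul_of_none hx hD hi hk hx0 hxi
      convert (avoidsLoopEnds_neg_mul (c := c + b) (hm (k + 1)) hlen (by omega)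
        (by omega)).add_mul z using 1
      simp only [if_neg hS, Option.getD_some]
      push_cast
      ring

lemma eventually_validChips_transferChips {r a N : ℕ} (hN : a + r + g ≤ N)
    (hlen : ∀ k < g, N * m (k + 1) < ℓ (k + 1) + m (k + 1)) {x : ℕ → ℕ → Option ℝ}
    {D : Divisor 𝒞} (hx : ∀ i ≤ r, ValidChips g ℓ m (x i))
    (hD : ∀ i ≤ r, LinEquiv 𝒞 D (stdDiv 𝒞 i (x i) (r - i)))
    (htot : chipsLT a (x 0) g = g + 1) :
    ∀ᶠ ε in 𝓝[>] (0 : ℝ), ValidChips g ℓ m (transferChips hℓ hm a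
      (shiftChips (fun k => ∀ i ≤ r, (x i k).isSome) ε (x 0))) := by
  have havoid := (Filter.eventually_all_finset (Finset.range g)).2 fun k hk =>
    eventually_avoidsLoopEnds_transferCoord hN hx hD htot (Finset.mem_range.1 hk)
      (hlen k (Finset.mem_range.1 hk))
  filter_upwards [havoid] with ε hε
  exact validChips_transferChips hℓ hm fun k hk => hε k (Finset.mem_range.2 hk)

end

end Chips

section VertexAvoiding

variable {g : ℕ} {ℓ m n : ℕ → ℝ} {hℓ : ∀ k, 0 < ℓ k} {hm : ∀ k, 0 < m k} {hn : ∀ k, 0 < n k}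

local notation "𝒞" => chainOfLoops g ℓ m n hℓ hm hn

variable {r : ℕ} {x : ℕ → ℕ → Option ℝ}

lemma vertexAvoiding_of_stdDiv {D : Divisor 𝒞} (hx : ∀ i ≤ r, ValidChips g ℓ m (x i))
    (hD : ∀ i ≤ r, LinEquiv 𝒞 D (stdDiv 𝒞 i (x i) (r - i))) : VertexAvoiding 𝒞 D r :=
  fun i hi => ⟨stdDiv 𝒞 i (x i) (r - i),
    ⟨hD i hi, stdDiv_nonneg i.cast_nonneg _ (by omega), stdDiv_leftEnd (hx i hi),
      stdDiv_rightEnd (hx i hi), fun k => ⟨stdDiv_v (hx i hi) k, stdDiv_w (hx i hi) k⟩⟩,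
    fun _ hF hF0 => stdDiv_unique (hx i hi) ((hD i hi).symm.trans hF) hF0⟩

lemma hasRank_of_stdDiv {D : Divisor 𝒞} (hx : ∀ i ≤ r, ValidChips g ℓ m (x i))
    (hD : ∀ i ≤ r, LinEquiv 𝒞 D (stdDiv 𝒞 i (x i) (r - i))) : HasRank 𝒞 D r := by
  refine ⟨rankGE_of_stdDiv hx hD, fun h => ?_⟩
  have h0r := r.zero_le
  have hF : (0 : Divisor 𝒞) ≤ Finsupp.single (rightEnd 𝒞) ((r : ℤ) + 1) :=
    Finsupp.single_nonneg.2 (by positivity)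
  obtain ⟨D', hD', hequiv⟩ := h _ hF (by simp [deg_eq_pair])
  have hsum := add_nonneg hD' hF
  have hright : (r : ℤ) + 1 ≤ (D' + Finsupp.single (rightEnd 𝒞) ((r : ℤ) + 1)) (rightEnd 𝒞) := by
    rw [Finsupp.add_apply, Finsupp.single_eq_same]
    exact le_add_of_nonneg_left (hD' _)
  have heq := stdDiv_unique (hx 0 h0r)
    ((hD 0 h0r).symm.trans (hequiv.congr_sub (D₁ := D) (by abel))) hsum (hsum _) (by
      rw [Nat.cast_zero, sub_zero]
      linarith)
  rw [heq, stdDiv_rightEnd (hx 0 h0r)] at hright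
  push_cast at hright
  linarith

lemma VertexAvoiding.exists_stdDiv {D : Divisor 𝒞} (h : VertexAvoiding 𝒞 D r) :
    ∃ x : ℕ → ℕ → Option ℝ, (∀ i ≤ r, ValidChips g ℓ m (x i)) ∧
      ∀ i ≤ r, LinEquiv 𝒞 D (stdDiv 𝒞 i (x i) (r - i)) := by
  have hexists (i : ℕ) (hi : i ≤ r) : ∃ y : ℕ → Option ℝ, ValidChips g ℓ m y ∧
      LinEquiv 𝒞 D (stdDiv 𝒞 i y (r - i)) := by
    obtain ⟨F, ⟨hDF, hF, hleft, hright, hvw⟩, huniq⟩ := h i hi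
    have hdet : DeterminedByEnds F := fun G hFG hG hleftG hrightG =>
      huniq G (hDF.trans hFG) hG (hleft ▸ hleftG) (hright ▸ hrightG)
    obtain ⟨y, hy, hFy⟩ := hdet.exists_eq_stdDiv hF (fun k => (hvw k).1) fun k => (hvw k).2
    rw [hleft, hright] at hFy
    exact ⟨y, hy, hFy ▸ hDF⟩
  choose! x hx hD using hexists
  exact ⟨x, hx, hD⟩

lemma IsDistinguished.carries_stdDiv {D : Divisor 𝒞} (hx : ∀ i ≤ r, ValidChips g ℓ m (x i))
    (hD : ∀ i ≤ r, LinEquiv 𝒞 D (stdDiv 𝒞 i (x i) (r - i))) {ψ : Fin (r + 1) → Point 𝒞 → ℝ}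
    (hψ : IsDistinguished 𝒞 D r ψ) (i : Fin (r + 1)) :
    Carries 𝒞 (ψ i) D (stdDiv 𝒞 (i : ℕ) (x i) (r - (i : ℕ))) := by
  have hi : (i : ℕ) ≤ r := by omega
  obtain ⟨D', hD', hleft, hright, hcarries⟩ := hψ i
  exact stdDiv_unique (hx i hi) ((hD i hi).symm.trans ⟨_, hcarries⟩) hD' hleft.ge hright.ge ▸
    hcarries

end VertexAvoiding

section EdgeRise

/-- The initial slope on the bottom edge of the loop `k` of a function that carries
`stdDiv Γ a x b` to `stdDiv Γ a' x' b'`: the two edges have the same end points, which leaves only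
one choice for it. -/
def bottomSlope (ℓ m : ℕ → ℝ) (a a' : ℤ) (x x' : ℕ → Option ℝ) (k : ℕ) : ℝ :=
  ((bottomHinge (x' k) (m (k + 1)) - bottomHinge (x k) (m (k + 1))) -
    (topHinge (x' k) (ℓ (k + 1)) - topHinge (x k) (ℓ (k + 1))) +
    (chipsLT a x k - chipsLT a' x' k : ℤ) * ℓ (k + 1)) / (ℓ (k + 1) + m (k + 1))

/-- The difference of the values at the point `pt e t` and at the source of the edge `e` of a
function that carries `stdDiv Γ a x b` to `stdDiv Γ a' x' b'`. -/
def edgeRise {g : ℕ} (ℓ m : ℕ → ℝ) (a a' : ℤ) (x x' : ℕ → Option ℝ) (t : ℝ) : ChainEdge g → ℝ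
  | .bridge k => (chipsLT a x k - chipsLT a' x' k : ℤ) * t
  | .top k => ((chipsLT a x k - chipsLT a' x' k : ℤ) - bottomSlope ℓ m a a' x x' k) * t -
      (topHinge (x' k) t - topHinge (x k) t)
  | .bottom k => bottomSlope ℓ m a a' x x' k * t - (bottomHinge (x' k) t - bottomHinge (x k) t)

variable {g : ℕ} {ℓ m n : ℕ → ℝ} {hℓ : ∀ k, 0 < ℓ k} {hm : ∀ k, 0 < m k} {hn : ∀ k, 0 < n k}

local notation "𝒞" => chainOfLoops g ℓ m n hℓ hm hn

lemma cast_bottom_eq_bottomSlope {a a' b b' : ℤ} {x x' : ℕ → Option ℝ}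
    (hx : ValidChips g ℓ m x) (hx' : ValidChips g ℓ m x') {f : Point 𝒞 → ℝ} {σ : ChainEdge g → ℤ}
    (hσ : ∀ e, HasInitialSlope f (stdDiv 𝒞 a' x' b' - stdDiv 𝒞 a x b) e (σ e)) {k : Fin g}
    (hsum : σ (.top k) + σ (.bottom k) = chipsLT a x k - chipsLT a' x' k) :
    (σ (.bottom k) : ℝ) = bottomSlope ℓ m a a' x x' k := by
  have htop := hσ (.top k) _ (len_pos 𝒞 _).le le_rfl
  have hbottom := hσ (.bottom k) _ (len_pos 𝒞 _).le le_rfl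
  rw [pt_len, map_sub] at htop hbottom
  rw [pair_hinge_top hx, pair_hinge_top hx'] at htop
  rw [pair_hinge_bottom hx, pair_hinge_bottom hx'] at hbottom
  simp only [chainOfLoops] at htop hbottom
  rw [bottomSlope, eq_div_iff (add_pos (hℓ _) (hm _)).ne', ← hsum]
  push_cast
  linarith

lemma MetricGraph.Carries.apply_pt {a a' b b' : ℤ} {x x' : ℕ → Option ℝ}
    (hx : ValidChips g ℓ m x) (hx' : ValidChips g ℓ m x') {f : Point 𝒞 → ℝ}
    (hf : Carries 𝒞 f (stdDiv 𝒞 a x b) (stdDiv 𝒞 a' x' b')) (e : ChainEdge g) {t : ℝ}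
    (h0 : 0 ≤ t) (ht : t ≤ len 𝒞 e) :
    f (pt 𝒞 e t) = f (.vertex (src 𝒞 e)) + edgeRise ℓ m a a' x x' t e := by
  obtain ⟨σ, hσ, hbridge, hloop, -⟩ := chain_carries_iff.1 hf
  have hdeg {k j : ℕ} (hkj : 4 * k ≤ j) (hjk : j ≤ 4 * k + 3) (hj : 1 ≤ j) (hjg : j ≤ 4 * g + 2) :
      -degLT j (stdDiv 𝒞 a' x' b' - stdDiv 𝒞 a x b) = chipsLT a x k - chipsLT a' x' k := by
    rw [map_sub, degLT_stdDiv hx hkj hjk hj hjg, degLT_stdDiv hx' hkj hjk hj hjg, neg_sub]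
  rw [hσ e t h0 ht, add_sub_assoc, map_sub]
  congr 1
  rcases e with k | k | k
  · rw [pair_hinge_bridge hx, pair_hinge_bridge hx', hbridge,
      hdeg (k := k) (by omega) (by omega) (by omega) (by omega), sub_self, sub_zero, edgeRise]
  all_goals
    have hsum := (hloop k).trans (hdeg (k := k) (by omega) (by omega) (by omega) (by omega))
    have hbottom := cast_bottom_eq_bottomSlope hx hx' hσ hsum
  · rw [pair_hinge_top hx, pair_hinge_top hx', edgeRise, ← hbottom, ← hsum]
    push_cast
    ring
  · rw [pair_hinge_bottom hx, pair_hinge_bottom hx', edgeRise, ← hbottom]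

lemma exists_eq_pt (p : Point 𝒞) : ∃ e t, 0 ≤ t ∧ t ≤ len 𝒞 e ∧ p = pt 𝒞 e t := by
  rcases p with (k | k) | ⟨e, t, h⟩
  · exact ⟨.bridge k, 0, le_rfl, (len_pos 𝒞 _).le, (pt_zero (Γ := 𝒞) (.bridge k)).symm⟩
  · exact ⟨.bridge k, _, (len_pos 𝒞 _).le, le_rfl, (pt_len (Γ := 𝒞) (.bridge k)).symm⟩
  · exact ⟨e, t, h.1.le, h.2.le, (pt_inner h).symm⟩

lemma MetricGraph.Carries.exists_abs_le {f : Point 𝒞 → ℝ} {D D' : Divisor 𝒞}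
    (hf : Carries 𝒞 f D D') : ∃ M, ∀ p, |f p| ≤ M := by
  obtain ⟨σ, hσ, -⟩ := chain_carries_iff.1 hf
  have hbound (e : ChainEdge g) : ∃ M, ∀ t ∈ Set.Icc 0 (len 𝒞 e),
      ‖f (.vertex (src 𝒞 e)) + σ e * t - pair (hinge e t) (D' - D)‖ ≤ M :=
    isCompact_Icc.exists_bound_of_continuousOn
      (((continuous_const.add (continuous_const.mul continuous_id)).sub
        (continuous_pair_hinge e (D' - D))).continuousOn)
  choose M hM using hbound
  refine ⟨∑ e, |M e|, fun p => ?_⟩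
  obtain ⟨e, t, h0, ht, rfl⟩ := exists_eq_pt p
  rw [hσ e t h0 ht]
  exact ((hM e t ⟨h0, ht⟩).trans (le_abs_self _)).trans
    (Finset.single_le_sum (f := fun e => |M e|) (fun _ _ => abs_nonneg _) (Finset.mem_univ e))

lemma abs_sub_leftEnd_le {φ : Point 𝒞 → ℝ} {B : ℝ}
    (hφ : ∀ e t, 0 ≤ t → t ≤ len 𝒞 e → |φ (pt 𝒞 e t) - φ (.vertex (src 𝒞 e))| ≤ B) (p : Point 𝒞) :
    |φ p - φ (leftEnd 𝒞)| ≤ (2 * g + 1) * B := by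
  have hB : 0 ≤ B := (abs_nonneg _).trans (hφ (.bridge 0) 0 le_rfl (len_pos 𝒞 _).le)
  have hstep {e : ChainEdge g} {j : ℕ} {t : ℝ} (h0 : 0 ≤ t) (ht : t ≤ len 𝒞 e)
      (h : |φ (.vertex (src 𝒞 e)) - φ (leftEnd 𝒞)| ≤ j * B) :
      |φ (pt 𝒞 e t) - φ (leftEnd 𝒞)| ≤ (j + 1 : ℕ) * B := by
    push_cast
    linarith [abs_sub_le (φ (pt 𝒞 e t)) (φ (.vertex (src 𝒞 e))) (φ (leftEnd 𝒞)), hφ e t h0 ht]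
  have hstep_len {e : ChainEdge g} {j : ℕ}
      (h : |φ (.vertex (src 𝒞 e)) - φ (leftEnd 𝒞)| ≤ j * B) :
      |φ (.vertex (tgt 𝒞 e)) - φ (leftEnd 𝒞)| ≤ (j + 1 : ℕ) * B :=
    pt_len (Γ := 𝒞) e ▸ hstep (len_pos 𝒞 e).le le_rfl h
  have hw (k : Fin (g + 1)) : |φ (.vertex (.w k)) - φ (leftEnd 𝒞)| ≤ (2 * k : ℕ) * B := by
    induction k using Fin.induction with
    | zero => simp [leftEnd]
    | succ k ih => exact hstep_len (e := .bottom k) (hstep_len (e := .bridge k.castSucc) ih)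
  have hle {j : ℕ} (hj : j ≤ 2 * g + 1) : (j : ℝ) * B ≤ (2 * g + 1) * B := by
    gcongr
    exact_mod_cast hj
  obtain ⟨e, t, h0, ht, rfl⟩ := exists_eq_pt p
  rcases e with k | k | k
  · exact (hstep h0 ht (hw k)).trans (hle (by omega))
  all_goals
    refine (hstep (j := 2 * k + 1) h0 ht ?_).trans (hle (by omega))
    exact hstep_len (e := .bridge k.castSucc) (hw k.castSucc)

end EdgeRise

section ChainEmbedding

/-- The edge of a chain that corresponds to `e` after `s` further loops have been put in front. -/
def shiftEdge {g : ℕ} (s : ℕ) : ChainEdge g → ChainEdge (g + s)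
  | .bridge k => .bridge ⟨k + s, by omega⟩
  | .top k => .top ⟨k + s, by omega⟩
  | .bottom k => .bottom ⟨k + s, by omega⟩

/-- The position of the source of `e` on the edge `shiftEdge s e`, if the first bridge is extended
by `N` on the left. -/
def edgeOffset {g : ℕ} (N : ℝ) : ChainEdge g → ℝ
  | .bridge k => if k = 0 then N else 0
  | _ => 0

lemma edgeOffset_nonneg {g : ℕ} {N : ℝ} (hN : 0 ≤ N) (e : ChainEdge g) : 0 ≤ edgeOffset N e := by
  unfold edgeOffset
  split <;> positivity

variable {g s : ℕ} {ℓ m n ℓ' m' n' : ℕ → ℝ} {hℓ : ∀ k, 0 < ℓ k} {hm : ∀ k, 0 < m k}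
  {hn : ∀ k, 0 < n k} {hℓ' : ∀ k, 0 < ℓ' k} {hm' : ∀ k, 0 < m' k} {hn' : ∀ k, 0 < n' k} {N : ℝ}

local notation "𝒞" => chainOfLoops g ℓ m n hℓ hm hn

local notation "𝒞'" => chainOfLoops (g + s) ℓ' m' n' hℓ' hm' hn'

/-- The embedding of a chain of `g` loops into the chain obtained by putting `s` further loops in
front, and extending the first bridge by `N`. -/
def chainEmbedding (N : ℝ) : Point 𝒞 → Point 𝒞'
  | .vertex (.w k) => pt 𝒞' (shiftEdge s (.bridge k)) (edgeOffset N (.bridge k))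
  | .vertex (.v k) => .vertex (.v ⟨k + s, by omega⟩)
  | .inner e t _ => pt 𝒞' (shiftEdge s e) (edgeOffset N e + t)

local notation "𝒿" => (chainEmbedding N : Point 𝒞 → Point 𝒞')

lemma len_shiftEdge (hns : n' s = N + n 0) (hnk : ∀ k, 1 ≤ k → n' (k + s) = n k)
    (hℓs : ∀ k, ℓ' (k + s) = ℓ k) (hms : ∀ k, m' (k + s) = m k) (e : ChainEdge g) :
    len 𝒞' (shiftEdge s e) = edgeOffset N e + len 𝒞 e := by
  rcases e with k | k | k <;> simp only [shiftEdge, edgeOffset, chainOfLoops]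
  · split_ifs with hk
    · simp [hk, hns]
    · rw [hnk _ (Nat.one_le_iff_ne_zero.2 fun h => hk (Fin.ext h)), zero_add]
  · rw [Nat.add_right_comm, hℓs, zero_add]
  · rw [Nat.add_right_comm, hms, zero_add]

lemma chainEmbedding_src (e : ChainEdge g) :
    𝒿 (.vertex (src 𝒞 e)) = pt 𝒞' (shiftEdge s e) (edgeOffset N e) := by
  rcases e with k | k | k
  · rfl
  · exact (pt_zero (Γ := 𝒞') (shiftEdge s (.top k))).symm
  · exact (pt_zero (Γ := 𝒞') (shiftEdge s (.bottom k))).symm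

lemma chainEmbedding_tgt (e : ChainEdge g) :
    𝒿 (.vertex (tgt 𝒞 e)) = .vertex (tgt 𝒞' (shiftEdge s e)) := by
  rcases e with k | k | k
  · rfl
  all_goals
    have hw : 𝒿 (.vertex (.w k.succ)) = .vertex (.w ⟨k + 1 + s, by omega⟩) := by
      rw [chainEmbedding, edgeOffset, if_neg (Fin.succ_ne_zero k)]
      exact pt_zero (Γ := 𝒞') (.bridge ⟨k + 1 + s, _⟩)
    refine hw.trans (congrArg (fun j => Point.vertex (ChainVertex.w j)) (Fin.ext ?_))
    exact Nat.add_right_comm _ _ _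

lemma chainEmbedding_pt (hns : n' s = N + n 0) (hnk : ∀ k, 1 ≤ k → n' (k + s) = n k)
    (hℓs : ∀ k, ℓ' (k + s) = ℓ k) (hms : ∀ k, m' (k + s) = m k) (e : ChainEdge g) {t : ℝ}
    (h0 : 0 ≤ t) (ht : t ≤ len 𝒞 e) :
    𝒿 (pt 𝒞 e t) = pt 𝒞' (shiftEdge s e) (edgeOffset N e + t) := by
  rcases h0.eq_or_lt with rfl | h0
  · rw [pt_zero, add_zero, chainEmbedding_src]
  rcases ht.eq_or_lt with rfl | ht
  · rw [pt_len, chainEmbedding_tgt, ← len_shiftEdge (hℓ := hℓ) (hm := hm) (hn := hn) (hℓ' := hℓ')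
      (hm' := hm') (hn' := hn') hns hnk hℓs hms, pt_len]
  · rw [pt_inner ⟨h0, ht⟩, chainEmbedding]

lemma edgeRise_shiftEdge (hℓs : ∀ k, ℓ' (k + s) = ℓ k) (hms : ∀ k, m' (k + s) = m k)
    {a₁ a₂ c₁ c₂ : ℤ} {x₁ x₂ X₁ X₂ : ℕ → Option ℝ} (h₁ : ∀ k < g, X₁ (k + s) = x₁ k)
    (h₂ : ∀ k < g, X₂ (k + s) = x₂ k) (hc : chipsLT c₁ X₁ s - chipsLT c₂ X₂ s = a₁ - a₂)
    (e : ChainEdge g) (t : ℝ) :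
    edgeRise ℓ' m' c₁ c₂ X₁ X₂ (edgeOffset N e + t) (shiftEdge s e) -
      edgeRise ℓ' m' c₁ c₂ X₁ X₂ (edgeOffset N e) (shiftEdge s e) =
      edgeRise ℓ m a₁ a₂ x₁ x₂ t e := by
  have hchips {k : ℕ} (hk : k ≤ g) : chipsLT c₁ X₁ (k + s) - chipsLT c₂ X₂ (k + s) =
      chipsLT a₁ x₁ k - chipsLT a₂ x₂ k := by
    induction k with
    | zero => rw [zero_add, chipsLT_zero, chipsLT_zero, hc]
    | succ k ih =>
      simp only [Nat.add_right_comm k 1 s, chipsLT_succ, h₁ k hk, h₂ k hk]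
      linarith [ih (by omega)]
  have hslope (k : Fin g) : bottomSlope ℓ' m' c₁ c₂ X₁ X₂ (k + s) =
      bottomSlope ℓ m a₁ a₂ x₁ x₂ k := by
    simp only [bottomSlope, Nat.add_right_comm k.1 s 1, hchips k.2.le, h₁ k k.2, h₂ k k.2, hℓs, hms]
  have hhinge (o : Option ℝ) : bottomHinge o 0 = 0 ∧ topHinge o 0 = 0 := by
    rcases o with - | u
    · exact ⟨rfl, rfl⟩
    · rcases lt_or_ge 0 u with hu | hu
      · simp [bottomHinge, topHinge, hu, hu.le]
      · simp [bottomHinge, topHinge, hu, hu.not_gt]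
  rcases e with k | k | k
  · simp only [shiftEdge, edgeRise, hchips (Nat.lt_succ_iff.1 k.2)]
    ring
  · simp [shiftEdge, edgeRise, edgeOffset, hslope, hchips k.2.le, h₁ k k.2, h₂ k k.2, hhinge]
  · simp [shiftEdge, edgeRise, edgeOffset, hslope, h₁ k k.2, h₂ k k.2, hhinge]

theorem exists_comp_chainEmbedding_eq_add (hN : 0 ≤ N) (hns : n' s = N + n 0)
    (hnk : ∀ k, 1 ≤ k → n' (k + s) = n k) (hℓs : ∀ k, ℓ' (k + s) = ℓ k)
    (hms : ∀ k, m' (k + s) = m k) {a₁ b₁ a₂ b₂ c₁ d₁ c₂ d₂ : ℤ} {x₁ x₂ X₁ X₂ : ℕ → Option ℝ}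
    (hx₁ : ValidChips g ℓ m x₁) (hx₂ : ValidChips g ℓ m x₂)
    (hX₁ : ValidChips (g + s) ℓ' m' X₁) (hX₂ : ValidChips (g + s) ℓ' m' X₂)
    (h₁ : ∀ k < g, X₁ (k + s) = x₁ k) (h₂ : ∀ k < g, X₂ (k + s) = x₂ k)
    (hc : chipsLT c₁ X₁ s - chipsLT c₂ X₂ s = a₁ - a₂) {f : Point 𝒞 → ℝ}
    (hf : Carries 𝒞 f (stdDiv 𝒞 a₁ x₁ b₁) (stdDiv 𝒞 a₂ x₂ b₂)) {F : Point 𝒞' → ℝ}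
    (hF : Carries 𝒞' F (stdDiv 𝒞' c₁ X₁ d₁) (stdDiv 𝒞' c₂ X₂ d₂)) :
    ∃ c, ∀ p, F (chainEmbedding N p) = f p + c := by
  have hrise (e : ChainEdge g) (t : ℝ) (h0 : 0 ≤ t) (ht : t ≤ len 𝒞 e) :
      |F (𝒿 (pt 𝒞 e t)) - f (pt 𝒞 e t) - (F (𝒿 (.vertex (src 𝒞 e))) - f (.vertex (src 𝒞 e)))| ≤
        0 := by
    have hlen := len_shiftEdge (hℓ := hℓ) (hm := hm) (hn := hn) (hℓ' := hℓ') (hm' := hm')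
      (hn' := hn') hns hnk hℓs hms e
    have hoffset := edgeOffset_nonneg hN e
    rw [chainEmbedding_src, chainEmbedding_pt hns hnk hℓs hms e h0 ht,
      hF.apply_pt hX₁ hX₂ _ hoffset (by linarith), hF.apply_pt hX₁ hX₂ _ (add_nonneg hoffset h0)
      (by linarith), hf.apply_pt hx₁ hx₂ e h0 ht,
      ← edgeRise_shiftEdge (N := N) hℓs hms h₁ h₂ hc e t]
    exact le_of_eq (abs_eq_zero.2 (by ring))
  refine ⟨F (𝒿 (leftEnd 𝒞)) - f (leftEnd 𝒞), fun p => ?_⟩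
  have hp := abs_sub_leftEnd_le (φ := fun p => F (𝒿 p) - f p) hrise p
  rw [mul_zero, abs_nonpos_iff, sub_eq_zero] at hp
  linarith

end ChainEmbedding

section Tropical

open Filter

variable {ι X : Type} {S : Finset ι} {f : ι → X → ℝ}

lemma TropicallyDependent.of_eq_add {f' : ι → X → ℝ} {c : ι → ℝ} {e : X → ℝ}
    (h : TropicallyDependent S f) (hf' : ∀ i ∈ S, ∀ x, f' i x = f i x + c i + e x) :
    TropicallyDependent S f' := by
  obtain ⟨b, hb⟩ := h
  refine ⟨fun i => b i - c i, fun x => ?_⟩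
  obtain ⟨i, hi, j, hj, hij, heq, hmin⟩ := hb x
  refine ⟨i, hi, j, hj, hij, ?_, fun k hk => ?_⟩
  · rw [hf' i hi, hf' j hj]
    linarith
  · rw [hf' i hi, hf' k hk]
    linarith [hmin k hk]

lemma TropicallyIndependent.image {κ : Type} [DecidableEq κ] {e : ι → κ} {f : κ → X → ℝ}
    (h : TropicallyIndependent S fun i => f (e i)) : TropicallyIndependent (S.image e) f := by
  rintro ⟨b, hb⟩
  refine h ⟨fun i => b (e i), fun x => ?_⟩
  obtain ⟨_, hi, _, hj, hij, heq, hmin⟩ := hb x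
  obtain ⟨i, hi', rfl⟩ := Finset.mem_image.1 hi
  obtain ⟨j, hj', rfl⟩ := Finset.mem_image.1 hj
  exact ⟨i, hi', j, hj', ne_of_apply_ne e hij, heq,
    fun k hk => hmin _ (Finset.mem_image_of_mem e hk)⟩

/-- Two of the functions `f i + b i` are everywhere within `δ` of the minimum: the approximate form
of the condition on the constants `b` in `TropicallyDependent`. -/
def NearMinimumTwice (S : Finset ι) (f : ι → X → ℝ) (δ : ℝ) (b : ι → ℝ) : Prop :=
  ∀ x, ∃ i ∈ S, ∃ j ∈ S, i ≠ j ∧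
    ∀ k ∈ S, f i x + b i ≤ f k x + b k + δ ∧ f j x + b j ≤ f k x + b k + δ

lemma NearMinimumTwice.tropicallyDependent {b : ι → ℝ} (h : NearMinimumTwice S f 0 b) :
    TropicallyDependent S f := by
  refine ⟨b, fun x => ?_⟩
  obtain ⟨i, hi, j, hj, hij, hmin⟩ := h x
  simp only [add_zero] at hmin
  exact ⟨i, hi, j, hj, hij, le_antisymm (hmin j hj).1 (hmin i hi).2, fun k hk => (hmin k hk).1⟩

lemma NearMinimumTwice.of_tendsto {α : Type} {U : Ultrafilter α} {δ : α → ℝ} {b : α → ι → ℝ}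
    {δ₀ : ℝ} {b₀ : ι → ℝ} (hδ : Tendsto δ U (𝓝 δ₀)) (hb : Tendsto b U (𝓝 b₀))
    (h : ∀ᶠ a in U, NearMinimumTwice S f (δ a) (b a)) : NearMinimumTwice S f δ₀ b₀ := by
  intro x
  have hb' := tendsto_pi_nhds.1 hb
  -- Along an ultrafilter, one of the finitely many pairs `i, j` occurs eventually.
  obtain ⟨i, hi, hev⟩ := (Ultrafilter.eventually_exists_mem_iff S.finite_toSet).1
    (h.mono fun a ha => ha x)
  obtain ⟨j, hj, hev⟩ := (Ultrafilter.eventually_exists_mem_iff S.finite_toSet).1 hev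
  refine ⟨i, hi, j, hj, hev.exists.choose_spec.1, fun k hk => ?_⟩
  have hk' := ((hb' k).const_add (f k x)).add hδ
  exact ⟨le_of_tendsto_of_tendsto ((hb' i).const_add _) hk' (hev.mono fun _ ha => (ha.2 k hk).1),
    le_of_tendsto_of_tendsto ((hb' j).const_add _) hk' (hev.mono fun _ ha => (ha.2 k hk).2)⟩

lemma NearMinimumTwice.exists_mem_Icc {M δ : ℝ} {b : ι → ℝ} (hM : ∀ i ∈ S, ∀ x, |f i x| ≤ M)
    (hM0 : 0 ≤ M) (hδ : δ ≤ 1) (h : NearMinimumTwice S f δ b) :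
    ∃ b' ∈ Set.univ.pi fun _ => Set.Icc 0 (2 * M + 1), NearMinimumTwice S f δ b' := by
  rcases S.eq_empty_or_nonempty with rfl | hS
  · exact ⟨0, fun _ _ => ⟨le_rfl, by simp only [Pi.zero_apply]; linarith⟩,
      fun x => by simpa using h x⟩
  obtain ⟨i₀, hi₀, hmin⟩ := S.exists_min_image b hS
  refine ⟨fun i => max (min (b i - b i₀) (2 * M + 1)) 0,
    fun i _ => ⟨le_max_right _ _, max_le (min_le_right _ _) (by linarith)⟩, fun x => ?_⟩
  obtain ⟨i, hi, j, hj, hij, hnear⟩ := h x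
  have hbound {k : ι} (hk : k ∈ S) := abs_le.1 (hM k hk x)
  have htrunc {k : ι} (hk : k ∈ S) : max (min (b k - b i₀) (2 * M + 1)) 0 =
      min (b k - b i₀) (2 * M + 1) :=
    max_eq_left (le_min (sub_nonneg.2 (hmin k hk)) (by linarith))
  have heq {k : ι} (hk : k ∈ S) (hle : f k x + b k ≤ f i₀ x + b i₀ + δ) :
      max (min (b k - b i₀) (2 * M + 1)) 0 = b k - b i₀ := by
    rw [htrunc hk, min_eq_left]
    linarith [(hbound hk).1, (hbound hi₀).2]
  have hi' := hnear i₀ hi₀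
  refine ⟨i, hi, j, hj, hij, fun k hk => ?_⟩
  beta_reduce
  rw [heq hi hi'.1, heq hj hi'.2, htrunc hk]
  have hk' := hnear k hk
  rcases min_choice (b k - b i₀) (2 * M + 1) with hmin' | hmin' <;> rw [hmin']
  · constructor <;> linarith
  · constructor <;> linarith [(hbound hk).1, (hbound hi₀).2]

lemma tropicallyDependent_of_nearMinimumTwice {M : ℝ} (hM : ∀ i ∈ S, ∀ x, |f i x| ≤ M)
    (hM0 : 0 ≤ M) (h : ∀ δ > 0, ∃ b, NearMinimumTwice S f δ b) : TropicallyDependent S f := by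
  have hbounded (δ : ℝ) (hδ : 0 < δ ∧ δ ≤ 1) :
      ∃ b ∈ Set.univ.pi fun _ => Set.Icc 0 (2 * M + 1), NearMinimumTwice S f δ b :=
    (h δ hδ.1).choose_spec.exists_mem_Icc hM hM0 hδ.2
  choose! b hb hnear using hbounded
  have hsmall : ∀ᶠ δ in 𝓝[>] (0 : ℝ), 0 < δ ∧ δ ≤ 1 := Ioc_mem_nhdsGT one_pos
  let U := Ultrafilter.of (𝓝[>] (0 : ℝ))
  have hU : (U : Filter ℝ) ≤ 𝓝[>] 0 := Ultrafilter.of_le _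
  obtain ⟨b₀, -, hlim⟩ := (isCompact_univ_pi fun _ => isCompact_Icc).ultrafilter_le_nhds
    (U.map b) (le_principal_iff.2 ((hsmall.mono hb).filter_mono hU))
  exact (NearMinimumTwice.of_tendsto (hU.trans nhdsWithin_le_nhds) hlim
    ((hsmall.mono hnear).filter_mono hU)).tropicallyDependent

theorem TropicallyIndependent.exists_pos {M : ℝ} (hM : ∀ i ∈ S, ∀ x, |f i x| ≤ M)
    (h : TropicallyIndependent S f) :
    ∃ δ > 0, ∀ f' : ι → X → ℝ, (∀ i ∈ S, ∃ c, ∀ x, |f' i x - f i x - c| ≤ δ) →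
      TropicallyIndependent S f' := by
  by_contra! hne
  have hM' : ∀ i ∈ S, ∀ x, |f i x| ≤ |M| := fun i hi x => (hM i hi x).trans (le_abs_self M)
  refine h (tropicallyDependent_of_nearMinimumTwice hM' (abs_nonneg M) fun δ hδ => ?_)
  obtain ⟨f', hff', hf'⟩ := hne (δ / 2) (half_pos hδ)
  obtain ⟨b, hb⟩ := not_not.1 hf'
  choose! c hc using hff'
  refine ⟨fun i => b i + c i, fun x => ?_⟩
  obtain ⟨i, hi, j, hj, hij, heq, hmin⟩ := hb x
  refine ⟨i, hi, j, hj, hij, fun k hk => ?_⟩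
  have hi' := abs_le.1 (hc i hi x)
  have hj' := abs_le.1 (hc j hj x)
  have hk' := abs_le.1 (hc k hk x)
  constructor <;> linarith [hmin k hk]

section Path

variable {X' : Type} {A B : Finset ι} {F : ι → X' → ℝ} {j : X → X'} {γ : ℝ → X'} {p₀ : X}
  {σ : ι → ℤ} {M N : ℝ} {b : ι → ℝ} {J : ι}

lemma lt_on_path_of_minimal [DecidableEq ι] (hγ : γ N = j p₀)
    (hσ : ∀ I ∈ A ∪ B, ∀ t, 0 ≤ t → t ≤ N → F I (γ t) = F I (γ 0) + σ I * t)
    (hA : ∀ I ∈ A, σ I ≤ 0) (hB : ∀ I ∈ B, 1 ≤ σ I)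
    (hM : ∀ I ∈ A ∪ B, ∀ p, |F I (j p) - F I (j p₀)| ≤ M) (hJ : J ∈ B) {p : X}
    (hmin : ∀ K ∈ A ∪ B, F J (j p) + b J ≤ F K (j p) + b K) {t : ℝ}
    (ht : 0 ≤ t) (htN : t < N - 2 * M) {K : ι} (hK : K ∈ A) :
    F J (γ t) + b J < F K (γ t) + b K := by
  have hJ' := Finset.mem_union_right A hJ
  have hK' := Finset.mem_union_left B hK
  have hMJ := abs_le.1 (hM J hJ' p)
  have hMK := abs_le.1 (hM K hK' p)
  have hN : t ≤ N := by linarith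
  have hgap (I : ι) (hI : I ∈ A ∪ B) : F I (γ t) = F I (j p₀) - σ I * (N - t) := by
    rw [hσ I hI t ht hN, ← hγ, hσ I hI N (ht.trans hN) le_rfl]
    ring
  have hslopeK : σ K * (N - t) ≤ 0 :=
    mul_nonpos_of_nonpos_of_nonneg (by exact_mod_cast hA K hK) (sub_nonneg.2 hN)
  have hslopeJ : N - t ≤ σ J * (N - t) :=
    le_mul_of_one_le_left (sub_nonneg.2 hN) (by exact_mod_cast hB J hJ)
  rw [hgap J hJ', hgap K hK']
  linarith [hmin K hK']

lemma finite_setOf_minimum_twice_on_path {T : Set ℝ}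
    (hσ : ∀ I ∈ B, ∀ t ∈ T, F I (γ t) = F I (γ 0) + σ I * t) (hinj : Set.InjOn σ B)
    (hT : ∀ t ∈ T, ∃ I ∈ B, ∃ K ∈ B, I ≠ K ∧ F I (γ t) + b I = F K (γ t) + b K) :
    T.Finite := by
  refine Set.Finite.subset (Set.Finite.image2
    (fun I K => (F K (γ 0) + b K - (F I (γ 0) + b I)) / (σ I - σ K)) B.finite_toSet
    B.finite_toSet) fun t ht => ?_
  obtain ⟨I, hI, K, hK, hIK, heq⟩ := hT t ht
  have hne : (σ I : ℝ) - σ K ≠ 0 :=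
    sub_ne_zero.2 (by exact_mod_cast hinj.ne hI hK hIK)
  rw [hσ I hI t ht, hσ K hK t ht] at heq
  refine ⟨I, hI, K, hK, ?_⟩
  rw [div_eq_iff hne]
  linarith

theorem tropicallyIndependent_of_path [DecidableEq ι] (hN : 2 * M < N) (hγ : γ N = j p₀)
    (hσ : ∀ I ∈ A ∪ B, ∀ t, 0 ≤ t → t ≤ N → F I (γ t) = F I (γ 0) + σ I * t)
    (hA : ∀ I ∈ A, σ I ≤ 0) (hB : ∀ I ∈ B, 1 ≤ σ I) (hinj : Set.InjOn σ B)
    (hM : ∀ I ∈ A ∪ B, ∀ p, |F I (j p) - F I (j p₀)| ≤ M)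
    (hind : TropicallyIndependent A fun I p => F I (j p)) :
    TropicallyIndependent (A ∪ B) F := by
  rintro ⟨b, hb⟩
  -- If some `J ∈ B` attained the minimum on `j(X)`, only functions in `B` would do so at the start
  -- of the path, where two of them agree at only finitely many points.
  have hnot {J : ι} (hJ : J ∈ B) (p : X) : ¬ ∀ K ∈ A ∪ B, F J (j p) + b J ≤ F K (j p) + b K := by
    intro hmin
    have hM0 := (abs_nonneg _).trans (hM J (Finset.mem_union_right A hJ) p)
    have hmemB {t : ℝ} (ht : t ∈ Set.Ico 0 (N - 2 * M)) {I : ι} (hI : I ∈ A ∪ B)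
        (hle : F I (γ t) + b I ≤ F J (γ t) + b J) : I ∈ B :=
      (Finset.mem_union.1 hI).resolve_left fun hIA =>
        hle.not_gt (lt_on_path_of_minimal hγ hσ hA hB hM hJ hmin ht.1 ht.2 hIA)
    refine (Set.Ico_infinite (sub_pos.2 hN)) (finite_setOf_minimum_twice_on_path (b := b)
      (fun I hI t ht => hσ I (Finset.mem_union_right A hI) t ht.1 (by linarith [ht.2])) hinj
      fun t ht => ?_)
    obtain ⟨I, hI, K, hK, hIK, heq, hle⟩ := hb (γ t)
    have hleJ := hle J (Finset.mem_union_right A hJ)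
    exact ⟨I, hmemB ht hI hleJ, K, hmemB ht hK (heq ▸ hleJ), hIK, heq⟩
  refine hind ⟨b, fun p => ?_⟩
  obtain ⟨I, hI, K, hK, hIK, heq, hmin⟩ := hb (j p)
  have hmemA {I : ι} (hI : I ∈ A ∪ B) (hle : ∀ K ∈ A ∪ B, F I (j p) + b I ≤ F K (j p) + b K) :
      I ∈ A :=
    (Finset.mem_union.1 hI).resolve_right fun hIB => hnot hIB p hle
  exact ⟨I, hmemA hI hmin, K, hmemA hK (heq ▸ hmin), hIK, heq,
    fun k hk => hmin k (Finset.mem_union_left B hk)⟩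

end Path

end Tropical

section Multisets

variable {r m : ℕ} {X X' : Type}

lemma multisetSum_eq_add_mul {ψ : Fin (r + 1) → X → ℝ} {ψ' : Fin (r + 1) → X' → ℝ} {x : X} {y : X'}
    {σ : Fin (r + 1) → ℝ} {t : ℝ} (h : ∀ i, ψ i x = ψ' i y + σ i * t) (I : Sym (Fin (r + 1)) m) :
    multisetSum ψ I x = multisetSum ψ' I y + ((I : Multiset (Fin (r + 1))).map σ).sum * t := by
  rw [multisetSum, multisetSum, ← Multiset.sum_map_mul_right, ← Multiset.sum_map_add]
  exact congrArg _ (Multiset.map_congr rfl fun i _ => h i)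

lemma abs_multisetSum_sub_le {ψ ψ' : Fin (r + 1) → X → ℝ} {c : Fin (r + 1) → ℝ}
    {δ : ℝ} {x y : X} (h : ∀ i, |ψ' i y - ψ i x - c i| ≤ δ) (I : Sym (Fin (r + 1)) m) :
    |multisetSum ψ' I y - multisetSum ψ I x - ((I : Multiset (Fin (r + 1))).map c).sum| ≤
      m * δ := by
  rw [multisetSum, multisetSum, ← Multiset.sum_map_sub, ← Multiset.sum_map_sub]
  refine Multiset.abs_sum_le_sum_abs.trans ?_
  rw [Multiset.map_map]
  refine (Multiset.sum_le_card_nsmul _ δ fun z hz => ?_).trans_eq (by simp)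
  obtain ⟨i, -, rfl⟩ := Multiset.mem_map.1 hz
  exact h i

lemma multisetSum_map_succ (ψ : Fin (r + 1 + 1) → X → ℝ) (I : Sym (Fin (r + 1)) m) (x : X) :
    multisetSum ψ (I.map Fin.succ) x = multisetSum (fun i => ψ i.succ) I x := by
  simp [multisetSum, Multiset.map_map]

/-- The slope of `ψ_i` on the bridge between `s` new loops, put in front of a chain, and the old
ones. -/
def frontSlope (s : ℕ) (i : Fin (r + 1)) : ℤ := if i = 0 then s + 1 else 1 - i

/-- The slope of `ψ_I` on the bridge between the new loops and the old ones. -/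
def frontSlopeSum (s : ℕ) (I : Sym (Fin (r + 1)) m) : ℤ :=
  ((I : Multiset (Fin (r + 1))).map (frontSlope s)).sum

lemma frontSlope_succ (s : ℕ) (i : Fin r) : frontSlope s i.succ = -(i : ℕ) := by
  rw [frontSlope, if_neg (Fin.succ_ne_zero i), Fin.val_succ]
  push_cast
  ring

lemma frontSlope_eq_ite_sub (s : ℕ) (i : Fin (r + 1)) :
    frontSlope s i = (if (i : ℕ) = 0 then (s : ℤ) + 1 else 0) - (i - 1 : ℕ) := by
  refine Fin.cases ?_ (fun i => ?_) i
  · simp [frontSlope]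
  · simp [frontSlope]

lemma cast_frontSlopeSum (s : ℕ) (I : Sym (Fin (r + 1)) m) : (frontSlopeSum s I : ℝ) =
    ((I : Multiset (Fin (r + 1))).map fun i => (frontSlope s i : ℝ)).sum := by
  rw [frontSlopeSum, Int.cast_multiset_sum, Multiset.map_map]
  rfl

lemma frontSlopeSum_map_succ_nonpos (s : ℕ) (I : Sym (Fin r) m) :
    frontSlopeSum s (I.map Fin.succ) ≤ 0 := by
  rw [frontSlopeSum, Sym.coe_map, Multiset.map_map]
  refine (Multiset.sum_le_card_nsmul _ 0 fun z hz => ?_).trans (by simp)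
  obtain ⟨i, -, rfl⟩ := Multiset.mem_map.1 hz
  simp [frontSlope_succ]

lemma exists_frontSlopeSum_eq_sub {s a e : ℕ} (hsr : s ≤ r) (ha : 1 ≤ a) (ham : a ≤ m)
    (hes : e ≤ s) : ∃ I : Sym (Fin (r + 1 + 1)) (m + 1), 0 ∈ I ∧
      frontSlopeSum s I = a * (s + 1) - e := by
  let I : Multiset (Fin (r + 1 + 1)) := Multiset.replicate a 0 +
    Multiset.replicate (m - a) (Fin.succ 0) + {Fin.succ ⟨e, by omega⟩}
  have hI : Multiset.card I = m + 1 := by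
    simp only [I, Multiset.card_add, Multiset.card_replicate, Multiset.card_singleton]
    omega
  refine ⟨⟨I, hI⟩, ?_, ?_⟩
  · rw [Sym.mem_mk]
    simp [I, Multiset.mem_replicate, Nat.one_le_iff_ne_zero.1 ha]
  · simp only [frontSlopeSum, Sym.coe_mk, I, Multiset.map_add, Multiset.map_replicate,
      Multiset.map_singleton, frontSlope_succ]
    simp [frontSlope, sub_eq_add_neg]

lemma exists_frontSlopeSum_eq {s k : ℕ} (hsr : s ≤ r)
    (hk : k = (m + 1) * (s + 1) ∨ k ∈ Finset.Icc 1 (m * (s + 1))) :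
    ∃ I : Sym (Fin (r + 1 + 1)) (m + 1), 0 ∈ I ∧ frontSlopeSum s I = k := by
  rcases hk with rfl | hk
  · refine ⟨Sym.replicate (m + 1) 0, by simp [Sym.mem_replicate], ?_⟩
    rw [frontSlopeSum, Sym.coe_replicate]
    simp [frontSlope, add_one_mul, add_comm]
  · obtain ⟨hk1, hk2⟩ := Finset.mem_Icc.1 hk
    have hdiv := Nat.div_add_mod (k - 1) (s + 1)
    have hmod := Nat.mod_lt (k - 1) (Nat.add_one_pos s)
    have hquot : (k - 1) / (s + 1) < m := (Nat.div_lt_iff_lt_mul s.add_one_pos).2 (by omega)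
    obtain ⟨I, h0, hI⟩ := exists_frontSlopeSum_eq_sub (m := m) (s := s)
      (a := (k - 1) / (s + 1) + 1) (e := s - (k - 1) % (s + 1)) hsr
      (Nat.le_add_left 1 _) hquot (by omega)
    refine ⟨I, h0, hI.trans ?_⟩
    zify [hk1, Nat.lt_succ_iff.1 hmod] at hdiv ⊢
    linarith

lemma exists_finset_injOn_frontSlopeSum {s : ℕ} (hsr : s ≤ r) :
    ∃ B : Finset (Sym (Fin (r + 1 + 1)) (m + 1)), B.card = m * (s + 1) + 1 ∧ (∀ I ∈ B, 0 ∈ I) ∧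
      (∀ I ∈ B, 1 ≤ frontSlopeSum s I) ∧
      Set.InjOn (frontSlopeSum s) (B : Set (Sym (Fin (r + 1 + 1)) (m + 1))) := by
  classical
  let T : Finset ℕ := insert ((m + 1) * (s + 1)) (Finset.Icc 1 (m * (s + 1)))
  choose! φ hφ0 hφ using fun k (hk : k ∈ T) =>
    exists_frontSlopeSum_eq (m := m) (s := s) hsr (Finset.mem_insert.1 hk)
  have hT {k : ℕ} (hk : k ∈ T) : 1 ≤ k := by
    rcases Finset.mem_insert.1 hk with rfl | hk
    · exact Nat.mul_pos m.succ_pos s.succ_pos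
    · exact (Finset.mem_Icc.1 hk).1
  have hinj : Set.InjOn φ T := fun k hk k' hk' h => by
    exact_mod_cast (hφ k hk).symm.trans ((congrArg _ h).trans (hφ k' hk'))
  have hnotMem : (m + 1) * (s + 1) ∉ Finset.Icc 1 (m * (s + 1)) := fun h => by
    linarith [(Finset.mem_Icc.1 h).2]
  refine ⟨T.image φ, ?_, ?_, ?_, ?_⟩
  · rw [Finset.card_image_of_injOn hinj, Finset.card_insert_of_notMem hnotMem, Nat.card_Icc]
    rfl
  · exact Finset.forall_mem_image.2 hφ0
  · exact Finset.forall_mem_image.2 fun k hk => by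
      rw [hφ k hk]
      exact_mod_cast hT hk
  · rw [Finset.coe_image]
    rintro _ ⟨k, hk, rfl⟩ _ ⟨k', hk', rfl⟩ h
    rw [hφ k hk, hφ k' hk'] at h
    rw [Nat.cast_injective h]

end Multisets

section Shift

/-- Moving the chips by `ε` does not take them to another edge. -/
def KeepsSides (g : ℕ) (ε : ℝ) (x : ℕ → Option ℝ) : Prop := ∀ k < g, ∀ u ∈ x k, 0 < u + ε ↔ 0 < u

lemma bottomHinge_sub_topHinge {l k u : ℝ} (h : -l < u ∧ u < k ∧ u ≠ 0) :
    bottomHinge (some u) k - topHinge (some u) l = -u + if 0 < u then k else -l := by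
  simp only [bottomHinge, topHinge, Option.elim_some]
  split_ifs
  · rw [max_eq_left (by linarith)]
    ring
  · rw [max_eq_left (by linarith)]
    ring

lemma abs_bottomHinge_add_sub_le {u ε : ℝ} (hε : 0 ≤ ε) (h : 0 < u + ε ↔ 0 < u) (t : ℝ) :
    |bottomHinge (some (u + ε)) t - bottomHinge (some u) t| ≤ ε := by
  simp only [bottomHinge, Option.elim_some, h]
  split_ifs
  · refine (abs_max_sub_max_le_abs _ _ _).trans (le_of_eq ?_)
    rw [show t - (u + ε) - (t - u) = -ε by ring, abs_neg, abs_of_nonneg hε]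
  · simpa using hε

lemma abs_topHinge_add_sub_le {u ε : ℝ} (hε : 0 ≤ ε) (h : 0 < u + ε ↔ 0 < u) (t : ℝ) :
    |topHinge (some (u + ε)) t - topHinge (some u) t| ≤ ε := by
  simp only [topHinge, Option.elim_some, h]
  split_ifs
  · simpa using hε
  · refine (abs_max_sub_max_le_abs _ _ _).trans (le_of_eq ?_)
    rw [show t + (u + ε) - (t + u) = ε by ring, abs_of_nonneg hε]

variable {g : ℕ} {ℓ m n : ℕ → ℝ} {hℓ : ∀ k, 0 < ℓ k} {hm : ∀ k, 0 < m k} {hn : ∀ k, 0 < n k}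
  {S : ℕ → Prop} {ε : ℝ} {a a' b b' : ℤ} {x x' : ℕ → Option ℝ}

local notation "𝒞" => chainOfLoops g ℓ m n hℓ hm hn

lemma ValidChips.eventually_keepsSides (hx : ValidChips g ℓ m x) :
    ∀ᶠ ε in 𝓝[>] (0 : ℝ), KeepsSides g ε x := by
  suffices h : ∀ k ∈ Finset.range g, ∀ᶠ ε in 𝓝[>] (0 : ℝ), ∀ u ∈ x k, 0 < u + ε ↔ 0 < u by
    filter_upwards [(Filter.eventually_all_finset _).2 h] with ε hε k hk
    exact hε k (Finset.mem_range.2 hk)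
  intro k hk
  rcases hxk : x k with _ | u
  · simp
  have hu := (hx k (Finset.mem_range.1 hk) u hxk).2.2
  filter_upwards [eventually_lt_of_pos (abs_pos.2 hu), self_mem_nhdsWithin] with ε hεu (hε : 0 < ε)
  rintro _ ⟨⟩
  refine ⟨fun h => ?_, fun h => by linarith⟩
  by_contra! hle
  rw [abs_of_nonpos hle] at hεu
  linarith

lemma KeepsSides.abs_hinge_shiftChips_sub_le (hs : KeepsSides g ε x) (hε : 0 ≤ ε) {k : ℕ}
    (hk : k < g) (t : ℝ) :
    |bottomHinge (shiftChips S ε x k) t - bottomHinge (x k) t| ≤ ε ∧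
      |topHinge (shiftChips S ε x k) t - topHinge (x k) t| ≤ ε := by
  rw [shiftChips]
  split_ifs
  · rcases hxk : x k with _ | u
    · simpa [bottomHinge, topHinge] using hε
    · exact ⟨abs_bottomHinge_add_sub_le hε (hs k hk u hxk) t,
        abs_topHinge_add_sub_le hε (hs k hk u hxk) t⟩
  · simpa using hε

open Classical in
lemma KeepsSides.hinge_sub_hinge_shiftChips (hs : KeepsSides g ε x) (hx : ValidChips g ℓ m x)
    (hxε : ValidChips g ℓ m (shiftChips S ε x)) {k : ℕ} (hk : k < g) (h : S k → (x k).isSome) :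
    bottomHinge (shiftChips S ε x k) (m (k + 1)) - topHinge (shiftChips S ε x k) (ℓ (k + 1)) =
      bottomHinge (x k) (m (k + 1)) - topHinge (x k) (ℓ (k + 1)) - if S k then ε else 0 := by
  by_cases hSk : S k
  · obtain ⟨u, hu⟩ := Option.isSome_iff_exists.1 (h hSk)
    have huε : shiftChips S ε x k = some (u + ε) := by
      rw [shiftChips, if_pos hSk, hu, Option.map_some]
    rw [huε, hu, bottomHinge_sub_topHinge (hx k hk u hu),
      bottomHinge_sub_topHinge (hxε k hk _ huε), if_congr (hs k hk u hu) rfl rfl, if_pos hSk]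
    ring
  · rw [shiftChips, if_neg hSk, if_neg hSk, sub_zero]

theorem MetricGraph.LinEquiv.shift (hS : ∀ k < g, S k → (x k).isSome ∧ (x' k).isSome)
    (hx : ValidChips g ℓ m x) (hx' : ValidChips g ℓ m x')
    (hxε : ValidChips g ℓ m (shiftChips S ε x)) (hxε' : ValidChips g ℓ m (shiftChips S ε x'))
    (h : LinEquiv 𝒞 (stdDiv 𝒞 a x b) (stdDiv 𝒞 a' x' b')) :
    LinEquiv 𝒞 (stdDiv 𝒞 a (shiftChips S ε x) b) (stdDiv 𝒞 a' (shiftChips S ε x') b') := by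
  obtain ⟨hdeg, hmoment⟩ := (stdDiv_linEquiv_iff hx hx').1 h
  refine (stdDiv_linEquiv_iff hxε hxε').2 ⟨?_, fun k hk => ?_⟩
  · rwa [chipsLT_shiftChips, chipsLT_shiftChips]
  · rw [chipMoment_shiftChips m a ε fun h => (hS k hk h).1,
      chipMoment_shiftChips m a' ε fun h => (hS k hk h).2, add_sub_add_right_eq_sub]
    exact hmoment k hk

lemma abs_edgeRise_shiftChips_sub_le (hε : 0 ≤ ε)
    (hS : ∀ k < g, S k → (x k).isSome ∧ (x' k).isSome)
    (hx : ValidChips g ℓ m x) (hx' : ValidChips g ℓ m x')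
    (hxε : ValidChips g ℓ m (shiftChips S ε x)) (hxε' : ValidChips g ℓ m (shiftChips S ε x'))
    (hs : KeepsSides g ε x) (hs' : KeepsSides g ε x') (t : ℝ) (e : ChainEdge g) :
    |edgeRise ℓ m a a' (shiftChips S ε x) (shiftChips S ε x') t e -
      edgeRise ℓ m a a' x x' t e| ≤ 2 * ε := by
  -- Both hinge terms change by `ε` when the chips move, so the slopes stay the same.
  have hslope (k : Fin g) : bottomSlope ℓ m a a' (shiftChips S ε x) (shiftChips S ε x') k =
      bottomSlope ℓ m a a' x x' k := by
    have hk := hs.hinge_sub_hinge_shiftChips hx hxε k.2 fun h => (hS k k.2 h).1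
    have hk' := hs'.hinge_sub_hinge_shiftChips hx' hxε' k.2 fun h => (hS k k.2 h).2
    rw [bottomSlope, bottomSlope, chipsLT_shiftChips, chipsLT_shiftChips]
    congr 1
    linarith
  rcases e with k | k | k
  · simp only [edgeRise, chipsLT_shiftChips, sub_self, abs_zero]
    linarith
  all_goals
    have hk := hs.abs_hinge_shiftChips_sub_le (S := S) hε k.2 t
    have hk' := hs'.abs_hinge_shiftChips_sub_le (S := S) hε k.2 t
    rw [edgeRise, edgeRise, hslope]
  · rw [chipsLT_shiftChips, chipsLT_shiftChips]
    have := abs_le.1 hk.2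
    have := abs_le.1 hk'.2
    exact abs_le.2 ⟨by linarith, by linarith⟩
  · have := abs_le.1 hk.1
    have := abs_le.1 hk'.1
    exact abs_le.2 ⟨by linarith, by linarith⟩

theorem exists_abs_sub_sub_le_of_shiftChips (hε : 0 ≤ ε)
    (hS : ∀ k < g, S k → (x k).isSome ∧ (x' k).isSome)
    (hx : ValidChips g ℓ m x) (hx' : ValidChips g ℓ m x')
    (hxε : ValidChips g ℓ m (shiftChips S ε x)) (hxε' : ValidChips g ℓ m (shiftChips S ε x'))
    (hs : KeepsSides g ε x) (hs' : KeepsSides g ε x') {f f' : Point 𝒞 → ℝ}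
    (hf : Carries 𝒞 f (stdDiv 𝒞 a x b) (stdDiv 𝒞 a' x' b'))
    (hf' : Carries 𝒞 f' (stdDiv 𝒞 a (shiftChips S ε x) b) (stdDiv 𝒞 a' (shiftChips S ε x') b')) :
    ∃ c, ∀ p, |f' p - f p - c| ≤ (2 * g + 1) * (2 * ε) := by
  refine ⟨_, abs_sub_leftEnd_le (φ := fun p => f' p - f p) fun e t h0 ht => ?_⟩
  rw [hf.apply_pt hx hx' e h0 ht, hf'.apply_pt hxε hxε' e h0 ht, sub_sub_sub_comm,
    add_sub_cancel_left, add_sub_cancel_left]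
  exact abs_edgeRise_shiftChips_sub_le hε hS hx hx' hxε hxε' hs hs' t e

end Shift

section Deformation

variable {g : ℕ} {ℓ m n : ℕ → ℝ} {hℓ : ∀ k, 0 < ℓ k} {hm : ∀ k, 0 < m k} {hn : ∀ k, 0 < n k}

local notation "𝒞" => chainOfLoops g ℓ m n hℓ hm hn

variable {r q s : ℕ} {x : ℕ → ℕ → Option ℝ}

lemma MaximalRankOn.exists_carries_stdDiv {d : ℤ} (h : MaximalRankOn 𝒞 d r q) :
    ∃ x : ℕ → ℕ → Option ℝ, (∀ i ≤ r, ValidChips g ℓ m (x i)) ∧ chipsLT 0 (x 0) g = d - r ∧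
      ∃ f : Fin (r + 1) → Point 𝒞 → ℝ,
        (∀ i : Fin (r + 1), Carries 𝒞 (f i) (stdDiv 𝒞 0 (x 0) r)
          (stdDiv 𝒞 (i : ℕ) (x i) (r - (i : ℕ)))) ∧
        ∃ A : Finset (Sym (Fin (r + 1)) q),
          (A.card : ℤ) = min ((r + q).choose q : ℤ) (q * d - g + 1) ∧
          TropicallyIndependent A (multisetSum f) := by
  obtain ⟨D, hdeg, -, hva, ψ, hψ, A, hcard, hA⟩ := h
  obtain ⟨x, hx, hD⟩ := hva.exists_stdDiv
  have hψx := hψ.carries_stdDiv hx hD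
  refine ⟨x, hx, ?_, fun i p => ψ i p + -ψ 0 p, fun i => ?_, A, hcard, fun hdep => hA ?_⟩
  · have hdeg₀ := (chain_linEquiv_iff.1 (hD 0 r.zero_le)).1
    rw [deg_stdDiv, hdeg] at hdeg₀
    push_cast at hdeg₀
    linarith
  · have h₀ := hψx 0
    simp only [Fin.val_zero, Nat.cast_zero, sub_zero] at h₀
    exact (hψx i).add h₀.neg (by abel)
  · refine hdep.of_eq_add (c := 0) (e := fun p => q * ψ 0 p) fun I _ p => ?_
    rw [multisetSum_eq_add_mul (ψ' := fun i p => ψ i p + -ψ 0 p) (y := p) (σ := fun _ => 1)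
      (t := ψ 0 p) fun i => by ring]
    simp

lemma TropicallyIndependent.exists_pos_multisetSum {X : Type} {A : Finset (Sym (Fin (r + 1)) q)}
    {f : Fin (r + 1) → X → ℝ} (hf : ∀ i, ∃ M, ∀ p, |f i p| ≤ M)
    (hA : TropicallyIndependent A (multisetSum f)) :
    ∃ δ > 0, ∀ f' : Fin (r + 1) → X → ℝ, (∀ i, ∃ c, ∀ p, |f' i p - f i p - c| ≤ δ) →
      TropicallyIndependent A (multisetSum f') := by
  choose M hM using hf
  have hM' (i : Fin (r + 1)) (p : X) : |f i p - 0 - 0| ≤ ∑ j, |M j| := by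
    rw [sub_zero, sub_zero]
    exact ((hM i p).trans (le_abs_self _)).trans
      (Finset.single_le_sum (f := fun j => |M j|) (fun _ _ => abs_nonneg _) (Finset.mem_univ i))
  have hbounded : ∀ I ∈ A, ∀ p, |multisetSum f I p| ≤ q * ∑ j, |M j| := fun I _ p => by
    simpa [multisetSum] using
      abs_multisetSum_sub_le (ψ := fun _ _ => 0) (c := 0) (x := p) (fun i => hM' i p) I
  obtain ⟨δ, hδ, hind⟩ := hA.exists_pos hbounded
  refine ⟨δ / (q + 1), by positivity, fun f' hf' => hind _ fun I _ => ?_⟩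
  choose c hc using hf'
  refine ⟨_, fun p => (abs_multisetSum_sub_le (fun i => hc i p) I).trans ?_⟩
  rw [mul_div_assoc', div_le_iff₀ (by positivity)]
  linarith

lemma eventually_valid_shiftChips (hx : ∀ i ≤ r, ValidChips g ℓ m (x i)) (S : ℕ → Prop) :
    ∀ᶠ ε in 𝓝[>] (0 : ℝ), ∀ i ≤ r, ValidChips g ℓ m (shiftChips S ε (x i)) ∧
      KeepsSides g ε (x i) := by
  have := (Filter.eventually_all_finite (Set.finite_Iic r)).2 fun i hi =>
    ((hx i hi).eventually_shiftChips S).and (hx i hi).eventually_keepsSides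
  simpa only [Set.mem_Iic] using this

lemma eventually_tropicallyIndependent_shiftChips {S : ℕ → Prop}
    (hS : ∀ k, S k → ∀ i ≤ r, (x i k).isSome) (hx : ∀ i ≤ r, ValidChips g ℓ m (x i))
    {f : Fin (r + 1) → Point 𝒞 → ℝ}
    (hf : ∀ i : Fin (r + 1), Carries 𝒞 (f i) (stdDiv 𝒞 0 (x 0) r)
      (stdDiv 𝒞 (i : ℕ) (x i) (r - (i : ℕ))))
    {A : Finset (Sym (Fin (r + 1)) q)} (hA : TropicallyIndependent A (multisetSum f)) :
    ∀ᶠ ε in 𝓝[>] (0 : ℝ), ∀ f' : Fin (r + 1) → Point 𝒞 → ℝ,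
      (∀ i : Fin (r + 1), Carries 𝒞 (f' i) (stdDiv 𝒞 0 (shiftChips S ε (x 0)) r)
        (stdDiv 𝒞 (i : ℕ) (shiftChips S ε (x i)) (r - (i : ℕ)))) →
      TropicallyIndependent A (multisetSum f') := by
  obtain ⟨δ, hδ, hind⟩ := hA.exists_pos_multisetSum fun i => (hf i).exists_abs_le
  have hg : (0 : ℝ) < (2 * g + 1) * 2 := by positivity
  filter_upwards [eventually_valid_shiftChips hx S, eventually_lt_of_pos (div_pos hδ hg),
    self_mem_nhdsWithin] with ε hε hεδ (hε0 : 0 < ε) f' hf'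
  rw [lt_div_iff₀' hg, mul_assoc] at hεδ
  refine hind f' fun i => ?_
  have hi : (i : ℕ) ≤ r := by omega
  obtain ⟨c, hc⟩ := exists_abs_sub_sub_le_of_shiftChips hε0.le
    (fun k _ hk => ⟨hS k hk 0 r.zero_le, hS k hk i hi⟩) (hx 0 r.zero_le) (hx i hi)
    (hε 0 r.zero_le).1 (hε i hi).1 (hε 0 r.zero_le).2 (hε i hi).2 (hf i) (hf' i)
  exact ⟨c, fun p => (hc p).trans hεδ.le⟩

/-- The chips `Y 0, …, Y (r + 1)` on the loops of the chain `Γ` that will become, after `s` further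
loops have been put in front, the chips of the divisors `D_0, …, D_{r+1}` of a vertex avoiding class
of rank `r + 1`. For `j ≥ 1` they are the chips of the divisor `D_{j-1}` of a class of rank `r` on
`Γ`, and `Y 0` are the chips left when `s + 1` more chips have gone through the chain. -/
structure ExtendableChips {g : ℕ} (Γ : MetricGraph (ChainVertex g) (ChainEdge g)) (ℓ m : ℕ → ℝ)
    (s r : ℕ) (Y : ℕ → ℕ → Option ℝ) : Prop where
  valid : ∀ j ≤ r + 1, ValidChips g ℓ m (Y j)
  linEquiv : ∀ j ≤ r + 1, LinEquiv Γ (stdDiv Γ (if j = 0 then s + 1 else 0) (Y 1) r)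
    (stdDiv Γ (j - 1 : ℕ) (Y j) (r + 1 - j))
  chipsLT_eq : chipsLT 0 (Y 1) g = g - s

lemma stdDiv_linEquiv_transferChips {x : ℕ → Option ℝ} {a b : ℤ} (hx : ValidChips g ℓ m x)
    (hy : ValidChips g ℓ m (transferChips hℓ hm a x)) :
    LinEquiv 𝒞 (stdDiv 𝒞 a x b)
      (stdDiv 𝒞 0 (transferChips hℓ hm a x) (chipsLT a x g - g + b)) := by
  refine (stdDiv_linEquiv_iff hx hy).2 ⟨?_, fun k _ => exists_chipMoment_transferChips hℓ hm a x k⟩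
  rw [chipsLT_transferChips]
  ring

lemma extendableChips_of_transferChips (hx : ∀ i ≤ r, ValidChips g ℓ m (x i))
    (hlin : ∀ i ≤ r, LinEquiv 𝒞 (stdDiv 𝒞 0 (x 0) r) (stdDiv 𝒞 i (x i) (r - i)))
    (htot : chipsLT 0 (x 0) g = g - s)
    (hy : ValidChips g ℓ m (transferChips hℓ hm (s + 1) (x 0))) :
    ExtendableChips 𝒞 ℓ m s r fun j => j.casesOn (transferChips hℓ hm (s + 1) (x 0)) x where
  valid := by
    rintro (_ | i) hi
    · exact hy
    · exact hx i (by omega)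
  linEquiv := by
    rintro (_ | i) hi
    · have hchips : chipsLT (s + 1) (x 0) g - g + r = r + 1 - (0 : ℕ) := by
        rw [← add_zero ((s : ℤ) + 1), chipsLT_add, htot]
        push_cast
        ring
      exact hchips ▸ stdDiv_linEquiv_transferChips (hx 0 r.zero_le) hy
    · rw [Nat.cast_succ, add_sub_add_right_eq_sub]
      exact hlin i (by omega)
  chipsLT_eq := htot

theorem MaximalRankOn.exists_extendableChips {N : ℕ} (hN : s + 1 + r + g ≤ N)
    (hlen : ∀ k < g, N * m (k + 1) < ℓ (k + 1) + m (k + 1))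
    (h : MaximalRankOn 𝒞 (g + r - s) r q) :
    ∃ Y, ExtendableChips 𝒞 ℓ m s r Y ∧ ∃ A : Finset (Sym (Fin (r + 1)) q),
      (A.card : ℤ) = min ((r + q).choose q : ℤ) (q * (g + r - s) - g + 1) ∧
      ∀ f : Fin (r + 1) → Point 𝒞 → ℝ,
        (∀ i : Fin (r + 1), Carries 𝒞 (f i) (stdDiv 𝒞 0 (Y 1) r)
          (stdDiv 𝒞 (i : ℕ) (Y (i + 1)) (r - (i : ℕ)))) →
        TropicallyIndependent A (multisetSum f) := by
  obtain ⟨x, hx, htot, f, hf, A, hcard, hA⟩ := h.exists_carries_stdDiv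
  have htot : chipsLT 0 (x 0) g = g - s := by rw [htot]; ring
  have htot' : chipsLT (s + 1 : ℕ) (x 0) g = g + 1 := by
    rw [← add_zero ((s + 1 : ℕ) : ℤ), chipsLT_add, htot]
    push_cast
    ring
  have hlin : ∀ i ≤ r, LinEquiv 𝒞 (stdDiv 𝒞 0 (x 0) r) (stdDiv 𝒞 i (x i) (r - i)) :=
    fun i hi => ⟨_, hf ⟨i, Nat.lt_succ_of_le hi⟩⟩
  let S : ℕ → Prop := fun k => ∀ i ≤ r, (x i k).isSome
  obtain ⟨ε, ⟨hy, hind⟩, hxε⟩ := ((eventually_validChips_transferChips hN hlen hx hlin htot').and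
    (eventually_tropicallyIndependent_shiftChips (S := S) (fun _ hk => hk) hx hf hA)).and
    (eventually_valid_shiftChips hx S) |>.exists
  have hshift : ∀ i ≤ r, LinEquiv 𝒞 (stdDiv 𝒞 0 (shiftChips S ε (x 0)) r)
      (stdDiv 𝒞 i (shiftChips S ε (x i)) (r - i)) := fun i hi =>
    (hlin i hi).shift (fun k _ hk => ⟨hk 0 r.zero_le, hk i hi⟩) (hx 0 r.zero_le) (hx i hi)
      (hxε 0 r.zero_le).1 (hxε i hi).1
  exact ⟨_, extendableChips_of_transferChips (x := fun i => shiftChips S ε (x i))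
    (fun i hi => (hxε i hi).1) hshift ((chipsLT_shiftChips 0 S ε _ g).trans htot)
    (by exact_mod_cast hy), A, hcard, hind⟩

end Deformation

section FrontChips

/-- The chips of the divisor `D_j` on the loops put in front of a chain: none if `j = 0`, and
otherwise one on each loop, placed so that the `chipMoment` is `0` modulo the length of the loop. -/
def frontChips (ℓ m : ℕ → ℝ) (j k : ℕ) : Option ℝ :=
  if j = 0 then none else some ((k + 1 + j) * m (k + 1) - (ℓ (k + 1) + m (k + 1)))

variable {s : ℕ} {ℓ m : ℕ → ℝ}

lemma frontChips_zero : frontChips ℓ m 0 = fun _ => none := rfl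

lemma frontChips_succ (j : ℕ) : frontChips ℓ m (j + 1) =
    fun k : ℕ => some ((k + 1 + (j + 1 : ℕ)) * m (k + 1) - (ℓ (k + 1) + m (k + 1))) := rfl

lemma chipsLT_frontChips (c : ℤ) (j k : ℕ) :
    chipsLT c (frontChips ℓ m j) k = if j = 0 then c else c + k := by
  rcases j with _ | j
  · rw [frontChips_zero, chipsLT_none, if_pos rfl]
  · rw [frontChips_succ, chipsLT_some, if_neg j.succ_ne_zero]

lemma validChips_frontChips {N j : ℕ} (hm : ∀ k, 0 < m k) (hj : s + j ≤ N)
    (hlen : ∀ k < s, N * m (k + 1) < ℓ (k + 1) + m (k + 1)) :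
    ValidChips s ℓ m (frontChips ℓ m j) := by
  rcases j with _ | j
  · rintro k _ u ⟨⟩
  rintro k hk _ ⟨⟩
  have hN : ((k + 1 + (j + 1) : ℕ) : ℝ) * m (k + 1) ≤ N * m (k + 1) :=
    mul_le_mul_of_nonneg_right (Nat.cast_le.2 (by omega)) (hm _).le
  have hpos : 0 < ((k : ℝ) + (j + 1)) * m (k + 1) := mul_pos (by positivity) (hm _)
  have := hlen k hk
  push_cast at hN ⊢
  exact ⟨by linarith, by linarith [hm (k + 1)], by linarith⟩

lemma exists_chipMoment_frontChips (j k : ℕ) :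
    ∃ z : ℤ, chipMoment m j (frontChips ℓ m j) k - chipMoment m 1 (frontChips ℓ m 1) k =
      z * (ℓ (k + 1) + m (k + 1)) := by
  rcases j with _ | j
  · refine ⟨1, ?_⟩
    simp only [chipMoment, frontChips_succ, frontChips_zero, chipsLT_none, chipsLT_some,
      Option.getD_none, Option.getD_some]
    push_cast
    ring
  · refine ⟨0, ?_⟩
    simp only [chipMoment, frontChips_succ, chipsLT_some, Option.getD_some]
    push_cast
    ring

end FrontChips

section Extension

lemma chipMoment_prependChips_lt {s k : ℕ} (hk : k < s) (m : ℕ → ℝ) (a : ℤ) (h x : ℕ → Option ℝ) :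
    chipMoment m a (prependChips s h x) k = chipMoment m a h k := by
  rw [chipMoment, chipMoment, chipsLT_prependChips_le hk, prependChips_lt hk]

lemma chipsLT_prependChips_eq_sub_add (s k : ℕ) (a c : ℤ) (h x : ℕ → Option ℝ) :
    chipsLT c (prependChips s h x) (k + s) = chipsLT c h s - a + chipsLT a x k := by
  rw [chipsLT_prependChips_add, ← chipsLT_add, sub_add_cancel]

lemma chipMoment_prependChips_add (s k : ℕ) (m : ℕ → ℝ) (a c : ℤ) (h x : ℕ → Option ℝ) :
    chipMoment m c (prependChips s h x) (k + s) = chipMoment (fun k => m (k + s)) a x k -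
      m (k + 1 + s) * (chipsLT c h s - a : ℤ) := by
  rw [chipMoment, chipMoment, prependChips_add, Nat.add_right_comm,
    chipsLT_prependChips_eq_sub_add _ _ a]
  push_cast
  ring

variable {g s : ℕ} {ℓ m n ℓ' m' n' : ℕ → ℝ} {hℓ : ∀ k, 0 < ℓ k} {hm : ∀ k, 0 < m k}
  {hn : ∀ k, 0 < n k} {hℓ' : ∀ k, 0 < ℓ' k} {hm' : ∀ k, 0 < m' k} {hn' : ∀ k, 0 < n' k} {N : ℝ}

local notation "𝒞" => chainOfLoops g ℓ m n hℓ hm hn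

local notation "𝒞'" => chainOfLoops (g + s) ℓ' m' n' hℓ' hm' hn'

theorem MetricGraph.LinEquiv.prependChips (hℓs : ∀ k, ℓ' (k + s) = ℓ k)
    (hms : ∀ k, m' (k + s) = m k)
    {a₁ b₁ a₂ b₂ c₁ c₂ : ℤ} {x₁ x₂ h₁ h₂ : ℕ → Option ℝ}
    (hx₁ : ValidChips g ℓ m x₁) (hx₂ : ValidChips g ℓ m x₂)
    (hX₁ : ValidChips (g + s) ℓ' m' (prependChips s h₁ x₁))
    (hX₂ : ValidChips (g + s) ℓ' m' (prependChips s h₂ x₂))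
    (hc : chipsLT c₁ h₁ s - chipsLT c₂ h₂ s = a₁ - a₂)
    (hmom : ∀ k < s, ∃ z : ℤ, chipMoment m' c₂ h₂ k - chipMoment m' c₁ h₁ k =
      z * (ℓ' (k + 1) + m' (k + 1)))
    (h : LinEquiv 𝒞 (stdDiv 𝒞 a₁ x₁ b₁) (stdDiv 𝒞 a₂ x₂ b₂)) :
    LinEquiv 𝒞' (stdDiv 𝒞' c₁ (prependChips s h₁ x₁) b₁)
      (stdDiv 𝒞' c₂ (prependChips s h₂ x₂) b₂) := by
  obtain ⟨hdeg, hmom'⟩ := (stdDiv_linEquiv_iff hx₁ hx₂).1 h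
  obtain rfl : m = fun k => m' (k + s) := funext fun k => (hms k).symm
  refine (stdDiv_linEquiv_iff hX₁ hX₂).2 ⟨?_, fun k hk => ?_⟩
  · rw [chipsLT_prependChips_eq_sub_add s g a₁ c₁, chipsLT_prependChips_eq_sub_add s g a₂ c₂]
    linarith
  · rcases lt_or_ge k s with hks | hks
    · rw [chipMoment_prependChips_lt hks, chipMoment_prependChips_lt hks]
      exact hmom k hks
    · obtain ⟨k, rfl⟩ := Nat.exists_eq_add_of_le' hks
      obtain ⟨z, hz⟩ := hmom' k (by omega)
      have hc' : chipsLT c₂ h₂ s - a₂ = chipsLT c₁ h₁ s - a₁ := by linarith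
      refine ⟨z, ?_⟩
      rw [chipMoment_prependChips_add s k m' a₁ c₁, chipMoment_prependChips_add s k m' a₂ c₂, hc',
        sub_sub_sub_cancel_right, hz, Nat.add_right_comm, hℓs]

lemma tropicallyIndependent_comp_chainEmbedding {r q : ℕ}
    {ψ : Fin (r + 1 + 1) → Point 𝒞' → ℝ} {H : Fin (r + 1 + 1) → Point 𝒞 → ℝ}
    {c : Fin (r + 1 + 1) → ℝ} {A : Finset (Sym (Fin (r + 1)) q)}
    (hA : TropicallyIndependent A (multisetSum fun i => H i.succ))
    (hψ : ∀ i p, ψ i (chainEmbedding N p) = H i p + c i) :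
    TropicallyIndependent (A.image (Sym.map Fin.succ)) fun I (p : Point 𝒞) =>
      multisetSum ψ I (chainEmbedding N p) := by
  refine TropicallyIndependent.image fun hdep => hA (hdep.of_eq_add (e := 0)
    (c := fun I => -((I : Multiset (Fin (r + 1))).map fun i => c i.succ).sum) fun I _ p => ?_)
  have hsum := multisetSum_eq_add_mul (ψ := fun i => ψ i.succ) (ψ' := fun i => H i.succ)
    (x := chainEmbedding N p) (y := p) (σ := fun i => c i.succ) (t := 1)
    (fun i => by rw [hψ, mul_one]) I
  rw [multisetSum_map_succ, hsum, Pi.zero_apply]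
  ring

lemma tropicallyIndependent_image_succ_union {r q : ℕ}
    {ψ : Fin (r + 1 + 1) → Point 𝒞' → ℝ} {H : Fin (r + 1 + 1) → Point 𝒞 → ℝ}
    {c : Fin (r + 1 + 1) → ℝ} {A : Finset (Sym (Fin (r + 1)) q)}
    {B : Finset (Sym (Fin (r + 1 + 1)) q)} {M : ℝ} (hM : ∀ i p, |H i p| ≤ M)
    (hN : 2 * (q * (2 * M)) < N) (hψ : ∀ i p, ψ i (chainEmbedding N p) = H i p + c i)
    (hslope : ∀ i t, 0 ≤ t → t ≤ N → ψ i (pt 𝒞' (.bridge ⟨s, by omega⟩) t) =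
      ψ i (pt 𝒞' (.bridge ⟨s, by omega⟩) 0) + (frontSlope s i : ℤ) * t)
    (hA : TropicallyIndependent A (multisetSum fun i => H i.succ))
    (hB : ∀ I ∈ B, 1 ≤ frontSlopeSum s I)
    (hinj : Set.InjOn (frontSlopeSum s) (B : Set (Sym (Fin (r + 1 + 1)) q))) :
    TropicallyIndependent (A.image (Sym.map Fin.succ) ∪ B) (multisetSum ψ) := by
  have hγ : pt 𝒞' (.bridge ⟨s, by omega⟩) N =
      chainEmbedding N (.vertex (.w 0) : Point 𝒞) := by
    simp [chainEmbedding, shiftEdge, edgeOffset]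
  refine tropicallyIndependent_of_path (γ := pt 𝒞' (.bridge ⟨s, by omega⟩))
    (j := (chainEmbedding N : Point 𝒞 → Point 𝒞')) (p₀ := .vertex (.w 0))
    hN hγ (fun I _ t h0 ht => ?_) (fun I hI => ?_) hB hinj (fun I _ p => ?_)
    (tropicallyIndependent_comp_chainEmbedding hA hψ)
  · rw [cast_frontSlopeSum]
    exact multisetSum_eq_add_mul (fun i => hslope i t h0 ht) I
  · obtain ⟨J, -, rfl⟩ := Finset.mem_image.1 hI
    exact frontSlopeSum_map_succ_nonpos s J
  · have hvar (i : Fin (r + 1 + 1)) : |ψ i (chainEmbedding N p) -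
        ψ i (chainEmbedding N (.vertex (.w 0) : Point 𝒞)) - (0 : Fin (r + 1 + 1) → ℝ) i| ≤
          2 * M := by
      rw [hψ, hψ, Pi.zero_apply, sub_zero, add_sub_add_right_eq_sub, two_mul]
      exact (abs_sub _ _).trans (add_le_add (hM i _) (hM i _))
    simpa using abs_multisetSum_sub_le hvar I

lemma card_image_succ_union {r q : ℕ} {A : Finset (Sym (Fin (r + 1)) q)}
    {B : Finset (Sym (Fin (r + 1 + 1)) q)} (hB : ∀ I ∈ B, 0 ∈ I) :
    (A.image (Sym.map Fin.succ) ∪ B).card = A.card + B.card := by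
  have hdisj : Disjoint (A.image (Sym.map Fin.succ)) B := by
    refine Finset.disjoint_left.2 fun I hI hIB => ?_
    obtain ⟨J, -, rfl⟩ := Finset.mem_image.1 hI
    obtain ⟨i, -, hi⟩ := Sym.mem_map.1 (hB _ hIB)
    exact Fin.succ_ne_zero i hi
  rw [Finset.card_union_of_disjoint hdisj,
    Finset.card_image_of_injective _ (Sym.map_injective (Fin.succ_injective _) _)]

lemma card_finset_sym_le {r q : ℕ} (S : Finset (Sym (Fin (r + 1)) q)) :
    S.card ≤ (r + q).choose q := by
  refine (Finset.card_le_univ S).trans_eq ?_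
  rw [Sym.card_sym_eq_choose, Fintype.card_fin, Nat.add_right_comm, Nat.add_sub_cancel]

variable {r q N₀ : ℕ} {Y : ℕ → ℕ → Option ℝ}

lemma ExtendableChips.valid_prependChips (hY : ExtendableChips 𝒞 ℓ m s r Y)
    (hN₀ : s + 1 + r ≤ N₀) (hlen : ∀ k < s, N₀ * m' (k + 1) < ℓ' (k + 1) + m' (k + 1))
    (hℓs : ∀ k, ℓ' (k + s) = ℓ k) (hms : ∀ k, m' (k + s) = m k) (hm' : ∀ k, 0 < m' k) {j : ℕ}
    (hj : j ≤ r + 1) : ValidChips (g + s) ℓ' m' (prependChips s (frontChips ℓ' m' j) (Y j)) := by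
  refine (validChips_frontChips hm' (by omega : s + j ≤ N₀) hlen).prependChips ?_
  simpa only [hℓs, hms] using hY.valid j hj

lemma chipsLT_frontChips_sub (s j : ℕ) (ℓ m : ℕ → ℝ) :
    chipsLT 1 (frontChips ℓ m 1) s - chipsLT j (frontChips ℓ m j) s =
      (if j = 0 then (s : ℤ) + 1 else 0) - (j - 1 : ℕ) := by
  rcases j with _ | j
  · simp [chipsLT_frontChips, add_comm]
  · simp [chipsLT_frontChips]

lemma ExtendableChips.linEquiv_prependChips (hY : ExtendableChips 𝒞 ℓ m s r Y)
    (hX : ∀ j ≤ r + 1, ValidChips (g + s) ℓ' m' (prependChips s (frontChips ℓ' m' j) (Y j)))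
    (hℓs : ∀ k, ℓ' (k + s) = ℓ k) (hms : ∀ k, m' (k + s) = m k) {j : ℕ} (hj : j ≤ r + 1) :
    LinEquiv 𝒞' (stdDiv 𝒞' 1 (prependChips s (frontChips ℓ' m' 1) (Y 1)) r)
      (stdDiv 𝒞' j (prependChips s (frontChips ℓ' m' j) (Y j)) ((r + 1 : ℕ) - j)) :=
  (hY.linEquiv j hj).prependChips hℓs hms (hY.valid 1 (by omega)) (hY.valid j hj)
    (hX 1 (by omega)) (hX j hj) (chipsLT_frontChips_sub s j ℓ' m')
    fun k _ => exists_chipMoment_frontChips j k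

lemma MetricGraph.Carries.apply_bridge {a a' b b' : ℤ} {x x' : ℕ → Option ℝ}
    (hx : ValidChips g ℓ m x) (hx' : ValidChips g ℓ m x') {f : Point 𝒞 → ℝ}
    (hf : Carries 𝒞 f (stdDiv 𝒞 a x b) (stdDiv 𝒞 a' x' b')) (k : Fin (g + 1)) {t : ℝ}
    (h0 : 0 ≤ t) (ht : t ≤ n k) : f (pt 𝒞 (.bridge k) t) =
      f (pt 𝒞 (.bridge k) 0) + (chipsLT a x k - chipsLT a' x' k : ℤ) * t := by
  rw [hf.apply_pt hx hx' (.bridge k) h0 ht, pt_zero, edgeRise]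

lemma ExtendableChips.tropicallyIndependent {M : ℝ} (hY : ExtendableChips 𝒞 ℓ m s r Y)
    (hX : ∀ j ≤ r + 1, ValidChips (g + s) ℓ' m' (prependChips s (frontChips ℓ' m' j) (Y j)))
    (hℓs : ∀ k, ℓ' (k + s) = ℓ k) (hms : ∀ k, m' (k + s) = m k)
    (hns : n' s = N + n 0) (hnk : ∀ k, 1 ≤ k → n' (k + s) = n k) (hN0 : 0 ≤ N)
    {H : Fin (r + 1 + 1) → Point 𝒞 → ℝ}
    (hH : ∀ i : Fin (r + 1 + 1), Carries 𝒞 (H i)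
      (stdDiv 𝒞 (if (i : ℕ) = 0 then s + 1 else 0) (Y 1) r)
      (stdDiv 𝒞 (i - 1 : ℕ) (Y i) (r + 1 - (i : ℕ))))
    (hM : ∀ i p, |H i p| ≤ M) (hN : 2 * (q * (2 * M)) < N)
    {A : Finset (Sym (Fin (r + 1)) q)} {B : Finset (Sym (Fin (r + 1 + 1)) q)}
    (hA : TropicallyIndependent A (multisetSum fun i => H i.succ))
    (hB : ∀ I ∈ B, 1 ≤ frontSlopeSum s I)
    (hinj : Set.InjOn (frontSlopeSum s) (B : Set (Sym (Fin (r + 1 + 1)) q)))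
    {ψ : Fin (r + 1 + 1) → Point 𝒞' → ℝ}
    (hψ : ∀ i : Fin (r + 1 + 1), Carries 𝒞' (ψ i)
      (stdDiv 𝒞' 1 (prependChips s (frontChips ℓ' m' 1) (Y 1)) r)
      (stdDiv 𝒞' (i : ℕ) (prependChips s (frontChips ℓ' m' i) (Y i)) ((r + 1 : ℕ) - (i : ℕ)))) :
    TropicallyIndependent (A.image (Sym.map Fin.succ) ∪ B) (multisetSum ψ) := by
  have hi (i : Fin (r + 1 + 1)) : (i : ℕ) ≤ r + 1 := Nat.lt_succ_iff.1 i.2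
  have hchips (i : Fin (r + 1 + 1)) : chipsLT 1 (prependChips s (frontChips ℓ' m' 1) (Y 1)) s -
      chipsLT (i : ℕ) (prependChips s (frontChips ℓ' m' i) (Y i)) s =
        (if (i : ℕ) = 0 then (s : ℤ) + 1 else 0) - (i - 1 : ℕ) := by
    rw [chipsLT_prependChips_le le_rfl, chipsLT_prependChips_le le_rfl, chipsLT_frontChips_sub]
  choose c hc using fun i : Fin (r + 1 + 1) => exists_comp_chainEmbedding_eq_add
    hN0 hns hnk hℓs hms (hY.valid 1 (by omega)) (hY.valid i (hi i)) (hX 1 (by omega)) (hX i (hi i))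
    (fun k _ => prependChips_add s k _ _) (fun k _ => prependChips_add s k _ _) (hchips i)
    (hH i) (hψ i)
  refine tropicallyIndependent_image_succ_union hM hN hc (fun i t h0 ht => ?_) hA hB hinj
  rw [(hψ i).apply_bridge (hX 1 (by omega)) (hX i (hi i)) ⟨s, by omega⟩ h0
    (by rw [hns]; linarith [hn 0]), hchips, frontSlope_eq_ite_sub]

theorem ExtendableChips.maximalRankOn {M : ℝ} (hY : ExtendableChips 𝒞 ℓ m s r Y) (hsr : s ≤ r)
    (hN₀ : s + 1 + r ≤ N₀) (hlen : ∀ k < s, N₀ * m' (k + 1) < ℓ' (k + 1) + m' (k + 1))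
    (hℓs : ∀ k, ℓ' (k + s) = ℓ k) (hms : ∀ k, m' (k + s) = m k)
    (hns : n' s = N + n 0) (hnk : ∀ k, 1 ≤ k → n' (k + s) = n k) (hN0 : 0 ≤ N)
    {H : Fin (r + 1 + 1) → Point 𝒞 → ℝ}
    (hH : ∀ i : Fin (r + 1 + 1), Carries 𝒞 (H i)
      (stdDiv 𝒞 (if (i : ℕ) = 0 then s + 1 else 0) (Y 1) r)
      (stdDiv 𝒞 (i - 1 : ℕ) (Y i) (r + 1 - (i : ℕ))))
    (hM : ∀ i p, |H i p| ≤ M) (hN : 2 * ((q + 1 : ℕ) * (2 * M)) < N)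
    {A : Finset (Sym (Fin (r + 1)) (q + 1))}
    (hcard : (A.card : ℤ) = (q + 1 : ℕ) * (g + r - s) - g + 1)
    (hA : TropicallyIndependent A (multisetSum fun i => H i.succ)) :
    MaximalRankOn 𝒞' (g + r + 1) (r + 1) (q + 1) := by
  have hX (j : ℕ) (hj : j ≤ r + 1) := hY.valid_prependChips hN₀ hlen hℓs hms hm' hj
  have hlin (j : ℕ) (hj : j ≤ r + 1) :=
    hY.linEquiv_prependChips (hℓ' := hℓ') (hm' := hm') (hn' := hn') hX hℓs hms hj
  choose ψ hψ using fun i : Fin (r + 1 + 1) => hlin i (Nat.lt_succ_iff.1 i.2)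
  obtain ⟨B, hBcard, hB0, hB1, hinj⟩ := exists_finset_injOn_frontSlopeSum (m := q) hsr
  have hdeg : chipsLT 1 (prependChips s (frontChips ℓ' m' 1) (Y 1)) (g + s) = g + 1 := by
    rw [chipsLT_prependChips_eq_sub_add s g 0, hY.chipsLT_eq, chipsLT_frontChips,
      if_neg one_ne_zero]
    ring
  have hcard' : ((A.image (Sym.map Fin.succ) ∪ B).card : ℤ) =
      (q + 1 : ℕ) * (g + r + 1) - (g + s : ℕ) + 1 := by
    rw [card_image_succ_union hB0, hBcard, Nat.cast_add, hcard]
    push_cast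
    ring
  refine ⟨_, ?_, hasRank_of_stdDiv hX hlin, vertexAvoiding_of_stdDiv hX hlin, ψ,
    fun i => ?_, A.image (Sym.map Fin.succ) ∪ B, ?_,
    hY.tropicallyIndependent hX hℓs hms hns hnk hN0 hH hM hN hA hB1 hinj hψ⟩
  · rw [deg_stdDiv, hdeg]
    ring
  · have hi := hX i (Nat.lt_succ_iff.1 i.2)
    exact ⟨_, stdDiv_nonneg (Nat.cast_nonneg _) _ (by omega), stdDiv_leftEnd hi,
      stdDiv_rightEnd hi, hψ i⟩
  · rw [← hcard']
    exact (min_eq_right (by exact_mod_cast card_finset_sym_le _)).symm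

end Extension

section Lengths

lemma AdmissibleLoops.add_right {g s : ℕ} {ℓ m : ℕ → ℝ} (hm : ∀ k, 0 < m k)
    (h : AdmissibleLoops (g + s) ℓ m) :
    AdmissibleLoops g (fun k => ℓ (k + s)) (fun k => m (k + s)) := by
  obtain ⟨hratio, hindep⟩ := h
  refine ⟨fun k hk => ?_, fun c hc hsum k hk => ?_⟩
  · rw [Finset.mem_Icc] at hk
    have hk' := hratio (k + s) (Finset.mem_Icc.2 ⟨by omega, by omega⟩)
    have : 0 ≤ 4 * (s : ℝ) * m (k + s) := mul_nonneg (by positivity) (hm _).le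
    push_cast at hk'
    linarith
  have hext : ∑ k ∈ Finset.Icc 1 (g + s), ((if s < k then c (k - s) else 0 : ℤ) : ℝ) * m k = 0 := by
    rw [← hsum, ← Finset.sum_subset (s₁ := Finset.Icc (1 + s) (g + s))
      (Finset.Icc_subset_Icc_left (by omega)), ← Finset.map_add_right_Icc, Finset.sum_map]
    · refine Finset.sum_congr rfl fun i hi => ?_
      rw [addRightEmbedding_apply, if_pos (by have := Finset.mem_Icc.1 hi; omega),
        Nat.add_sub_cancel]
    · intro k hk hk'
      rw [Finset.mem_Icc] at hk hk'
      rw [if_neg (by omega), Int.cast_zero, zero_mul]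
  rw [Finset.mem_Icc] at hk
  have hk' := hindep (fun k => if s < k then c (k - s) else 0) (fun i hi => ?_) hext (k + s)
    (Finset.mem_Icc.2 ⟨by omega, by omega⟩)
  · rwa [if_pos (by omega), Nat.add_sub_cancel] at hk'
  · rw [Finset.mem_Icc] at hi
    split_ifs with his
    · exact (hc (i - s) (Finset.mem_Icc.2 ⟨by omega, by omega⟩)).trans (by push_cast; linarith)
    · rw [abs_zero]
      positivity

/-- The bridge lengths of the chain with `s` new loops in front of the bridges `n`: the leftmost
bridge has length `Q`, those between two new loops have length `P`, and the one joining the new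
loops to the old ones is the old leftmost bridge lengthened by `N`. -/
def extendBridges (s : ℕ) (P Q N : ℝ) (n : ℕ → ℝ) (k : ℕ) : ℝ :=
  if k = 0 then Q else if k < s then P else if k = s then N + n 0 else n (k - s)

variable {g r s : ℕ} {ℓ n : ℕ → ℝ} {C P Q N : ℝ}

lemma extendBridges_zero : extendBridges s P Q N n 0 = Q :=
  if_pos rfl

lemma extendBridges_of_lt {k : ℕ} (hk : k ≠ 0) (hks : k < s) : extendBridges s P Q N n k = P := by
  rw [extendBridges, if_neg hk, if_pos hks]

lemma extendBridges_self (hs : s ≠ 0) : extendBridges s P Q N n s = N + n 0 := by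
  rw [extendBridges, if_neg hs, if_neg (lt_irrefl s), if_pos rfl]

lemma extendBridges_add {k : ℕ} (hk : 1 ≤ k) : extendBridges s P Q N n (k + s) = n k := by
  rw [extendBridges, if_neg (by omega), if_neg (by omega), if_neg (by omega), Nat.add_sub_cancel]

lemma extendBridges_pos (hn : ∀ k, 0 < n k) (hP : 0 < P) (hQ : 0 < Q) (hN : 0 ≤ N) (k : ℕ) :
    0 < extendBridges s P Q N n k := by
  rw [extendBridges]
  split_ifs
  exacts [hQ, hP, add_pos_of_nonneg_of_pos hN (hn 0), hn _]

lemma le_extendBridges (hs : s ≠ 0) (hn : 0 ≤ n 0) (hPQ : P ≤ Q) (hPN : P ≤ N) {k : ℕ}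
    (hk : k ≤ s) : P ≤ extendBridges s P Q N n k := by
  rcases eq_or_ne k 0 with rfl | hk0
  · rwa [extendBridges_zero]
  rcases hk.lt_or_eq with hks | rfl
  · rw [extendBridges_of_lt hk0 hks]
  · rw [extendBridges_self hs]
    linarith

lemma le_extendBridges_add (hs : s ≠ 0) (hN : 0 ≤ N) (k : ℕ) :
    n k ≤ extendBridges s P Q N n (k + s) := by
  rcases Nat.eq_zero_or_pos k with rfl | hk
  · rw [zero_add, extendBridges_self hs]
    linarith
  · rw [extendBridges_add hk]

lemma sum_Ico_one_extendBridges :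
    ∑ i ∈ Finset.Ico 1 s, extendBridges s P Q N n i = (s - 1 : ℕ) * P := by
  rw [Finset.sum_congr rfl fun i hi => extendBridges_of_lt
    (Nat.one_le_iff_ne_zero.1 (Finset.mem_Ico.1 hi).1) (Finset.mem_Ico.1 hi).2]
  simp

lemma sum_Ico_add_extendBridges {a b : ℕ} (ha : 1 ≤ a) :
    ∑ i ∈ Finset.Ico (a + s) (b + s), extendBridges s P Q N n i = ∑ i ∈ Finset.Ico a b, n i := by
  rw [← Finset.map_add_right_Ico, Finset.sum_map]
  exact Finset.sum_congr rfl fun i hi => extendBridges_add (ha.trans (Finset.mem_Ico.1 hi).1)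

lemma sum_Icc_add {M : Type*} [AddCommMonoid M] (f : ℕ → M) (a b s : ℕ) :
    ∑ i ∈ Finset.Icc (a + s) (b + s), f i = ∑ i ∈ Finset.Icc a b, f (i + s) := by
  rw [← Finset.map_add_right_Icc, Finset.sum_map]
  rfl

lemma admissibleBridges_extendBridges (hs : s ≠ 0) (hn : 0 ≤ n 0)
    (h : AdmissibleBridges g r s (fun k => ℓ (k + s)) n C) (hP : ∀ k ∈ Finset.Icc 1 s, C * ℓ k < P)
    (hN0 : 0 ≤ N) (hPQ : P ≤ Q) (hQN : Q ≤ N)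
    (hQ : C * (∑ i ∈ Finset.Icc 1 s, ℓ i + (s - 1 : ℕ) * P) < Q) :
    AdmissibleBridges (g + s) (r + 1) s ℓ (extendBridges s P Q N n) C := by
  have hback := le_extendBridges_add (P := P) (Q := Q) (n := n) hs hN0
  refine ⟨fun k hk => ?_, fun α hα => ?_⟩
  · rw [Finset.mem_Icc] at hk
    rcases le_or_gt k s with hks | hks
    · have hfront (j : ℕ) (hj : j ≤ s) := le_extendBridges hs hn hPQ (hPQ.trans hQN) hj
      exact (hP k (Finset.mem_Icc.2 ⟨hk.1, hks⟩)).trans_le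
        (le_min (hfront _ (by omega)) (hfront _ hks))
    · obtain ⟨j, rfl⟩ := Nat.exists_eq_add_of_le' hks.le
      refine (h.1 j (Finset.mem_Icc.2 ⟨by omega, by omega⟩)).trans_le (min_le_min ?_ (hback j))
      rw [Nat.sub_add_comm (by omega)]
      exact hback _
  · rcases α with _ | α
    · simp only [zero_mul, zero_add, one_mul]
      rw [sum_Ico_one_extendBridges, extendBridges_zero, extendBridges_self hs]
      exact hQ.trans_le (le_min le_rfl (by linarith))
    · rw [Nat.succ_mul (α + 1), Nat.succ_mul α, Nat.add_right_comm _ s 1, sum_Icc_add,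
        sum_Ico_add_extendBridges (by omega), ← Nat.succ_mul]
      refine (h.2 α (by omega)).trans_le (min_le_min ?_ (hback _))
      rw [Nat.succ_mul α]
      exact hback _

theorem exists_admissibleBridges_extendBridges (hs : s ≠ 0) (hn : ∀ k, 0 < n k)
    (h : AdmissibleBridges g r s (fun k => ℓ (k + s)) n C) (L : ℝ) :
    ∃ P Q N : ℝ, L < N ∧ (∀ k, 0 < extendBridges s P Q N n k) ∧
      AdmissibleBridges (g + s) (r + 1) s ℓ (extendBridges s P Q N n) C := by
  obtain ⟨P, hP0, hP⟩ : ∃ P : ℝ, 0 < P ∧ ∀ k ∈ Finset.Icc 1 s, C * ℓ k < P := by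
    refine ⟨∑ k ∈ Finset.Icc 1 s, |C * ℓ k| + 1, by positivity, fun k hk => ?_⟩
    exact (le_abs_self _).trans_lt <| lt_add_of_le_of_pos
      (Finset.single_le_sum (f := fun k => |C * ℓ k|) (fun _ _ => abs_nonneg _) hk) one_pos
  obtain ⟨Q, hQ⟩ := exists_gt (max P (C * (∑ i ∈ Finset.Icc 1 s, ℓ i + (s - 1 : ℕ) * P)))
  obtain ⟨N, hN⟩ := exists_gt (max Q L)
  rw [max_lt_iff] at hQ hN
  have hQ0 := hP0.trans hQ.1
  exact ⟨P, Q, N, hN.2, extendBridges_pos hn hP0 hQ0 (hQ0.trans hN.1).le,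
    admissibleBridges_extendBridges hs (hn 0).le h hP (hQ0.trans hN.1).le hQ.1.le hN.1.le hQ.2⟩

end Lengths

section Existence

variable {g s r q : ℕ} {ℓ m n ℓ' m' : ℕ → ℝ} {hℓ : ∀ k, 0 < ℓ k} {hm : ∀ k, 0 < m k}
  {hn : ∀ k, 0 < n k} {hℓ' : ∀ k, 0 < ℓ' k} {hm' : ∀ k, 0 < m' k}

theorem MaximalRankOn.exists_extension {N₀ : ℕ} (hsr : s ≤ r) (hq : 1 ≤ q)
    (hN₀ : s + 1 + r + g ≤ N₀)
    (hlen : ∀ k < g + s, N₀ * m' (k + 1) < ℓ' (k + 1) + m' (k + 1))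
    (hℓs : ∀ k, ℓ' (k + s) = ℓ k) (hms : ∀ k, m' (k + s) = m k)
    (hsurj : (q : ℤ) * (g + r - s) - g + 1 ≤ ((r + q).choose q : ℤ))
    (h : MaximalRankOn (chainOfLoops g ℓ m n hℓ hm hn) (g + r - s) r q) :
    ∃ L : ℝ, ∀ N > L, ∀ (n' : ℕ → ℝ) (hn' : ∀ k, 0 < n' k), n' s = N + n 0 →
      (∀ k, 1 ≤ k → n' (k + s) = n k) →
      MaximalRankOn (chainOfLoops (g + s) ℓ' m' n' hℓ' hm' hn') (g + r + 1) (r + 1) q := by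
  obtain ⟨q, rfl⟩ := Nat.exists_eq_add_of_le' hq
  have hlen' (k : ℕ) (hk : k < g) : N₀ * m (k + 1) < ℓ (k + 1) + m (k + 1) := by
    rw [← hms, ← hℓs, Nat.add_right_comm]
    exact hlen _ (by omega)
  obtain ⟨Y, hY, A, hcard, hA⟩ := h.exists_extendableChips hN₀ hlen'
  choose H hH using fun i : Fin (r + 1 + 1) => hY.linEquiv i (Nat.lt_succ_iff.1 i.2)
  choose M hM using fun i => (hH i).exists_abs_le
  obtain ⟨M', hM'⟩ := (Set.finite_range M).bddAbove
  refine ⟨max (2 * ((q + 1 : ℕ) * (2 * M'))) 0, fun N hN n' hn' hns hnk => ?_⟩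
  rw [gt_iff_lt, max_lt_iff] at hN
  refine hY.maximalRankOn hsr (by omega) (fun k hk => hlen k (by omega)) hℓs hms hns hnk hN.2.le
    hH (fun i p => (hM i p).trans (hM' (Set.mem_range_self i))) hN.1
    (hcard.trans (min_eq_right hsurj)) (hA _ fun i => ?_)
  simpa [add_sub_add_right_eq_sub] using hH i.succ

end Existence

section MaximalRankConjecture

lemma mrcGenus_succ (r s ρ : ℕ) : mrcGenus (r + 1) s ρ = mrcGenus r s ρ + s := by
  rw [mrcGenus, mrcGenus]
  ring

lemma mrcDegree_succ (r s ρ : ℕ) : mrcDegree (r + 1) s ρ = mrcGenus r s ρ + r + 1 := by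
  rw [mrcDegree, mrcGenus_succ]
  push_cast
  ring

lemma succ_le_mrcGenus {s : ℕ} (hs : 1 ≤ s) (r ρ : ℕ) : r + 1 ≤ mrcGenus r s ρ :=
  (Nat.le_mul_of_pos_right _ hs).trans (Nat.le_add_right _ _)

lemma AdmissibleLoops.mul_lt_add {g : ℕ} {ℓ m : ℕ → ℝ} (hm : ∀ k, 0 < m k)
    (h : AdmissibleLoops g ℓ m) {k : ℕ} (hk : k < g) :
    (4 * g : ℕ) * m (k + 1) < ℓ (k + 1) + m (k + 1) := by
  have hk' := h.1 (k + 1) (Finset.mem_Icc.2 ⟨by omega, by omega⟩)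
  push_cast
  linarith [hm (k + 1)]

end MaximalRankConjecture

end

theorem theorem1p2 (r s ρ m : ℕ) (hs : 1 ≤ s) (hm : 1 ≤ m) (hsr : s ≤ r)
    (hsurj : SurjectiveRange r s ρ m) (h : TropicalMRC r s ρ m) :
    TropicalMRC (r + 1) s ρ m := by
  intro ℓ μ hℓ hμ hadm C
  have hrg := succ_le_mrcGenus hs r ρ
  rw [mrcGenus_succ] at hadm
  rw [mrcGenus_succ, mrcDegree_succ]
  obtain ⟨n, hn, hbr, hmax⟩ := h (fun k => ℓ (k + s)) (fun k => μ (k + s)) (fun _ => hℓ _)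
    (fun _ => hμ _) (hadm.add_right hμ) C
  obtain ⟨L, hL⟩ := hmax.exists_extension (hℓ' := hℓ) (hm' := hμ) hsr hm
    (N₀ := 4 * (mrcGenus r s ρ + s)) (by omega) (fun _ => hadm.mul_lt_add hμ) (fun _ => rfl)
    (fun _ => rfl) hsurj
  have hs0 : s ≠ 0 := Nat.one_le_iff_ne_zero.1 hs
  obtain ⟨P, Q, N, hN, hpos, hbr'⟩ := exists_admissibleBridges_extendBridges hs0 hn hbr L
  exact ⟨extendBridges s P Q N n, hpos, hbr', hL N hN _ hpos (extendBridges_self hs0)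
    fun _ => extendBridges_add⟩
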